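/- A knot is a tame (unoriented) knot $k$ in the 3-sphere $\mathbb S^3$, that is, an embedded circle having a tubular neighbourhood (an open embedding $N:S^1\times\mathbb R^2\to\mathbb S^3$ with $N(S^1\times\{0\})=k$). Its exterior is $E(k)=\mathbb S^3\setminus N(S^1\times\{|w|<1\})$; up to homeomorphism it does not depend on $N$. The infinite cyclic cover $\widetilde E(k)$ is the (unique) connected regular covering of $E(k)$ whose group of deck transformations is infinite cyclic. The knot $k$ has Property $IE$ if $\widetilde E(k)$ embeds topologically into $\mathbb S^3$. The knot $k$ is fibred if $E(k)$ is a locally trivial bundle over $S^1$ with fibre a compact connected surface with boundary. A knot $k$ is a connected sum $k_1\#k_2$ of $k_1$ and $k_2$ if, after ambient isotopies of $k$, $k_1$ and $k_2$ separately, there are a standard 2-sphere in $\mathbb S^3$ bounding closed balls $B_+$ and $B_-$, and an unknotted circle $C$ crossing this sphere perpendicularly at two points and meeting each of the two balls in an unknotted arc, such that $k_1\cap B_-=C\cap B_-$, $k_2\cap B_+=C\cap B_+$, both $k_1$ and $k_2$ coincide with $C$ near the sphere, $k\cap B_+=k_1\cap B_+$ and $k\cap B_-=k_2\cap B_-$.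 (All choices of orientations of the summands are allowed.) **Lemma 4.1.** Let $k_1$ and $k_2$ be two knots in $\mathbb S^3$ and let $k_1\#k_2$ be a connected sum of them. (1) If $k_1\#k_2$ has Property $IE$, then both $k_1$ and $k_2$ have Property $IE$. (2) If $k_1$ has Property $IE$ and $k_2$ is fibred, then $k_1\#k_2$ has Property $IE$. -/

import Mathlib

namespace KnotIE

/-- The 3-sphere. -/
abbrev S3 : Type := Metric.sphere (0 : EuclideanSpace ℝ (Fin 4)) 1

/-- `N` is a tubular neighbourhood of the subset `k` of the 3-sphere: an embedding of `S¹ × ℂ`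
onto an open subset of the 3-sphere that carries the core circle `S¹ × {0}` onto `k`. -/
structure IsTube (N : Circle × ℂ → S3) (k : Set S3) : Prop where
  isOpenEmbedding : Topology.IsOpenEmbedding N
  core : Set.range (fun z : Circle => N (z, 0)) = k

/-- A (tame, unoriented) knot in the 3-sphere: an embedded circle that has a tubular
neighbourhood. -/
structure Knot where
  carrier : Set S3
  tame : ∃ N : Circle × ℂ → S3, IsTube N carrier

/-- The exterior of the core of `N`: the complement of the interior `N (S¹ × {|w| < 1})` of the
compact solid torus `N (S¹ × {|w| ≤ 1})`. -/
def exterior (N : Circle × ℂ → S3) : Set S3 :=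
  (N '' {p | ‖p.2‖ < 1})ᶜ

/-- `p : X → E` is an infinite cyclic cover: a connected covering space whose group of deck
transformations is infinite cyclic, generated by some `τ`, and acts freely and transitively on
each fibre. -/
structure IsInfiniteCyclicCover {X E : Type} [TopologicalSpace X] [TopologicalSpace E]
    (p : X → E) : Prop where
  connected : ConnectedSpace X
  covering : IsCoveringMap p
  surjective : Function.Surjective p
  deck : ∃ τ : X ≃ₜ X,
    (∀ x y, p x = p y ↔ ∃ n : ℤ, (τ ^ n) x = y) ∧ ∀ n : ℤ, n ≠ 0 → ∀ x, (τ ^ n) x ≠ x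

/-- Property IE: the infinite cyclic cover of the exterior of the knot embeds into the
3-sphere. -/
def Knot.PropertyIE (k : Knot) : Prop :=
  ∃ N : Circle × ℂ → S3, IsTube N k.carrier ∧
    ∃ (X : Type) (_ : TopologicalSpace X) (p : X → exterior N),
      IsInfiniteCyclicCover p ∧ ∃ e : X → S3, Topology.IsEmbedding e

/-- A knot is fibred if its exterior is a locally trivial bundle over the circle whose fibre is a
compact connected surface (with boundary). -/
def Knot.IsFibred (k : Knot) : Prop :=
  ∃ N : Circle × ℂ → S3, IsTube N k.carrier ∧
    ∃ (F : Type) (_ : TopologicalSpace F), T2Space F ∧ CompactSpace F ∧ ConnectedSpace F ∧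
      Nonempty (ChartedSpace (EuclideanHalfSpace 2) F) ∧
      ∃ q : exterior N → Circle, ∀ b : Circle, ∃ t : Bundle.Trivialization F q, b ∈ t.baseSet

/-- Two subsets of the 3-sphere are ambient isotopic. -/
def AmbientIsotopic (A B : Set S3) : Prop :=
  ∃ H : unitInterval → (S3 ≃ₜ S3),
    Continuous (fun x : unitInterval × S3 => H x.1 x.2) ∧
      (∀ x, H 0 x = x) ∧ H 1 '' A = B

/-- The great circle `{x₁ = x₂ = 0}`. It crosses the great sphere `{x₃ = 0}` at two points and
meets each of the two hemispheres bounded by that sphere in an unknotted arc. -/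
def greatCircle : Set S3 := {x | x.1 1 = 0 ∧ x.1 2 = 0}

/-- The closed upper side `{c ≤ x₃}` of a horizontal 2-sphere. -/
def above (c : ℝ) : Set S3 := {x | c ≤ x.1 3}

/-- The closed lower side `{x₃ ≤ c}` of a horizontal 2-sphere. -/
def below (c : ℝ) : Set S3 := {x | x.1 3 ≤ c}

/-- `k` is a connected sum `k₁ # k₂`. After ambient isotopies, `k₁` is the union of a knotted arc
in the upper hemisphere and the standard unknotted arc in the lower one, `k₂` is the union of the
standard unknotted arc in the upper hemisphere and a knotted arc in the lower one (both knots
being standard in a neighbourhood of the equatorial 2-sphere), and `k` is the union of the two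
knotted arcs. The knots being unoriented, all connected sums of `k₁` and `k₂`, for all choices of
orientations of the summands, are included. -/
def IsConnectedSum (k k₁ k₂ : Knot) : Prop :=
  ∃ J J₁ J₂ : Set S3,
    AmbientIsotopic k.carrier J ∧
    AmbientIsotopic k₁.carrier J₁ ∧
    AmbientIsotopic k₂.carrier J₂ ∧
    J₁ ∩ below (1 / 2) = greatCircle ∩ below (1 / 2) ∧
    J₂ ∩ above (-(1 / 2)) = greatCircle ∩ above (-(1 / 2)) ∧
    J ∩ above 0 = J₁ ∩ above 0 ∧
    J ∩ below 0 = J₂ ∩ below 0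

end KnotIE

/-!
Infinite cyclic covers are encoded by circle-valued maps. For a closed set `J` in the 3-sphere and
a map `f` from its complement to the circle, `cov J f` is the set of pairs `(x, t)` in `S³ × ℝ` such
that `t` is an angle of `f x`. A partition of unity shows that every infinite cyclic cover of the
exterior is of this form, and radial maps of a tube compare the exterior with the whole complement.
Hence Property IE means that some connected `cov J f` embeds into the 3-sphere, whatever tube is
used (`HasEmbeddedCover`, `Knot.propertyIE_iff`), and it is invariant under homeomorphisms of the
3-sphere. Whether `cov J f` is connected can be read off near a single point of the knot: it is so
exactly when `f` has no local `n`-th roots there for `n ≥ 2` (`IsTube.isConnected_cov_iff`). The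
substance of this criterion is that a root along the meridians extends to the whole complement,
because the local roots form a covering of the 3-sphere, and such a covering has a section
(`exists_section_of_isCoveringMap`). Let now `J` be the sum of `J₁` and `J₂` in standard position.

If a cover of the sum embeds, so does one of each summand (`IsSum.hasEmbeddedCover_left`,
`IsSum.hasEmbeddedCover_right`). The complement of `J₁` embeds into the complement of `J`, by
squeezing the lower hemisphere, in which `J₁` is a standard arc, into a layer just below the
equatorial 2-sphere. The map `f` of the sum pulls back along this embedding, and by the local
criterion the cover it defines is connected. The other summand follows by reflection.

For the converse, the infinite cyclic cover of a fibred knot is the product of a fibre with the line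
(`exists_product_structure`). Compressing the line into an interval shorter than a full turn, over
which the projection to the 3-sphere is injective, embeds the cover into the 3-sphere. This
embedding can be made to agree with the projection near any prescribed point of the cover
(`IsTube.exists_hasLocalProjections`). The cover of the sum consists of the upper part of the cover
of `J₁` and the lower part of the cover of `J₂`, glued along a cover of the twice punctured
equatorial 2-sphere, which is an open disc. The first part can be squeezed
inside the cover of `J₁` so that its face lands on the boundary of a lifted round cap, the inside of
which it leaves free. The second part is squeezed in the same way inside the cover of `J₂`, then
embedded into the 3-sphere by a map that is the projection near the lifted cap, so that its image
stays outside the cap. A conformal inversion turns it into the cap, which is lifted to the cover of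
`J₁`. The two embeddings agree over the equatorial 2-sphere and together embed the cover of the sum
into the cover of `J₁` (`IsSum.hasEmbeddedCover`), and with it into the 3-sphere if `J₁` has
Property IE.
-/

open Topology Set Filter
open scoped unitInterval

namespace KnotIE

/-! ### Embeddings of subsets -/

section Embeddings

variable {α β γ : Type*} [TopologicalSpace α] [TopologicalSpace β] [TopologicalSpace γ]

/-- The restriction of `g` to `s` is a topological embedding. -/
def EmbedsOn (g : α → β) (s : Set α) : Prop := IsEmbedding (fun x : s => g x)

theorem EmbedsOn.continuousOn {g : α → β} {s : Set α} (h : EmbedsOn g s) : ContinuousOn g s :=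
  continuousOn_iff_continuous_domRestrict.2 h.continuous

theorem EmbedsOn.injOn {g : α → β} {s : Set α} (h : EmbedsOn g s) : InjOn g s :=
  injOn_iff_injective.2 h.injective

theorem EmbedsOn.comp {g : α → β} {h : β → γ} {s : Set α} {t : Set β} (hh : EmbedsOn h t)
    (hg : EmbedsOn g s) (hst : MapsTo g s t) : EmbedsOn (h ∘ g) s := by
  have : IsEmbedding (hst.restrict g s t) := by
    refine IsEmbedding.of_comp (g := Subtype.val) ?_ continuous_subtype_val hg
    exact (hg.continuous).subtype_mk _
  exact (show IsEmbedding (fun x : t => h x) from hh).comp this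

theorem EmbedsOn.congr {g h : α → β} {s : Set α} (hg : EmbedsOn g s) (e : EqOn h g s) :
    EmbedsOn h s := by
  have : (fun x : s => h x) = fun x : s => g x := funext fun x => e x.2
  unfold EmbedsOn
  rw [this]; exact hg

theorem EmbedsOn.mono {g : α → β} {s t : Set α} (hg : EmbedsOn g t) (h : s ⊆ t) :
    EmbedsOn g s :=
  (show IsEmbedding (fun x : t => g x) from hg).comp (IsEmbedding.inclusion h)

theorem _root_.Topology.IsEmbedding.exists_embedsOn {s : Set α} {g : s → β} (hg : IsEmbedding g)
    [Nonempty β] : ∃ g' : α → β, EmbedsOn g' s ∧ ∀ y : s, g' y = g y := by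
  classical
  obtain ⟨b⟩ := ‹Nonempty β›
  let g' : α → β := fun y => if hy : y ∈ s then g ⟨y, hy⟩ else b
  have h : ∀ y : s, g' y = g y := fun y => by simp [g', y.2]
  refine ⟨g', ?_, h⟩
  rw [EmbedsOn, funext h]; exact hg

/-- A map with a left inverse that is continuous on a set containing the image is an embedding. -/
theorem embedsOn_of_leftInvOn {g : α → β} {l : β → α} {s : Set α} {t : Set β}
    (hg : ContinuousOn g s) (hst : MapsTo g s t) (hl : ContinuousOn l t) (h : LeftInvOn l g s) :
    EmbedsOn g s := by
  have h1 : IsEmbedding ((fun x : t => l x) ∘ hst.restrict g s t) := by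
    have : (fun x : t => l x) ∘ hst.restrict g s t = Subtype.val := by
      ext x; exact h x.2
    rw [this]; exact IsEmbedding.subtypeVal
  have h2 : Continuous (hst.restrict g s t) :=
    (continuousOn_iff_continuous_domRestrict.1 hg).subtype_mk _
  have h3 := IsEmbedding.of_comp h2 (continuousOn_iff_continuous_domRestrict.1 hl) h1
  exact IsEmbedding.subtypeVal.comp h3

/-- Pasting of continuous maps along two closed sets. -/
theorem continuousOn_of_closed_cover {g : α → β} {s A B : Set α} (hA : IsClosed A)
    (hB : IsClosed B) (hs : s ⊆ A ∪ B) (h1 : ContinuousOn g (s ∩ A))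
    (h2 : ContinuousOn g (s ∩ B)) : ContinuousOn g s := by
  intro x hx
  have e : s = (s ∩ A) ∪ (s ∩ B) := by rw [← inter_union_distrib_left, inter_eq_left.2 hs]
  rw [e]
  refine ContinuousWithinAt.union ?_ ?_
  · by_cases hxA : x ∈ A
    · exact h1 x ⟨hx, hxA⟩
    · have : (𝓝[s ∩ A] x) = ⊥ := by
        rw [← notMem_closure_iff_nhdsWithin_eq_bot]
        exact fun h => hxA (closure_minimal inter_subset_right hA h)
      rw [ContinuousWithinAt, this]; exact tendsto_bot
  · by_cases hxA : x ∈ B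
    · exact h2 x ⟨hx, hxA⟩
    · have : (𝓝[s ∩ B] x) = ⊥ := by
        rw [← notMem_closure_iff_nhdsWithin_eq_bot]
        exact fun h => hxA (closure_minimal inter_subset_right hB h)
      rw [ContinuousWithinAt, this]; exact tendsto_bot

/-- Two embeddings of closed pieces glue to an embedding as soon as closed sets of the target
separate the two images away from the image of the intersection. -/
theorem embedsOn_of_closed_cover {g : α → β} {s A B : Set α} {P Q : Set β} (hA : IsClosed A)
    (hB : IsClosed B) (hs : s ⊆ A ∪ B) (h1 : EmbedsOn g (s ∩ A)) (h2 : EmbedsOn g (s ∩ B))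
    (hP : IsClosed P) (hQ : IsClosed Q) (hAP : MapsTo g (s ∩ A) P) (hBQ : MapsTo g (s ∩ B) Q)
    (hAQ : ∀ x ∈ s, x ∉ B → g x ∉ Q) (hBP : ∀ x ∈ s, x ∉ A → g x ∉ P) : EmbedsOn g s := by
  have hc : ContinuousOn g s :=
    continuousOn_of_closed_cover hA hB hs h1.continuousOn h2.continuousOn
  have hBof : ∀ x ∈ s, g x ∈ Q → x ∈ B := fun x hx h => by
    by_contra hxB; exact hAQ x hx hxB h
  have hAof : ∀ x ∈ s, g x ∈ P → x ∈ A := fun x hx h => by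
    by_contra hxB; exact hBP x hx hxB h
  have hinj : InjOn g s := by
    intro x hx y hy e
    rcases hs hx with hxA | hxB
    · exact h1.injOn ⟨hx, hxA⟩ ⟨hy, hAof y hy (e ▸ hAP ⟨hx, hxA⟩)⟩ e
    · exact h2.injOn ⟨hx, hxB⟩ ⟨hy, hBof y hy (e ▸ hBQ ⟨hx, hxB⟩)⟩ e
  -- convergence of images forces convergence within each piece
  have key : ∀ {C : Set α}, EmbedsOn g (s ∩ C) → ∀ x : s, x.1 ∈ C →
      ∀ U ∈ 𝓝 x.1, ∀ᶠ y in 𝓝 (g x), ∀ z ∈ s ∩ C, g z = y → z ∈ U := by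
    intro C hC x hxC U hU
    have h3 := hC.isInducing.nhds_eq_comap ⟨x.1, x.2, hxC⟩
    have h4 : (Subtype.val ⁻¹' U : Set ↥(s ∩ C)) ∈ 𝓝 ⟨x.1, x.2, hxC⟩ :=
      continuous_subtype_val.continuousAt.preimage_mem_nhds hU
    rw [h3, mem_comap] at h4
    obtain ⟨W, hW, hWU⟩ := h4
    filter_upwards [hW] with y hy z hz hzy
    exact hWU (show (⟨z, hz⟩ : ↥(s ∩ C)) ∈ _ by
      rw [mem_preimage, hzy]; exact hy)
  have key' : ∀ {C : Set α} {R : Set β}, IsClosed R → EmbedsOn g (s ∩ C) →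
      (∀ z ∈ s ∩ C, g z ∈ R) → (∀ z ∈ s, g z ∈ R → z ∈ C) → ∀ x : s,
      ∀ U ∈ 𝓝 x.1, ∀ᶠ y in 𝓝 (g x), ∀ z ∈ s ∩ C, g z = y → z ∈ U := by
    intro C R hR hC hCR hRC x U hU
    by_cases hxC : x.1 ∈ C
    · exact key hC x hxC U hU
    · have : Rᶜ ∈ 𝓝 (g x) := hR.isOpen_compl.mem_nhds fun h => hxC (hRC _ x.2 h)
      filter_upwards [this] with y hy z hz hzy
      exact absurd (hzy ▸ hCR z hz) hy
  refine ⟨⟨?_⟩, injOn_iff_injective.1 hinj⟩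
  refine le_antisymm (continuous_iff_le_induced.1 (continuousOn_iff_continuous_domRestrict.1 hc)) ?_
  rw [le_iff_nhds]
  intro x V hV
  rw [nhds_induced, mem_comap]
  obtain ⟨U, hU, hUV⟩ := mem_nhds_subtype s x V |>.1 hV
  have e1 := key' hP h1 hAP hAof x U hU
  have e2 := key' hQ h2 hBQ hBof x U hU
  refine ⟨_, e1.and e2, ?_⟩
  rintro z ⟨hz1, hz2⟩
  apply hUV
  rcases hs z.2 with hzA | hzB
  · exact hz1 z.1 ⟨z.2, hzA⟩ rfl
  · exact hz2 z.1 ⟨z.2, hzB⟩ rfl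

end Embeddings

/-! ### Angles and degrees of circle-valued maps -/

section CircleMaps

variable {Y : Type*} [TopologicalSpace Y]

theorem exp_int_mul_two_pi (m : ℤ) : Circle.exp (m * (2 * Real.pi)) = 1 := by
  rw [← Circle.exp_zero, Circle.exp_eq_exp]; exact ⟨m, by ring⟩

theorem exp_eq_one_iff {x : ℝ} : Circle.exp x = 1 ↔ ∃ m : ℤ, x = m * (2 * Real.pi) := by
  rw [← Circle.exp_zero, Circle.exp_eq_exp]; simp

theorem exp_zpow (x : ℝ) (m : ℤ) : Circle.exp x ^ m = Circle.exp (m * x) :=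
  (Circle.exp_zsmul x m).symm.trans (by simp)

theorem exp_natpow (x : ℝ) (m : ℕ) : Circle.exp x ^ m = Circle.exp (m * x) := by
  exact_mod_cast exp_zpow x m

/-- Homotopy lifting for the exponential: along a homotopy of circle-valued maps the angle
varies by a continuous real function. -/
theorem exists_angle_of_homotopy (H : I × Y → Circle) (hH : Continuous H) :
    ∃ L : I × Y → ℝ, Continuous L ∧ (∀ y, L (0, y) = 0) ∧
      ∀ s y, H (s, y) = H (0, y) * Circle.exp (L (s, y)) := by
  let K : C(I × Y, Circle) := ⟨fun p => H p * (H (0, p.2))⁻¹, by fun_prop⟩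
  let z : C(Y, ℝ) := ⟨fun _ => 0, by fun_prop⟩
  have h0 : ∀ a, K (0, a) = Circle.exp (z a) := fun a => by simp [K, z]
  refine ⟨Circle.isCoveringMap_exp.liftHomotopy K z h0, map_continuous _, fun y => ?_,
    fun s y => ?_⟩
  · exact Circle.isCoveringMap_exp.liftHomotopy_zero K z h0 y
  · have := congrFun (Circle.isCoveringMap_exp.liftHomotopy_lifts K z h0) (s, y)
    simp only [Function.comp] at this
    rw [this]; simp [K]

/-- The two ends of a homotopy of circle-valued maps on a subset differ by a continuous angle. -/
theorem exists_angle_of_homotopyOn {α : Type*} [TopologicalSpace α] {S : Set α}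
    (H : I × α → Circle) (hH : ContinuousOn H (univ ×ˢ S)) :
    ∃ u : α → ℝ, ContinuousOn u S ∧ ∀ y ∈ S, H (1, y) = H (0, y) * Circle.exp (u y) := by
  classical
  obtain ⟨L, hL, -, h⟩ := exists_angle_of_homotopy (Y := S) (fun p => H (p.1, p.2.1))
    (hH.comp_continuous (by fun_prop) (fun p => ⟨mem_univ _, p.2.2⟩))
  refine ⟨fun y => if hy : y ∈ S then L (1, ⟨y, hy⟩) else 0, ?_, fun y hy => ?_⟩
  · rw [continuousOn_iff_continuous_domRestrict]
    have : (S.domRestrict fun y => if hy : y ∈ S then L (1, ⟨y, hy⟩) else 0)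
        = fun y => L (1, y) := by
      ext y; simp
    rw [this]; fun_prop
  · simp only [hy, dif_pos]
    exact h 1 ⟨y, hy⟩

/-- A circle-valued map on `Y × S¹`, with `Y` connected, has a degree `d` along the circles. -/
theorem exists_degree [PreconnectedSpace Y] (f : Y × Circle → Circle) (hf : Continuous f) :
    ∃ (d : ℤ) (u : Y × Circle → ℝ), Continuous u ∧
      ∀ y z, f (y, z) = f (y, 1) * z ^ d * Circle.exp (u (y, z)) := by
  rcases isEmpty_or_nonempty Y with hY | ⟨⟨y0⟩⟩
  · exact ⟨0, fun _ => 0, continuous_const, fun y => (hY.false y).elim⟩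
  let c : I → Circle := fun s => Circle.exp (2 * Real.pi * s)
  have hc : Continuous c := by fun_prop
  have hc0 : c 0 = 1 := by simp [c]
  have hc1 : c 1 = 1 := by simp [c]
  obtain ⟨L, hL, hL0, h⟩ := exists_angle_of_homotopy (fun p : I × Y => f (p.2, c p.1))
    (by fun_prop)
  -- the angle gained along a full circle is a multiple of `2π` that does not depend on `y`
  have hL1 : ∀ y, ∃ m : ℤ, L (1, y) = m * (2 * Real.pi) := fun y => by
    have := h 1 y
    simp only [hc0, hc1] at this
    rw [← exp_eq_one_iff]; exact mul_eq_left.1 this.symm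
  have hconst : ∀ y, L (1, y) = L (1, y0) := by
    intro y
    have := Circle.isCoveringMap_exp.eq_of_comp_eq (g₁ := fun y => L (1, y) - L (1, y0))
      (g₂ := fun _ => (0 : ℝ)) (by fun_prop) (by fun_prop) (by
        ext y
        obtain ⟨m, hm⟩ := hL1 y
        obtain ⟨m', hm'⟩ := hL1 y0
        simp only [Function.comp, hm, hm']
        rw [← sub_mul, ← Int.cast_sub, exp_int_mul_two_pi]; simp) y0 (by simp)
    linarith [congrFun this y]
  obtain ⟨d, hd⟩ := hL1 y0
  let q : Y × I → Y × Circle := Prod.map id c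
  have hcs : Function.Surjective c := by
    intro z
    obtain ⟨t, ht⟩ := Circle.exp_surjective z
    refine ⟨⟨Int.fract (t / (2 * Real.pi)), Int.fract_nonneg _, (Int.fract_lt_one _).le⟩, ?_⟩
    simp only [c, ← ht]
    rw [Circle.exp_eq_exp]
    refine ⟨-⌊t / (2 * Real.pi)⌋, ?_⟩
    rw [Int.fract]
    have := Real.pi_pos
    push_cast
    field_simp
    ring
  have hq : IsQuotientMap q :=
    ((isProperMap_id).prodMap (hc.isProperMap)).isClosedMap.isQuotientMap
      (continuous_id.prodMap hc) (Function.surjective_id.prodMap hcs)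
  -- without the linear part `2π d s` the angle closes up and descends to `Y × S¹`
  let v : Y × I → ℝ := fun p => L (p.2, p.1) - d * (2 * Real.pi * p.2)
  have hv : Continuous v := by fun_prop
  have hvq : ∀ a b, q a = q b → v a = v b := by
    rintro ⟨y, s⟩ ⟨y', s'⟩ e
    simp only [q, Prod.map, id, Prod.mk.injEq] at e
    obtain ⟨rfl, e⟩ := e
    simp only [c, Circle.exp_eq_exp] at e
    obtain ⟨m, hm⟩ := e
    have hpi := Real.pi_pos
    have hm' : (s : ℝ) = s' + m := by
      have : 2 * Real.pi * (s - s' - m : ℝ) = 0 := by linarith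
      rcases mul_eq_zero.1 this with h | h
      · linarith
      · linarith
    have h1 := s.2; have h2 := s'.2
    have hmcases : m = 0 ∨ m = 1 ∨ m = -1 := by
      have : (m : ℝ) ≤ 1 := by linarith [h1.2, h2.1]
      have : (-1 : ℝ) ≤ m := by linarith [h1.1, h2.2]
      have : m ≤ 1 := by exact_mod_cast ‹(m : ℝ) ≤ 1›
      have : -1 ≤ m := by exact_mod_cast ‹(-1 : ℝ) ≤ m›
      omega
    rcases hmcases with rfl | rfl | rfl
    · have : s = s' := Subtype.ext (by simpa using hm')
      rw [this]
    · have e1 : s = 1 := Subtype.ext (by push_cast at hm' ⊢; linarith [h1.2, h2.1])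
      have e2 : s' = 0 := Subtype.ext (by push_cast at hm' ⊢; linarith [h1.2, h2.1])
      simp only [v, e1, e2, hL0, hconst y, hd]; simp
    · have e1 : s = 0 := Subtype.ext (by push_cast at hm' ⊢; linarith [h1.1, h2.2])
      have e2 : s' = 1 := Subtype.ext (by push_cast at hm' ⊢; linarith [h1.1, h2.2])
      simp only [v, e1, e2, hL0, hconst y, hd]; simp
  obtain ⟨u, hu⟩ : ∃ u : Y × Circle → ℝ, ∀ a, u (q a) = v a := by
    refine ⟨fun b => v (hq.surjective b).choose, fun a => hvq _ _ ?_⟩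
    exact (hq.surjective (q a)).choose_spec
  refine ⟨d, u, ?_, fun y z => ?_⟩
  · rw [hq.continuous_iff]
    exact hv.congr fun a => (hu a).symm
  · obtain ⟨s, rfl⟩ := hcs z
    have h1 := h s y
    simp only [hc0] at h1
    rw [h1, show (y, c s) = q (y, s) from rfl, hu, mul_assoc]
    congr 1
    simp only [c, v]
    rw [exp_zpow, ← Circle.exp_add]
    congr 1; ring

/-- The power map `z ↦ z ^ m` of the circle has no continuous angle unless `m = 0`. This makes the
degree of a circle map well defined. -/
theorem degree_unique {m : ℤ} {c : Circle} {w : Circle → ℝ} (hw : Continuous w)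
    (h : ∀ z : Circle, z ^ m = c * Circle.exp (w z)) : m = 0 := by
  have h1 := h 1
  rw [one_zpow] at h1
  have := Circle.isCoveringMap_exp.eq_of_comp_eq (g₁ := fun s : ℝ => (m * s : ℝ))
      (g₂ := fun s => w (Circle.exp s) - w 1) (by fun_prop) (by fun_prop) (by
        funext s
        simp only [Function.comp]
        rw [← exp_zpow, h, sub_eq_add_neg, Circle.exp_add, Circle.exp_neg,
          eq_inv_of_mul_eq_one_left h1.symm, mul_comm]) 0 (by simp)
  have h2 := congrFun this (2 * Real.pi)
  simp only [Circle.exp_two_pi, sub_self] at h2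
  have := Real.pi_pos
  have h3 : (m : ℝ) = 0 := by
    rcases mul_eq_zero.1 h2 with h | h
    · exact h
    · linarith
  exact_mod_cast h3

/-- A circle map of degree `d` that is an `n`-th power has degree divisible by `n`. -/
theorem dvd_degree_of_root {d : ℤ} {n : ℕ} {c : Circle} {u : Circle → ℝ} (hu : Continuous u)
    {g : Circle → Circle} (hg : Continuous g)
    (h : ∀ z : Circle, c * z ^ d * Circle.exp (u z) = g z ^ n) : (n : ℤ) ∣ d := by
  obtain ⟨e, v, hv, h'⟩ := exists_degree (Y := Unit) (fun p => g p.2) (by fun_prop)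
  refine ⟨e, ?_⟩
  have : d - n * e = 0 := by
    refine degree_unique (c := c⁻¹ * g 1 ^ n) (w := fun z => n * v ((), z) - u z) (by fun_prop) ?_
    intro z
    have h1 := h z
    have h2 := h' () z
    simp only at h2
    rw [h2, mul_pow, mul_pow, ← zpow_natCast (z ^ e), ← zpow_mul, exp_natpow] at h1
    rw [zpow_sub, sub_eq_add_neg, Circle.exp_add, Circle.exp_neg, mul_comm (n : ℤ) e]
    have h3 : z ^ d = c⁻¹ * (c * z ^ d * Circle.exp (u z)) * (Circle.exp (u z))⁻¹ := by
      group
    rw [h3, h1]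
    generalize z ^ (e * (n : ℤ)) = a
    rw [mul_inv_eq_iff_eq_mul]
    simp only [mul_assoc, mul_left_comm, mul_comm]
  linarith

end CircleMaps

/-! ### Coverings of the 3-sphere -/

section Sections

/-- The suspension parametrisation `(s, v) ↦ (sin (π s) v, cos (π s))` of the 3-sphere. -/
noncomputable def suspension (p : I × Metric.sphere (0 : EuclideanSpace ℝ (Fin 3)) 1) : S3 :=
  ⟨!₂[Real.sin (Real.pi * p.1) * p.2.1 0, Real.sin (Real.pi * p.1) * p.2.1 1,
    Real.sin (Real.pi * p.1) * p.2.1 2, Real.cos (Real.pi * p.1)], by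
    have h := p.2.2
    rw [mem_sphere_zero_iff_norm, EuclideanSpace.norm_eq, Real.sqrt_eq_one] at h ⊢
    simp only [Real.norm_eq_abs, sq_abs, Fin.sum_univ_three] at h
    simp only [Real.norm_eq_abs, sq_abs, Fin.sum_univ_four]
    simp
    nlinarith [Real.sin_sq_add_cos_sq (Real.pi * p.1)]⟩

theorem S3_sq_sum (x : S3) : x.1 0 ^ 2 + x.1 1 ^ 2 + x.1 2 ^ 2 + x.1 3 ^ 2 = 1 := by
  have h := x.2
  rw [mem_sphere_zero_iff_norm, EuclideanSpace.norm_eq, Real.sqrt_eq_one] at h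
  simpa only [Real.norm_eq_abs, sq_abs, Fin.sum_univ_four] using h

/-- The point of the 3-sphere with the given coordinates. -/
def mkS3 (a b c d : ℝ) (h : a ^ 2 + b ^ 2 + c ^ 2 + d ^ 2 = 1) : S3 :=
  ⟨!₂[a, b, c, d], by
    rw [mem_sphere_zero_iff_norm, EuclideanSpace.norm_eq, Real.sqrt_eq_one]
    simpa [Fin.sum_univ_four] using h⟩

theorem S3_ext {x y : S3} (h0 : x.1 0 = y.1 0) (h1 : x.1 1 = y.1 1) (h2 : x.1 2 = y.1 2)
    (h3 : x.1 3 = y.1 3) : x = y := by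
  apply Subtype.ext
  ext i
  fin_cases i <;> assumption

theorem continuous_S3_coord (i : Fin 4) : Continuous fun x : S3 => x.1 i := by fun_prop

theorem continuous_suspension : Continuous suspension := by
  unfold suspension
  refine Continuous.subtype_mk ?_ _
  refine (PiLp.continuous_toLp 2 _).comp ?_
  refine continuous_pi fun i => ?_
  fin_cases i <;> simp <;> fun_prop

theorem suspension_three (p) : (suspension p).1 3 = Real.cos (Real.pi * p.1) := by
  simp [suspension]

theorem suspension_eq_iff {s s' : I} {v v'} (h : suspension (s, v) = suspension (s', v')) :
    s = s' ∧ (s = 0 ∨ s = 1 ∨ v = v') := by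
  have hpi := Real.pi_pos
  have h3 : (suspension (s, v)).1 3 = (suspension (s', v')).1 3 := by rw [h]
  rw [suspension_three, suspension_three] at h3
  have hs : s = s' := by
    have := Real.injOn_cos ⟨by have := s.2.1; positivity, by nlinarith [s.2.2]⟩
      ⟨by have := s'.2.1; positivity, by nlinarith [s'.2.2]⟩ h3
    exact Subtype.ext (mul_left_cancel₀ hpi.ne' this)
  subst hs
  refine ⟨rfl, ?_⟩
  by_cases h0 : s = 0
  · exact Or.inl h0
  by_cases h1 : s = 1
  · exact Or.inr (Or.inl h1)
  refine Or.inr (Or.inr ?_)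
  have s0 : 0 < (s : ℝ) := lt_of_le_of_ne s.2.1 fun e => h0 (Subtype.ext e.symm)
  have s1 : (s : ℝ) < 1 := lt_of_le_of_ne s.2.2 fun e => h1 (Subtype.ext e)
  have hsin : Real.sin (Real.pi * s) ≠ 0 :=
    (Real.sin_pos_of_pos_of_lt_pi (by positivity) (by nlinarith)).ne'
  apply Subtype.ext
  ext i
  have e0 : (suspension (s, v)).1 i.castSucc = (suspension (s, v')).1 i.castSucc := by rw [h]
  fin_cases i <;> simpa [suspension, hsin] using e0

theorem suspension_surjective : Function.Surjective suspension := by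
  intro x
  have hx := S3_sq_sum x
  have hpi := Real.pi_pos
  have hb : x.1 3 ^ 2 ≤ 1 := by nlinarith [sq_nonneg (x.1 0), sq_nonneg (x.1 1), sq_nonneg (x.1 2)]
  obtain ⟨hb1, hb2⟩ := abs_le.1 ((sq_le_one_iff_abs_le_one _).1 hb)
  let s : I := ⟨Real.arccos (x.1 3) / Real.pi, by have := Real.arccos_nonneg (x.1 3); positivity,
    by rw [div_le_one hpi]; exact Real.arccos_le_pi _⟩
  have hs : Real.pi * (s : ℝ) = Real.arccos (x.1 3) := by simp only [s]; field_simp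
  have hc : Real.cos (Real.pi * s) = x.1 3 := by rw [hs, Real.cos_arccos hb1 hb2]
  have hsn : Real.sin (Real.pi * s) = √(1 - x.1 3 ^ 2) := by rw [hs, Real.sin_arccos]
  set r := √(1 - x.1 3 ^ 2) with hr
  have hr2 : r ^ 2 = x.1 0 ^ 2 + x.1 1 ^ 2 + x.1 2 ^ 2 := by
    rw [hr, Real.sq_sqrt (by linarith)]; linarith
  by_cases h0 : r = 0
  · have hz : x.1 0 = 0 ∧ x.1 1 = 0 ∧ x.1 2 = 0 := by
      rw [h0] at hr2
      refine ⟨?_, ?_, ?_⟩ <;> nlinarith [sq_nonneg (x.1 0), sq_nonneg (x.1 1), sq_nonneg (x.1 2)]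
    refine ⟨(s, ⟨!₂[1, 0, 0], by
      rw [mem_sphere_zero_iff_norm, EuclideanSpace.norm_eq, Real.sqrt_eq_one]
      simp [Fin.sum_univ_three]⟩), S3_ext ?_ ?_ ?_ ?_⟩ <;>
    simp [suspension, hsn, h0, hz, hc]
  · refine ⟨(s, ⟨!₂[x.1 0 / r, x.1 1 / r, x.1 2 / r], by
      rw [mem_sphere_zero_iff_norm, EuclideanSpace.norm_eq, Real.sqrt_eq_one]
      simp [Fin.sum_univ_three]
      field_simp; linarith⟩), S3_ext ?_ ?_ ?_ ?_⟩ <;>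
    simp [suspension, hsn, hc] <;> field_simp

/-- The 3-sphere being simply connected, every covering of it has a section. It is found by
lifting the suspension parametrisation, a homotopy from a constant map of the 2-sphere. -/
theorem exists_section_of_isCoveringMap {E : Type*} [TopologicalSpace E] {p : E → S3}
    (hp : IsCoveringMap p) (hs : Function.Surjective p) :
    ∃ s : S3 → E, Continuous s ∧ ∀ x, p (s x) = x := by
  have : PreconnectedSpace (Metric.sphere (0 : EuclideanSpace ℝ (Fin 3)) 1) := by
    apply isPreconnected_iff_preconnectedSpace.1
    refine (isConnected_sphere ?_ _ zero_le_one).isPreconnected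
    rw [← Module.finrank_eq_rank]
    simp
  obtain ⟨e0, he0⟩ := hs (mkS3 0 0 0 1 (by norm_num))
  let H : C(I × Metric.sphere (0 : EuclideanSpace ℝ (Fin 3)) 1, S3) :=
    ⟨suspension, continuous_suspension⟩
  let z : C(Metric.sphere (0 : EuclideanSpace ℝ (Fin 3)) 1, E) := ⟨fun _ => e0, by fun_prop⟩
  have h0 : ∀ a, H (0, a) = p (z a) := fun a => by
    simp only [H, z, ContinuousMap.coe_mk, he0]
    apply S3_ext <;> simp [suspension, mkS3]
  let L := hp.liftHomotopy H z h0
  have hL : ∀ q, p (L q) = suspension q := fun q =>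
    congrFun (hp.liftHomotopy_lifts H z h0) q
  have hL0 : ∀ a, L (0, a) = e0 := fun a => hp.liftHomotopy_zero H z h0 a
  have hL1 : ∀ a b, L (1, a) = L (1, b) := fun a b => by
    refine hp.const_of_comp (g := fun a => L (1, a)) (by fun_prop) (fun a b => ?_) a b
    rw [hL, hL]
    apply S3_ext <;> simp [suspension]
  have hq : IsQuotientMap suspension :=
    continuous_suspension.isClosedMap.isQuotientMap continuous_suspension suspension_surjective
  have hLq : ∀ a b, suspension a = suspension b → L a = L b := by
    rintro ⟨s, v⟩ ⟨s', v'⟩ e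
    obtain ⟨rfl, rfl | rfl | rfl⟩ := suspension_eq_iff e
    · rw [hL0, hL0]
    · exact hL1 _ _
    · rfl
  refine ⟨fun x => L (suspension_surjective x).choose, ?_, fun x => ?_⟩
  · rw [hq.continuous_iff]
    refine (map_continuous L).congr fun a => ?_
    exact hLq _ _ (suspension_surjective (suspension a)).choose_spec.symm
  · rw [hL]; exact (suspension_surjective x).choose_spec

end Sections

/-! ### Roots of circle-valued maps -/

section Roots

/-- An `n`-th root of `b`, continuous in `b` as long as `b` is not opposite to `a`. -/
noncomputable def rootNear (n : ℕ) (a b : Circle) : Circle :=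
  Circle.exp ((a : ℂ).arg / n) * Circle.exp (((b * a⁻¹ : Circle) : ℂ).arg / n)

theorem rootNear_pow {n : ℕ} (hn : n ≠ 0) (a b : Circle) : rootNear n a b ^ n = b := by
  have : (n : ℝ) ≠ 0 := by exact_mod_cast hn
  rw [rootNear, mul_pow, exp_natpow, exp_natpow, mul_div_cancel₀ _ this, mul_div_cancel₀ _ this,
    Circle.exp_arg, Circle.exp_arg]
  simp

theorem continuousOn_rootNear {n : ℕ} (a : Circle) :
    ContinuousOn (rootNear n a) {b | ((b * a⁻¹ : Circle) : ℂ) ∈ Complex.slitPlane} := by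
  have : ContinuousOn (fun b : Circle => ((b * a⁻¹ : Circle) : ℂ).arg)
      {b | ((b * a⁻¹ : Circle) : ℂ) ∈ Complex.slitPlane} := fun b hb =>
    (ContinuousAt.comp (f := fun b : Circle => ((b * a⁻¹ : Circle) : ℂ))
      (Complex.continuousAt_arg hb) (by fun_prop)).continuousWithinAt
  unfold rootNear
  fun_prop

theorem isOpen_rootNear_domain (a : Circle) :
    IsOpen {b : Circle | ((b * a⁻¹ : Circle) : ℂ) ∈ Complex.slitPlane} :=
  Complex.isOpen_slitPlane.preimage (f := fun b : Circle => ((b * a⁻¹ : Circle) : ℂ)) (by fun_prop)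

theorem mem_rootNear_domain (a : Circle) :
    a ∈ {b : Circle | ((b * a⁻¹ : Circle) : ℂ) ∈ Complex.slitPlane} := by
  simp

theorem finite_circle_roots {n : ℕ} (hn : n ≠ 0) : Finite {s : Circle // s ^ n = 1} := by
  have h : Set.Finite {z : ℂ | z ^ n = 1} := by
    refine ((Polynomial.nthRootsFinset n (1 : ℂ)).finite_toSet).subset fun z hz => ?_
    simpa [Polynomial.mem_nthRootsFinset (Nat.pos_of_ne_zero hn)] using hz
  have := h.to_subtype
  refine Finite.of_injective (β := {z : ℂ | z ^ n = 1})
    (fun s => ⟨s.1, by have := congrArg (fun t : Circle => (t : ℂ)) s.2; simpa using this⟩) ?_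
  intro a b e
  simpa [Subtype.ext_iff, Circle.ext_iff] using e

open Classical in
/-- If near `J` the function `f` is an `n`-th power up to a factor `G` that extends
over `J`, then `f` has an `n`-th root on the complement of `J`: the local roots of `f`, together
with the local roots of `G` across `J`, form a covering of the 3-sphere, which has a section. -/
theorem exists_root_of_factor {J T : Set S3} (hJ : IsClosed J) (hT : IsOpen T) (hJT : J ⊆ T)
    {n : ℕ} (hn : n ≠ 0) {f F G : S3 → Circle} (hf : ContinuousOn f Jᶜ)
    (hF : ContinuousOn F (T \ J)) (hG : ContinuousOn G T)
    (h : ∀ x ∈ T \ J, f x = F x ^ n * G x) :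
    ∃ g : S3 → Circle, ContinuousOn g Jᶜ ∧ ∀ x ∈ Jᶜ, g x ^ n = f x := by
  -- `k x` is a root of `f` near `x` off `J`. For `x` in `J` it is the product of `F` with a root
  -- of `G` that is defined on `J` as well; the transition functions `ra` are computed with that
  -- root on `J`, and so are continuous across `J`.
  let D : Circle → Set Circle := fun a => {b | ((b * a⁻¹ : Circle) : ℂ) ∈ Complex.slitPlane}
  let U : S3 → Set S3 := fun x => if x ∈ J then T ∩ G ⁻¹' D (G x) else Jᶜ ∩ f ⁻¹' D (f x)
  let g : S3 → S3 → Circle := fun x y =>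
    if x ∈ J then rootNear n (G x) (G y) else rootNear n (f x) (f y)
  let k : S3 → S3 → Circle := fun x y => if x ∈ J then g x y * F y else g x y
  let ra : S3 → S3 → S3 → Circle := fun i j y =>
    if y ∈ J then g i y * (g j y)⁻¹ else k i y * (k j y)⁻¹
  have hU : ∀ x, IsOpen (U x) := fun x => by
    by_cases hx : x ∈ J
    · simp only [U, hx, if_pos]
      exact hG.isOpen_inter_preimage hT (isOpen_rootNear_domain _)
    · simp only [U, hx, if_neg, not_false_eq_true]
      exact hf.isOpen_inter_preimage hJ.isOpen_compl (isOpen_rootNear_domain _)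
  have hxU : ∀ x, x ∈ U x := fun x => by
    by_cases hx : x ∈ J
    · simp only [U, hx, if_pos]
      exact ⟨hJT hx, mem_rootNear_domain _⟩
    · simp only [U, hx, if_neg, not_false_eq_true]
      exact ⟨hx, mem_rootNear_domain _⟩
  have hUJ : ∀ x y, y ∈ U x → y ∈ J → x ∈ J := fun x y hy hyJ => by
    by_contra hx
    simp only [U, hx, if_neg, not_false_eq_true] at hy
    exact hy.1 hyJ
  have hUT : ∀ x ∈ J, U x ⊆ T := fun x hx y hy => by
    simp only [U, hx, if_pos] at hy; exact hy.1
  have hg : ∀ x ∈ J, ContinuousOn (g x) (U x) := fun x hx => by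
    simp only [U, g, hx, if_pos]
    exact (continuousOn_rootNear _).comp (hG.mono inter_subset_left) fun y hy => hy.2
  have hgJ : ∀ x ∈ J, ∀ y, g x y ^ n = G y := fun x hx y => by
    simp only [g, hx, if_pos]; exact rootNear_pow hn _ _
  have hk : ∀ x, ContinuousOn (k x) (U x ∩ Jᶜ) := fun x => by
    by_cases hx : x ∈ J
    · have : k x = fun y => g x y * F y := by funext y; simp [k, hx]
      rw [this]
      exact ((hg x hx).mono inter_subset_left).mul
        (hF.mono fun y hy => ⟨hUT x hx hy.1, hy.2⟩)
    · simp only [U, k, g, hx, if_neg, not_false_eq_true]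
      exact (continuousOn_rootNear _).comp (hf.mono fun y hy => hy.2) fun y hy => hy.1.2
  have hkn : ∀ x, ∀ y ∈ U x ∩ Jᶜ, k x y ^ n = f y := fun x y hy => by
    by_cases hx : x ∈ J
    · simp only [k, hx, if_pos]
      rw [h y ⟨hUT x hx hy.1, hy.2⟩, mul_pow, hgJ x hx, mul_comm]
    · simp only [k, g, hx, if_neg, not_false_eq_true]; exact rootNear_pow hn _ _
  have hra : ∀ i j, ∀ y ∈ U i ∩ U j, ra i j y ^ n = 1 := fun i j y hy => by
    by_cases hyJ : y ∈ J
    · simp only [ra, hyJ, if_pos]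
      rw [mul_pow, inv_pow, hgJ i (hUJ i y hy.1 hyJ), hgJ j (hUJ j y hy.2 hyJ), mul_inv_cancel]
    · simp only [ra, hyJ, if_neg, not_false_eq_true]
      rw [mul_pow, inv_pow, hkn i y ⟨hy.1, hyJ⟩, hkn j y ⟨hy.2, hyJ⟩, mul_inv_cancel]
  have hrac : ∀ i j, ContinuousOn (ra i j) (U i ∩ U j) := fun i j => by
    by_cases hij : i ∈ J ∧ j ∈ J
    · have : EqOn (ra i j) (fun y => g i y * (g j y)⁻¹) (U i ∩ U j) := fun y _ => by
        simp only [ra, k, hij.1, hij.2, if_pos]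
        split_ifs
        · rfl
        · rw [mul_inv, mul_mul_mul_comm, mul_inv_cancel, mul_one]
      refine ContinuousOn.congr ?_ this
      exact ((hg i hij.1).mono inter_subset_left).mul ((hg j hij.2).mono inter_subset_right).inv
    · have hd : ∀ y ∈ U i ∩ U j, y ∉ J := fun y hy hyJ =>
        hij ⟨hUJ i y hy.1 hyJ, hUJ j y hy.2 hyJ⟩
      have : EqOn (ra i j) (fun y => k i y * (k j y)⁻¹) (U i ∩ U j) := fun y hy => by
        simp only [ra, hd y hy, if_neg, not_false_eq_true]
      refine ContinuousOn.congr ?_ this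
      exact ((hk i).mono fun y hy => ⟨hy.1, hd y hy⟩).mul
        ((hk j).mono fun y hy => ⟨hy.2, hd y hy⟩).inv
  -- the local roots are glued to a bundle with fibre the group of `n`-th roots of unity
  have := finite_circle_roots hn
  let cc : S3 → S3 → S3 → {s : Circle // s ^ n = 1} → {s : Circle // s ^ n = 1} :=
    fun i j y v => if e : ra i j y ^ n = 1 then ⟨ra i j y * v.1, by
      rw [mul_pow, e, v.2, one_mul]⟩ else v
  have hcc : ∀ i j, ∀ y ∈ U i ∩ U j, ∀ v, (cc i j y v).1 = ra i j y * v.1 := by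
    intro i j y hy v
    simp only [cc, hra i j y hy, dif_pos]
  let Z : FiberBundleCore S3 S3 {s : Circle // s ^ n = 1} :=
    { baseSet := U
      isOpen_baseSet := hU
      indexAt := id
      mem_baseSet_at := hxU
      coordChange := cc
      coordChange_self := fun i x hx v => by
        apply Subtype.ext
        rw [hcc i i x ⟨hx, hx⟩]
        simp [ra]
      continuousOn_coordChange := fun i j => by
        refine IsEmbedding.subtypeVal.isInducing.continuousOn_iff.2 ?_
        have : EqOn (Subtype.val ∘ fun p : S3 × {s : Circle // s ^ n = 1} => cc i j p.1 p.2)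
          (fun p => ra i j p.1 * p.2.1) ((U i ∩ U j) ×ˢ univ) := fun p hp => hcc i j p.1 hp.1 p.2
        refine ContinuousOn.congr ?_ this
        exact ((hrac i j).comp continuousOn_fst fun p hp => hp.1).mul
          (by fun_prop)
      coordChange_comp := fun i j l x hx v => by
        apply Subtype.ext
        rw [hcc j l x ⟨hx.1.2, hx.2⟩, hcc i j x hx.1, hcc i l x ⟨hx.1.1, hx.2⟩, ← mul_assoc]
        congr 1
        simp only [ra]
        split_ifs <;> rw [mul_comm, mul_assoc, inv_mul_cancel_left] }
  have hcov : IsCoveringMap Z.proj := FiberBundle.isCoveringMap (F := {s : Circle // s ^ n = 1})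
  obtain ⟨s, hs, hps⟩ := exists_section_of_isCoveringMap hcov (fun x => ⟨⟨x, ⟨1, one_pow n⟩⟩, rfl⟩)
  have hps' : ∀ x, (s x).1 = x := hps
  let v : S3 → {s : Circle // s ^ n = 1} := fun x => (s x).2
  refine ⟨fun x => (v x).1 * k x x, ?_, ?_⟩
  · intro y hy
    have hUy : U y ∈ 𝓝 y := (hU y).mem_nhds (hxU y)
    have hw : ContinuousAt (fun x => (Z.localTriv y (s x)).2.1) y := by
      have h1 : ContinuousAt (Z.localTriv y) (s y) :=
        (Z.localTriv y).continuousAt (by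
          rw [FiberBundleCore.mem_localTriv_source, hps']
          exact hxU y)
      exact continuous_subtype_val.continuousAt.comp (continuous_snd.continuousAt.comp
        (h1.comp hs.continuousAt))
    have hky : ContinuousAt (k y) y :=
      (hk y).continuousAt (inter_mem hUy (hJ.isOpen_compl.mem_nhds hy))
    refine ((hw.mul hky).congr ?_).continuousWithinAt
    filter_upwards [hUy, hJ.isOpen_compl.mem_nhds hy] with x hx hxJ
    have e1 : (Z.localTriv y (s x)).2 = cc (s x).1 y (s x).1 (s x).2 := rfl
    change (Z.localTriv y (s x)).2.1 * k y x = _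
    rw [e1]
    have e2 : (cc (s x).1 y (s x).1 (s x).2).1 = ra (s x).1 y (s x).1 * (s x).2.1 :=
      hcc _ _ _ (by rw [hps' x]; exact ⟨hxU x, hx⟩) _
    rw [e2, hps' x]
    have hxJ' : x ∉ J := hxJ
    simp only [ra, hxJ', if_neg, not_false_eq_true]
    rw [mul_right_comm, inv_mul_cancel_right, mul_comm]
  · intro x hx
    simp only
    rw [mul_pow, (v x).2, one_mul, hkn x x ⟨hxU x, hx⟩]

end Roots

/-! ### Infinite cyclic covers of complements -/

section Covers

/-- The total space, inside `S³ × ℝ`, of the infinite cyclic cover of the complement of `J`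
classified by a circle-valued map `f`: the pairs `(x, t)` such that `t` is an angle of `f x`. -/
def cov (J : Set S3) (f : S3 → Circle) : Set (S3 × ℝ) := {p | p.1 ∉ J ∧ f p.1 = Circle.exp p.2}

theorem cov_nonempty {J : Set S3} {f : S3 → Circle} {x : S3} (hx : x ∉ J) :
    ∃ t, (x, t) ∈ cov J f :=
  ⟨((f x : Circle) : ℂ).arg, hx, (Circle.exp_arg _).symm⟩

theorem add_mem_cov {J : Set S3} {f : S3 → Circle} {x : S3} {t : ℝ} (h : (x, t) ∈ cov J f)
    (m : ℤ) : (x, t + m * (2 * Real.pi)) ∈ cov J f :=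
  ⟨h.1, by rw [h.2, Circle.exp_add, exp_int_mul_two_pi, mul_one]⟩

/-- The map classifying a connected infinite cyclic cover has no roots. -/
theorem not_root_of_isPreconnected {J : Set S3} {f g : S3 → Circle} (hc : IsPreconnected (cov J f))
    (hJ : Jᶜ.Nonempty) {n : ℕ} (hn : 2 ≤ n) (hg : ContinuousOn g Jᶜ)
    (h : ∀ x ∈ Jᶜ, g x ^ n = f x) : False := by
  have hn0 : n ≠ 0 := by omega
  have hn0' : (n : ℝ) ≠ 0 := by exact_mod_cast hn0
  obtain ⟨x, hx⟩ := hJ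
  obtain ⟨t, ht⟩ := cov_nonempty (f := f) hx
  have hfin := finite_circle_roots hn0
  have hd : IsDiscrete {s : Circle | s ^ n = 1} := by
    have : DiscreteTopology {s : Circle | s ^ n = 1} :=
      @Finite.instDiscreteTopology _ _ _ hfin
    exact ⟨this⟩
  have hcont : ContinuousOn (fun p : S3 × ℝ => Circle.exp (p.2 / n) * (g p.1)⁻¹) (cov J f) :=
    ContinuousOn.mul (by fun_prop)
      (hg.comp continuousOn_fst fun p hp => hp.1).inv
  -- comparing `g` with the root given by the angle yields a locally constant map to the roots of
  -- unity, which changes under the deck transformation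
  have key := hc.constant_of_mapsTo hd hcont (fun p hp => by
    simp only [mem_ofPred_eq]
    rw [mul_pow, exp_natpow, mul_div_cancel₀ _ hn0', ← hp.2, inv_pow, h _ hp.1, mul_inv_cancel])
    ht (add_mem_cov ht 1)
  simp only [mul_left_inj] at key
  rw [Circle.exp_eq_exp] at key
  obtain ⟨m, hm⟩ := key
  have hpi := Real.pi_pos
  have h2 : (1 : ℝ) + m * n = 0 := by
    field_simp at hm
    push_cast at hm
    have : 2 * Real.pi * (1 + m * n) = 0 := by linarith
    rcases mul_eq_zero.1 this with h | h
    · linarith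
    · exact h
  have h3 : (1 : ℤ) + m * n = 0 := by exact_mod_cast h2
  have h4 : (n : ℤ) ∣ 1 := ⟨-m, by linarith⟩
  have := Int.le_of_dvd one_pos h4
  omega

end Covers

/-! ### Degrees on meridians and connectedness of covers -/

section Tubes

variable {N : Circle × ℂ → S3} {J : Set S3}

theorem IsTube.mem_iff (hN : IsTube N J) {p : Circle × ℂ} : N p ∈ J ↔ p.2 = 0 := by
  rw [← hN.core]
  constructor
  · rintro ⟨z, hz⟩
    rw [← hN.isOpenEmbedding.injective hz]
  · intro h
    exact ⟨p.1, by rw [← h]⟩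

theorem IsTube.subset_range (hN : IsTube N J) : J ⊆ range N := by
  rw [← hN.core]
  rintro _ ⟨z, rfl⟩
  exact ⟨_, rfl⟩

theorem IsTube.continuous (hN : IsTube N J) : Continuous N := hN.isOpenEmbedding.continuous

theorem IsTube.isClosed (hN : IsTube N J) : IsClosed J := by
  rw [← hN.core]
  exact (isCompact_range (hN.continuous.comp (by fun_prop))).isClosed

theorem IsTube.image_homeomorph (hN : IsTube N J) (Φ : S3 ≃ₜ S3) : IsTube (Φ ∘ N) (Φ '' J) :=
  ⟨Φ.isOpenEmbedding.comp hN.isOpenEmbedding, by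
    rw [← hN.core, ← range_comp]; rfl⟩

theorem IsTube.compl_nonempty (hN : IsTube N J) : Jᶜ.Nonempty :=
  ⟨N (1, 1), by rw [mem_compl_iff, hN.mem_iff]; exact one_ne_zero⟩

/-- The inverse of the tube `N`, with junk values off the tube. -/
noncomputable def tubeCoord (N : Circle × ℂ → S3) : S3 → Circle × ℂ := Function.invFun N

theorem IsTube.tubeCoord_apply (hN : IsTube N J) (p : Circle × ℂ) : tubeCoord N (N p) = p :=
  Function.leftInverse_invFun hN.isOpenEmbedding.injective p

theorem IsTube.apply_tubeCoord (_hN : IsTube N J) {x : S3} (hx : x ∈ range N) :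
    N (tubeCoord N x) = x := Function.invFun_eq hx

theorem IsTube.continuousOn_tubeCoord (hN : IsTube N J) :
    ContinuousOn (tubeCoord N) (range N) := by
  rintro _ ⟨p, rfl⟩
  refine ContinuousAt.continuousWithinAt ?_
  rw [ContinuousAt, ← hN.isOpenEmbedding.map_nhds_eq, tendsto_map'_iff, hN.tubeCoord_apply]
  have : tubeCoord N ∘ N = id := funext fun p => hN.tubeCoord_apply p
  rw [this]; exact tendsto_id

/-- The direction of a complex number as a point of the circle, read as `1` for `0`. -/
noncomputable def dir (w : ℂ) : Circle := Circle.exp w.arg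

theorem coe_dir {w : ℂ} (hw : w ≠ 0) : (dir w : ℂ) = w / ‖w‖ := by
  have : (‖w‖ : ℂ) ≠ 0 := by simpa using hw
  rw [eq_div_iff this, dir, Circle.coe_exp, mul_comm]
  exact Complex.norm_mul_exp_arg_mul_I w

theorem norm_mul_dir (w : ℂ) : (‖w‖ : ℂ) * (dir w : ℂ) = w := by
  rw [dir, Circle.coe_exp]; exact Complex.norm_mul_exp_arg_mul_I w

theorem continuousOn_dir : ContinuousOn dir {0}ᶜ := by
  refine (show IsInducing ((↑) : Circle → ℂ) from ⟨rfl⟩).continuousOn_iff.2 ?_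
  have : EqOn (fun w => ((dir w : Circle) : ℂ)) (fun w => w / (‖w‖ : ℂ)) {0}ᶜ :=
    fun w hw => coe_dir hw
  refine ContinuousOn.congr ?_ this
  refine ContinuousOn.div (by fun_prop) (by fun_prop) fun w hw => ?_
  simpa using hw

theorem dir_mul {r : ℝ} (hr : 0 < r) (ζ : Circle) : dir (r * ζ) = ζ := by
  rw [dir, Complex.arg_real_mul _ hr, Circle.exp_arg]

theorem isPreconnected_S3 : IsPreconnected (univ : Set S3) := by
  have h : IsConnected (Metric.sphere (0 : EuclideanSpace ℝ (Fin 4)) 1) := by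
    refine isConnected_sphere ?_ _ zero_le_one
    rw [← Module.finrank_eq_rank]
    simp
  exact (isPreconnected_iff_preconnectedSpace.1 h.isPreconnected).isPreconnected_univ

theorem locallyPathConnectedSpace_S3 : LocallyPathConnectedSpace S3 :=
  have : Fact (Module.finrank ℝ (EuclideanSpace ℝ (Fin 4)) = 3 + 1) := ⟨by simp⟩
  ChartedSpace.locallyPathConnectedSpace (EuclideanSpace ℝ (Fin 3)) S3

/-- A knot does not separate the 3-sphere. -/
theorem IsTube.isPathConnected_compl (hN : IsTube N J) : IsPathConnected Jᶜ := by
  have hT : IsOpen (range N) := hN.isOpenEmbedding.isOpen_range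
  have hJo := hN.isClosed.isOpen_compl
  have hTJ : IsPreconnected (range N \ J) := by
    have : range N \ J = N '' (univ ×ˢ {0}ᶜ) := by
      ext x
      constructor
      · rintro ⟨⟨p, rfl⟩, h⟩
        exact ⟨p, ⟨mem_univ _, fun h' => h (hN.mem_iff.2 h')⟩, rfl⟩
      · rintro ⟨p, ⟨-, h⟩, rfl⟩
        exact ⟨⟨p, rfl⟩, fun h' => h (hN.mem_iff.1 h')⟩
    rw [this]
    refine IsPreconnected.image ?_ _ hN.continuous.continuousOn
    refine isPreconnected_univ.prod (isConnected_compl_singleton_of_one_lt_rank ?_ _).isPreconnected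
    rw [Complex.rank_real_complex]; exact Nat.one_lt_ofNat
  have hconn : IsPreconnected Jᶜ := by
    rw [isPreconnected_iff_subset_of_disjoint]
    -- the piece containing the punctured tube may be enlarged by `J` to an open set
    have key : ∀ u v : Set S3, IsOpen u → IsOpen v → Jᶜ ⊆ u ∪ v → Jᶜ ∩ (u ∩ v) = ∅ →
        range N \ J ⊆ u → Jᶜ ⊆ u ∨ Jᶜ ⊆ v := by
      intro u v hu hv huv hd hsub
      have h1 : ∀ x, x ∉ J → x ∈ u → x ∈ v → False := fun x hx hxu hxv => by
        have : x ∈ Jᶜ ∩ (u ∩ v) := ⟨hx, hxu, hxv⟩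
        rw [hd] at this; exact this
      have := isPreconnected_iff_subset_of_disjoint.1 isPreconnected_S3 ((u ∩ Jᶜ) ∪ range N)
        (v ∩ Jᶜ) ((hu.inter hJo).union hT) (hv.inter hJo) (fun x _ => by
          by_cases hx : x ∈ J
          · exact Or.inl (Or.inr (hN.subset_range hx))
          · rcases huv hx with h | h
            · exact Or.inl (Or.inl ⟨h, hx⟩)
            · exact Or.inr ⟨h, hx⟩) (by
          rw [eq_empty_iff_forall_notMem]
          rintro x ⟨-, h | h, hv, hx⟩
          · exact h1 x hx h.1 hv
          · exact h1 x hx (hsub ⟨h, hx⟩) hv)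
      rcases this with h | h
      · left
        intro x hx
        rcases h (mem_univ x) with h | h
        · exact h.1
        · exact hsub ⟨h, hx⟩
      · exact Or.inr fun x _ => (h (mem_univ x)).1
    intro u v hu hv huv hd
    rcases isPreconnected_iff_subset_of_disjoint.1 hTJ u v hu hv
      ((sdiff_subset_compl _ _).trans huv)
      (subset_eq_empty (inter_subset_inter_left _ (sdiff_subset_compl _ _)) hd) with h | h
    · exact key u v hu hv huv hd h
    · exact (key v u hv hu (by rwa [union_comm]) (by rwa [inter_comm v u]) h).symm
  have := locallyPathConnectedSpace_S3
  exact (hJo.isConnected_iff_isPathConnected).1 ⟨hN.compl_nonempty, hconn⟩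

/-- The map `f` has degree `d` on the meridians of the tube `N`. In the polar coordinates `(z, exp
r * ζ)` of the punctured tube, `f` is its value at `(z, 1)`, times `ζ ^ d`, up to a continuous
angle. -/
def HasMeridianDegree (N : Circle × ℂ → S3) (f : S3 → Circle) (d : ℤ) : Prop :=
  ∃ u : (Circle × ℝ) × Circle → ℝ, Continuous u ∧ ∀ z r (ζ : Circle),
    f (N (z, (Real.exp r : ℂ) * ζ)) = f (N (z, 1)) * ζ ^ d * Circle.exp (u ((z, r), ζ))

theorem exp_mul_circle_ne_zero (r : ℝ) (ζ : Circle) : (Real.exp r : ℂ) * ζ ≠ 0 :=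
  mul_ne_zero (by exact_mod_cast (Real.exp_pos r).ne') (Circle.coe_ne_zero ζ)

theorem IsTube.continuous_comp (hN : IsTube N J) {f : S3 → Circle} (hf : ContinuousOn f Jᶜ)
    {Y : Type*} [TopologicalSpace Y] {a : Y → Circle × ℂ} (ha : Continuous a)
    (h : ∀ y, (a y).2 ≠ 0) : Continuous fun y => f (N (a y)) :=
  hf.comp_continuous (hN.continuous.comp ha) fun y hy => h y (hN.mem_iff.1 hy)

theorem IsTube.exists_meridianDegree (hN : IsTube N J) {f : S3 → Circle}
    (hf : ContinuousOn f Jᶜ) : ∃ d, HasMeridianDegree N f d := by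
  obtain ⟨d, u, hu, h⟩ := exists_degree (Y := Circle × ℝ)
    (fun p => f (N (p.1.1, (Real.exp p.1.2 : ℂ) * p.2)))
    (hN.continuous_comp hf (by fun_prop) fun y => exp_mul_circle_ne_zero _ _)
  obtain ⟨L, hL, -, h'⟩ := exists_angle_of_homotopy (Y := Circle × ℝ)
    (fun p => f (N (p.2.1, (Real.exp (p.1 * p.2.2) : ℂ) * (1 : Circle))))
    (hN.continuous_comp hf (by fun_prop) fun y => exp_mul_circle_ne_zero _ _)
  refine ⟨d, fun p => L (1, p.1) + u p, by fun_prop, fun z r ζ => ?_⟩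
  have h1 := h (z, r) ζ
  have h2 := h' 1 (z, r)
  simp only [Icc.coe_zero, Icc.coe_one, zero_mul, one_mul, Real.exp_zero,
    Circle.coe_one, mul_one, Complex.ofReal_one] at h1 h2
  rw [h1, h2, Circle.exp_add]
  simp only [mul_assoc, mul_left_comm, mul_comm]

/-- If `n` divides the degree on the meridians, there is an `n`-th root on the whole complement. On
the punctured tube the map is an `n`-th power times a factor, its value at `(z, 1)`, that extends
over the core. -/
theorem IsTube.exists_root (hN : IsTube N J) {f : S3 → Circle} (hf : ContinuousOn f Jᶜ) {d : ℤ}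
    (hd : HasMeridianDegree N f d) {n : ℕ} (hn : n ≠ 0) (hnd : (n : ℤ) ∣ d) :
    ∃ g : S3 → Circle, ContinuousOn g Jᶜ ∧ ∀ x ∈ Jᶜ, g x ^ n = f x := by
  obtain ⟨u, hu, h⟩ := hd
  obtain ⟨e, rfl⟩ := hnd
  have hn' : (n : ℝ) ≠ 0 := by exact_mod_cast hn
  let c := tubeCoord N
  have hc := hN.continuousOn_tubeCoord
  have hcT : ∀ x ∈ range N \ J, (c x).2 ≠ 0 := fun x hx h0 => by
    apply hx.2
    rw [← hN.apply_tubeCoord hx.1, hN.mem_iff]; exact h0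
  refine exists_root_of_factor hN.isClosed hN.isOpenEmbedding.isOpen_range hN.subset_range hn hf
    (F := fun x => dir (c x).2 ^ e *
      Circle.exp (u (((c x).1, Real.log ‖(c x).2‖), dir (c x).2) / n))
    (G := fun x => f (N ((c x).1, 1))) ?_ ?_ ?_
  · have hc' : ContinuousOn c (range N \ J) := hc.mono sdiff_subset
    have h2 : ContinuousOn (fun x => dir (c x).2) (range N \ J) :=
      continuousOn_dir.comp (continuous_snd.comp_continuousOn hc') hcT
    have h3 : ContinuousOn (fun x => Real.log ‖(c x).2‖) (range N \ J) :=
      (continuous_snd.comp_continuousOn hc').norm.log fun x hx => norm_ne_zero_iff.2 (hcT x hx)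
    have h4 : ContinuousOn (fun x => u (((c x).1, Real.log ‖(c x).2‖), dir (c x).2))
        (range N \ J) :=
      hu.comp_continuousOn (((continuous_fst.comp_continuousOn hc').prodMk h3).prodMk h2)
    exact (h2.zpow e).mul (Circle.exp.continuous.comp_continuousOn (h4.div_const _))
  · have : ContinuousOn (fun x => N ((c x).1, 1)) (range N) :=
      hN.continuous.comp_continuousOn
        ((continuous_fst.comp_continuousOn hc).prodMk continuousOn_const)
    exact hf.comp this fun x _ => by
      rw [mem_compl_iff, hN.mem_iff]; exact one_ne_zero
  · intro x hx
    have h0 := hcT x hx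
    have hpos : 0 < ‖(c x).2‖ := norm_pos_iff.2 h0
    have h1 := h (c x).1 (Real.log ‖(c x).2‖) (dir (c x).2)
    rw [Real.exp_log hpos, norm_mul_dir] at h1
    have h2 : N ((c x).1, (c x).2) = x := hN.apply_tubeCoord hx.1
    rw [h2] at h1
    rw [h1, mul_pow, exp_natpow, mul_div_cancel₀ _ hn', ← zpow_natCast, ← zpow_mul,
      mul_comm e]
    simp only [mul_assoc, mul_left_comm, mul_comm]

/-- `f` has a continuous `n`-th root on the complement of `J` near `x`. -/
def HasLocalRoot (J : Set S3) (f : S3 → Circle) (x : S3) (n : ℕ) : Prop :=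
  ∃ U : Set S3, IsOpen U ∧ x ∈ U ∧ ∃ g : S3 → Circle, ContinuousOn g (U \ J) ∧
    ∀ y ∈ U \ J, g y ^ n = f y

/-- A local root near a point of the knot restricts to a small meridian, where it forces the degree
to be divisible by its order. -/
theorem IsTube.dvd_of_hasLocalRoot (hN : IsTube N J) {f : S3 → Circle} {d : ℤ}
    (hd : HasMeridianDegree N f d) {x : S3} (hx : x ∈ J) {n : ℕ} (h : HasLocalRoot J f x n) :
    (n : ℤ) ∣ d := by
  obtain ⟨U, hU, hxU, g, hg, hgn⟩ := h
  obtain ⟨u, hu, hfu⟩ := hd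
  rw [← hN.core] at hx
  obtain ⟨z, rfl⟩ := hx
  have hV : IsOpen ((fun w : ℂ => N (z, w)) ⁻¹' U) :=
    hU.preimage (hN.continuous.comp (by fun_prop))
  obtain ⟨ε, hε, hball⟩ := Metric.isOpen_iff.1 hV 0 hxU
  let r := Real.log (ε / 2)
  have hr : Real.exp r = ε / 2 := Real.exp_log (by positivity)
  have hmem : ∀ ζ : Circle, N (z, (Real.exp r : ℂ) * ζ) ∈ U \ J := fun ζ => by
    refine ⟨hball ?_, fun h => exp_mul_circle_ne_zero _ _ (hN.mem_iff.1 h)⟩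
    rw [hr, mem_ball_zero_iff, norm_mul, Circle.norm_coe, mul_one, Complex.norm_real,
      Real.norm_eq_abs, abs_of_pos (by positivity)]
    linarith
  refine dvd_degree_of_root (c := f (N (z, 1))) (u := fun ζ => u ((z, r), ζ)) (by fun_prop)
    (g := fun ζ => g (N (z, (Real.exp r : ℂ) * ζ)))
    (hg.comp_continuous (hN.continuous.comp (by fun_prop)) hmem) fun ζ => ?_
  rw [hgn _ (hmem ζ), hfu]

/-- If the degree on the meridians is `1` or `-1`, the cover is connected: running around a
meridian joins the points of a fibre. -/
theorem IsTube.isConnected_cov_of_degree (hN : IsTube N J) {f : S3 → Circle}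
    (hf : ContinuousOn f Jᶜ) {d : ℤ} (hd : HasMeridianDegree N f d) (h1 : d * d = 1) :
    IsConnected (cov J f) := by
  obtain ⟨u, hu, hfu⟩ := hd
  have hb : N (1, 1) ∉ J := by rw [hN.mem_iff]; exact one_ne_zero
  obtain ⟨t0, ht0⟩ := cov_nonempty (f := f) hb
  have hu1 : Circle.exp (u ((1, 0), 1)) = 1 := by
    have := hfu 1 0 1
    simpa using this
  -- the lift of the meridian traversed `k` times moves up by `k * d` sheets
  have hloop : ∀ k : ℤ, JoinedIn (cov J f) (N (1, 1), t0)
      (N (1, 1), t0 + (k * d : ℤ) * (2 * Real.pi)) := fun k => by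
    let P : Path (N (1, 1), t0) (N (1, 1), t0 + (k * d : ℤ) * (2 * Real.pi)) :=
      { toFun := fun s => (N (1, (Circle.exp (k * (2 * Real.pi) * s) : ℂ)),
          t0 + (k * d : ℤ) * (2 * Real.pi) * s +
            (u ((1, 0), Circle.exp (k * (2 * Real.pi) * s)) - u ((1, 0), 1)))
        continuous_toFun := by
          refine Continuous.prodMk (hN.continuous.comp (by fun_prop)) (by fun_prop)
        source' := by simp
        target' := by simp }
    refine ⟨P, fun s => ⟨?_, ?_⟩⟩
    · simp only [P, Path.coe_mk_mk]
      rw [hN.mem_iff]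
      exact Circle.coe_ne_zero _
    · simp only [P, Path.coe_mk_mk]
      have := hfu 1 0 (Circle.exp (k * (2 * Real.pi) * s))
      simp only [Real.exp_zero, Complex.ofReal_one, one_mul] at this
      rw [this, ht0.2, Circle.exp_add, Circle.exp_add, sub_eq_add_neg, Circle.exp_add,
        Circle.exp_neg, hu1, exp_zpow, inv_one, mul_one]
      congr 3
      push_cast; ring
  refine IsPathConnected.isConnected ⟨(N (1, 1), t0), ht0, ?_⟩
  rintro ⟨x, t⟩ hx
  -- any other point of the cover is joined to the fibre over the base point by lifting a path
  obtain ⟨γ, hγ⟩ := hN.isPathConnected_compl.joinedIn x hx.1 _ hb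
  let c : C(I, Circle) := ⟨fun s => f (γ s), hf.comp_continuous γ.continuous hγ⟩
  have hc0 : c 0 = Circle.exp t := by simp only [c, ContinuousMap.coe_mk, γ.source]; exact hx.2
  let L := Circle.isCoveringMap_exp.liftPath c t hc0
  have hL0 : L 0 = t := Circle.isCoveringMap_exp.liftPath_zero c t hc0
  have hL : ∀ s, Circle.exp (L s) = f (γ s) := fun s =>
    congrFun (Circle.isCoveringMap_exp.liftPath_lifts c t hc0) s
  have hj : JoinedIn (cov J f) (x, t) (N (1, 1), L 1) :=
    ⟨{ toFun := fun s => (γ s, L s)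
       continuous_toFun := by fun_prop
       source' := by simp [hL0]
       target' := by simp }, fun s => ⟨hγ s, (hL s).symm⟩⟩
  have h3 : Circle.exp (L 1) = Circle.exp t0 := by rw [hL, γ.target]; exact ht0.2
  obtain ⟨m, hm⟩ := Circle.exp_eq_exp.1 h3
  have h4 := hloop (m * d)
  rw [mul_assoc, h1, mul_one, ← hm] at h4
  exact h4.trans hj.symm

/-- The cover classified by `f` is connected if and only if `f` has no local roots near a given
point of the knot. -/
theorem IsTube.isConnected_cov_iff (hN : IsTube N J) {f : S3 → Circle} (hf : ContinuousOn f Jᶜ)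
    {x : S3} (hx : x ∈ J) : IsConnected (cov J f) ↔ ∀ n, 2 ≤ n → ¬ HasLocalRoot J f x n := by
  obtain ⟨d, hd⟩ := hN.exists_meridianDegree hf
  constructor
  · intro hc n hn hr
    obtain ⟨g, hg, hgn⟩ := hN.exists_root hf hd (by omega) (hN.dvd_of_hasLocalRoot hd hx hr)
    exact not_root_of_isPreconnected hc.isPreconnected hN.compl_nonempty hn hg hgn
  · intro h
    have key : ∀ n : ℕ, 2 ≤ n → ¬ (n : ℤ) ∣ d := fun n hn hnd => by
      obtain ⟨g, hg, hgn⟩ := hN.exists_root hf hd (by omega) hnd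
      exact h n hn ⟨univ, isOpen_univ, mem_univ _, g, hg.mono fun y hy => hy.2,
        fun y hy => hgn y hy.2⟩
    refine hN.isConnected_cov_of_degree hf hd ?_
    have h0 : d ≠ 0 := fun e => key 2 le_rfl (e ▸ dvd_zero _)
    have h1 : ¬ 2 ≤ d.natAbs := fun h2 => key d.natAbs h2 (Int.natAbs_dvd.2 dvd_rfl)
    have : d = 1 ∨ d = -1 := by omega
    rcases this with rfl | rfl <;> rfl

end Tubes

/-! ### Embeddings of covers -/

section EmbeddedCovers

/-- Some connected infinite cyclic cover of the complement of `J` embeds into the 3-sphere. -/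
def HasEmbeddedCover (J : Set S3) : Prop :=
  ∃ f : S3 → Circle, ContinuousOn f Jᶜ ∧ IsConnected (cov J f) ∧
    ∃ e : S3 × ℝ → S3, EmbedsOn e (cov J f)

/-- A map of complements lifts to the covers if it changes the circle-valued maps by an angle. -/
theorem mapsTo_cov {J J' : Set S3} {f f' : S3 → Circle} {ψ : S3 → S3} {u : S3 → ℝ}
    (hψ : ∀ x ∉ J, ψ x ∉ J') (h : ∀ x ∉ J, f' (ψ x) = f x * Circle.exp (u x)) :
    MapsTo (fun p : S3 × ℝ => (ψ p.1, p.2 + u p.1)) (cov J f) (cov J' f') :=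
  fun p hp => ⟨hψ _ hp.1, by rw [h _ hp.1, hp.2, Circle.exp_add]⟩

/-- The lift of an embedding of complements, sheared by an angle, is an embedding. -/
theorem embedsOn_cov {J : Set S3} {f : S3 → Circle} {ψ l : S3 → S3} {u : S3 → ℝ}
    (hψ : ContinuousOn ψ Jᶜ) (hu : ContinuousOn u Jᶜ) (hl : ContinuousOn l (ψ '' Jᶜ))
    (h : LeftInvOn l ψ Jᶜ) :
    EmbedsOn (fun p : S3 × ℝ => (ψ p.1, p.2 + u p.1)) (cov J f) := by
  have hl' : ContinuousOn (fun p : S3 × ℝ => l p.1) ((ψ '' Jᶜ) ×ˢ univ) :=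
    hl.comp continuousOn_fst fun p hp => hp.1
  refine embedsOn_of_leftInvOn (l := fun p => (l p.1, p.2 - u (l p.1))) (t := (ψ '' Jᶜ) ×ˢ univ)
    ?_ (fun p hp => ⟨mem_image_of_mem _ hp.1, mem_univ _⟩) (hl'.prodMk (continuousOn_snd.sub ?_))
    fun p hp => ?_
  · exact (hψ.comp continuousOn_fst fun p hp => hp.1).prodMk
      (continuousOn_snd.add (hu.comp continuousOn_fst fun p hp => hp.1))
  · refine hu.comp hl' ?_
    rintro ⟨_, t⟩ ⟨⟨x, hx, rfl⟩, -⟩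
    simp only [h hx]; exact hx
  · have := h hp.1
    simp only [this, add_sub_cancel_right]

theorem HasEmbeddedCover.image_homeomorph {J : Set S3} (h : HasEmbeddedCover J) (Φ : S3 ≃ₜ S3) :
    HasEmbeddedCover (Φ '' J) := by
  obtain ⟨f, hf, hc, e, he⟩ := h
  have hm : ∀ x, x ∉ Φ '' J ↔ Φ.symm x ∉ J := fun x => by
    rw [Φ.image_eq_preimage_symm]; rfl
  refine ⟨f ∘ Φ.symm, hf.comp Φ.symm.continuous.continuousOn fun x hx => (hm x).1 hx, ?_,
    fun p => e (Φ.symm p.1, p.2 + 0), ?_⟩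
  · have : cov (Φ '' J) (f ∘ Φ.symm) = (fun p : S3 × ℝ => (Φ p.1, p.2)) '' cov J f := by
      ext ⟨x, t⟩
      constructor
      · rintro ⟨h1, h2⟩
        exact ⟨(Φ.symm x, t), ⟨(hm x).1 h1, h2⟩, by simp⟩
      · rintro ⟨⟨y, s⟩, ⟨h1, h2⟩, h3⟩
        simp only [Prod.mk.injEq] at h3
        obtain ⟨rfl, rfl⟩ := h3
        exact ⟨by simpa using h1, by simpa using h2⟩
    rw [this]
    exact hc.image _ (by fun_prop)
  · refine he.comp (g := fun p : S3 × ℝ => (Φ.symm p.1, p.2 + 0))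
      (embedsOn_cov (ψ := Φ.symm) (l := Φ) (u := fun _ => 0) (by fun_prop) (by fun_prop)
      (by fun_prop) fun x _ => by simp) (mapsTo_cov (u := fun _ => 0) (fun x hx => (hm x).1 hx)
      fun x _ => by simp)

/-- Having a local root depends only on the set and the map near the point. -/
theorem HasLocalRoot.congr {J J' V : Set S3} {f f' : S3 → Circle} {x : S3} {n : ℕ}
    (h : HasLocalRoot J f x n) (hV : IsOpen V) (hx : x ∈ V) (hJ : ∀ y ∈ V, y ∈ J ↔ y ∈ J')
    (hf : ∀ y ∈ V, y ∉ J → f y = f' y) : HasLocalRoot J' f' x n := by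
  obtain ⟨U, hU, hxU, g, hg, hgn⟩ := h
  have hsub : (U ∩ V) \ J' ⊆ U \ J := fun y hy => ⟨hy.1.1, fun h => hy.2 ((hJ y hy.1.2).1 h)⟩
  exact ⟨U ∩ V, hU.inter hV, ⟨hxU, hx⟩, g, hg.mono hsub, fun y hy => by
    rw [hgn y (hsub hy), hf y hy.1.2 (hsub hy).2]⟩

end EmbeddedCovers

/-! ### Coordinates of the 3-sphere and the reflection in the equator -/

section Coordinates

open Classical in
/-- The point of the 3-sphere with the given coordinates, when their squares add up to `1`
(and a junk value otherwise). -/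
noncomputable def pt (a b c d : ℝ) : S3 :=
  if h : a ^ 2 + b ^ 2 + c ^ 2 + d ^ 2 = 1 then mkS3 a b c d h else mkS3 0 0 0 1 (by norm_num)

theorem pt_val {a b c d : ℝ} (h : a ^ 2 + b ^ 2 + c ^ 2 + d ^ 2 = 1) :
    (pt a b c d).1 = !₂[a, b, c, d] := by
  rw [pt, dif_pos h]; rfl

theorem pt_zero {a b c d : ℝ} (h : a ^ 2 + b ^ 2 + c ^ 2 + d ^ 2 = 1) :
    (pt a b c d).1 0 = a := by rw [pt_val h]; simp

theorem pt_one {a b c d : ℝ} (h : a ^ 2 + b ^ 2 + c ^ 2 + d ^ 2 = 1) :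
    (pt a b c d).1 1 = b := by rw [pt_val h]; simp

theorem pt_two {a b c d : ℝ} (h : a ^ 2 + b ^ 2 + c ^ 2 + d ^ 2 = 1) :
    (pt a b c d).1 2 = c := by rw [pt_val h]; simp

theorem pt_three {a b c d : ℝ} (h : a ^ 2 + b ^ 2 + c ^ 2 + d ^ 2 = 1) :
    (pt a b c d).1 3 = d := by rw [pt_val h]; simp

theorem pt_eq {a b c d : ℝ} {x : S3} (h0 : a = x.1 0) (h1 : b = x.1 1) (h2 : c = x.1 2)
    (h3 : d = x.1 3) : pt a b c d = x := by
  have h : a ^ 2 + b ^ 2 + c ^ 2 + d ^ 2 = 1 := by rw [h0, h1, h2, h3]; exact S3_sq_sum x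
  exact S3_ext ((pt_zero h).trans h0) ((pt_one h).trans h1) ((pt_two h).trans h2)
    ((pt_three h).trans h3)

theorem continuousOn_pt {Y : Type*} [TopologicalSpace Y] {a b c d : Y → ℝ} {s : Set Y}
    (ha : ContinuousOn a s) (hb : ContinuousOn b s) (hc : ContinuousOn c s)
    (hd : ContinuousOn d s) (h : ∀ y ∈ s, a y ^ 2 + b y ^ 2 + c y ^ 2 + d y ^ 2 = 1) :
    ContinuousOn (fun y => pt (a y) (b y) (c y) (d y)) s := by
  refine (IsEmbedding.subtypeVal.isInducing).continuousOn_iff.2 ?_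
  have : EqOn (Subtype.val ∘ fun y => pt (a y) (b y) (c y) (d y))
      (fun y => !₂[a y, b y, c y, d y]) s := fun y hy => pt_val (h y hy)
  refine ContinuousOn.congr ?_ this
  refine (PiLp.continuous_toLp 2 _).comp_continuousOn (continuousOn_pi.2 fun i => ?_)
  fin_cases i <;> simpa

/-- The reflection of the 3-sphere in the equatorial 2-sphere. -/
noncomputable def reflection : S3 ≃ₜ S3 :=
  have h : ∀ x : S3, x.1 0 ^ 2 + x.1 1 ^ 2 + x.1 2 ^ 2 + (-x.1 3) ^ 2 = 1 := fun x => by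
    rw [neg_sq]; exact S3_sq_sum x
  have hc : Continuous fun x : S3 => pt (x.1 0) (x.1 1) (x.1 2) (-x.1 3) := by
    rw [← continuousOn_univ]
    exact continuousOn_pt (by fun_prop) (by fun_prop) (by fun_prop) (by fun_prop) fun x _ => h x
  have hi : Function.LeftInverse (fun x : S3 => pt (x.1 0) (x.1 1) (x.1 2) (-x.1 3))
      (fun x : S3 => pt (x.1 0) (x.1 1) (x.1 2) (-x.1 3)) := fun x =>
    pt_eq (pt_zero (h x)) (pt_one (h x)) (pt_two (h x)) (by rw [pt_three (h x), neg_neg])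
  { toFun := fun x => pt (x.1 0) (x.1 1) (x.1 2) (-x.1 3)
    invFun := fun x => pt (x.1 0) (x.1 1) (x.1 2) (-x.1 3)
    left_inv := hi
    right_inv := hi
    continuous_toFun := hc
    continuous_invFun := hc }

theorem reflection_sq_sum (x : S3) :
    x.1 0 ^ 2 + x.1 1 ^ 2 + x.1 2 ^ 2 + (-x.1 3) ^ 2 = 1 := by
  rw [neg_sq]; exact S3_sq_sum x

@[simp] theorem reflection_zero (x : S3) : (reflection x).1 0 = x.1 0 :=
  pt_zero (reflection_sq_sum x)

@[simp] theorem reflection_one (x : S3) : (reflection x).1 1 = x.1 1 :=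
  pt_one (reflection_sq_sum x)

@[simp] theorem reflection_two (x : S3) : (reflection x).1 2 = x.1 2 :=
  pt_two (reflection_sq_sum x)

@[simp] theorem reflection_three (x : S3) : (reflection x).1 3 = -x.1 3 :=
  pt_three (reflection_sq_sum x)

@[simp] theorem reflection_reflection (x : S3) : reflection (reflection x) = x := by
  apply S3_ext <;> simp

theorem mem_reflection_image {J : Set S3} {x : S3} : x ∈ reflection '' J ↔ reflection x ∈ J := by
  constructor
  · rintro ⟨y, hy, rfl⟩; simpa
  · exact fun h => ⟨_, h, by simp⟩

end Coordinates

/-! ### From a connected sum to its summands -/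

section Sums

/-- `J` is the connected sum of `J₁` and `J₂` in standard position. -/
structure IsSum (J J₁ J₂ : Set S3) : Prop where
  left_std : J₁ ∩ below (1 / 2) = greatCircle ∩ below (1 / 2)
  right_std : J₂ ∩ above (-(1 / 2)) = greatCircle ∩ above (-(1 / 2))
  upper : J ∩ above 0 = J₁ ∩ above 0
  lower : J ∩ below 0 = J₂ ∩ below 0

variable {J J₁ J₂ : Set S3}

theorem IsSum.mem_left (h : IsSum J J₁ J₂) {x : S3} (hx : x.1 3 ≤ 1 / 2) :
    x ∈ J₁ ↔ x ∈ greatCircle := by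
  have := Set.ext_iff.1 h.left_std x
  simp only [below, mem_inter_iff, mem_ofPred_eq, hx, and_true] at this
  exact this

theorem IsSum.mem_right (h : IsSum J J₁ J₂) {x : S3} (hx : -(1 / 2) ≤ x.1 3) :
    x ∈ J₂ ↔ x ∈ greatCircle := by
  have := Set.ext_iff.1 h.right_std x
  simp only [above, mem_inter_iff, mem_ofPred_eq, hx, and_true] at this
  exact this

theorem IsSum.mem_upper (h : IsSum J J₁ J₂) {x : S3} (hx : 0 ≤ x.1 3) : x ∈ J ↔ x ∈ J₁ := by
  have := Set.ext_iff.1 h.upper x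
  simpa [above, hx] using this

theorem IsSum.mem_lower (h : IsSum J J₁ J₂) {x : S3} (hx : x.1 3 ≤ 0) : x ∈ J ↔ x ∈ J₂ := by
  have := Set.ext_iff.1 h.lower x
  simpa [below, hx] using this

theorem IsSum.reflect (h : IsSum J J₁ J₂) :
    IsSum (reflection '' J) (reflection '' J₂) (reflection '' J₁) where
  left_std := by
    ext x
    simp only [mem_inter_iff, mem_reflection_image, below, mem_ofPred_eq]
    refine and_congr_left fun hx => ?_
    rw [h.mem_right (by simp; linarith)]
    simp [greatCircle]
  right_std := by
    ext x
    simp only [mem_inter_iff, mem_reflection_image, above, mem_ofPred_eq]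
    refine and_congr_left fun hx => ?_
    rw [h.mem_left (by simp; linarith)]
    simp [greatCircle]
  upper := by
    ext x
    simp only [mem_inter_iff, mem_reflection_image, above, mem_ofPred_eq]
    exact and_congr_left fun hx => h.mem_lower (by simp; linarith)
  lower := by
    ext x
    simp only [mem_inter_iff, mem_reflection_image, below, mem_ofPred_eq]
    exact and_congr_left fun hx => h.mem_upper (by simp; linarith)

/-- The factor by which the squeezing map stretches the first three coordinates. -/
noncomputable def squeezeFactor (t : ℝ) : ℝ :=
  √((1 - (min t 0) ^ 2 / 4) / (1 - (min t 0) ^ 2))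

/-- The embedding of the 3-sphere minus the south pole onto `{-1/2 < x₃}` that halves the
negative heights and keeps the meridians and the upper hemisphere. -/
noncomputable def squeezeUp (x : S3) : S3 :=
  pt (squeezeFactor (x.1 3) * x.1 0) (squeezeFactor (x.1 3) * x.1 1)
    (squeezeFactor (x.1 3) * x.1 2) (x.1 3 - min (x.1 3) 0 / 2)

/-- The inverse of `squeezeUp`. -/
noncomputable def stretchDown (x : S3) : S3 :=
  pt ((squeezeFactor (x.1 3 + min (x.1 3) 0))⁻¹ * x.1 0)
    ((squeezeFactor (x.1 3 + min (x.1 3) 0))⁻¹ * x.1 1)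
    ((squeezeFactor (x.1 3 + min (x.1 3) 0))⁻¹ * x.1 2) (x.1 3 + min (x.1 3) 0)

theorem squeezeFactor_pos {t : ℝ} (h : -1 < t) : 0 < squeezeFactor t := by
  have h1 : (min t 0) ^ 2 < 1 := by
    rcases le_total t 0 with h0 | h0
    · rw [min_eq_left h0]; nlinarith
    · rw [min_eq_right h0]; norm_num
  apply Real.sqrt_pos.2
  apply div_pos <;> nlinarith

theorem squeezeFactor_sq {t : ℝ} (h : -1 < t) :
    squeezeFactor t ^ 2 * (1 - t ^ 2) = 1 - (t - min t 0 / 2) ^ 2 := by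
  have h2 : squeezeFactor t ^ 2 = (1 - (min t 0) ^ 2 / 4) / (1 - (min t 0) ^ 2) := by
    apply Real.sq_sqrt
    exact (Real.sqrt_pos.1 (squeezeFactor_pos h)).le
  rw [h2]
  rcases le_total t 0 with h0 | h0
  · rw [min_eq_left h0]
    rcases eq_or_ne (1 - t ^ 2) 0 with h3 | h3
    · nlinarith
    · field_simp; ring
  · rw [min_eq_right h0]; simp

theorem continuousOn_squeezeFactor : ContinuousOn squeezeFactor {t | -1 < t} := by
  refine ContinuousOn.sqrt (ContinuousOn.div (by fun_prop) (by fun_prop) fun t ht => ?_)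
  have h1 : (min t 0) ^ 2 < 1 := by
    have ht : -1 < t := ht
    rcases le_total t 0 with h0 | h0
    · rw [min_eq_left h0]; nlinarith
    · rw [min_eq_right h0]; norm_num
  linarith

theorem squeezeUp_sum {x : S3} (h : -1 < x.1 3) : (squeezeFactor (x.1 3) * x.1 0) ^ 2 +
    (squeezeFactor (x.1 3) * x.1 1) ^ 2 + (squeezeFactor (x.1 3) * x.1 2) ^ 2 +
    (x.1 3 - min (x.1 3) 0 / 2) ^ 2 = 1 := by
  have h1 := squeezeFactor_sq h
  have h2 := S3_sq_sum x
  have h3 : x.1 0 ^ 2 + x.1 1 ^ 2 + x.1 2 ^ 2 = 1 - x.1 3 ^ 2 := by linarith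
  rw [← h3] at h1
  linarith

theorem stretchDown_sum {x : S3} (h : -(1 / 2) < x.1 3) :
    ((squeezeFactor (x.1 3 + min (x.1 3) 0))⁻¹ * x.1 0) ^ 2 +
    ((squeezeFactor (x.1 3 + min (x.1 3) 0))⁻¹ * x.1 1) ^ 2 +
    ((squeezeFactor (x.1 3 + min (x.1 3) 0))⁻¹ * x.1 2) ^ 2 + (x.1 3 + min (x.1 3) 0) ^ 2 = 1 := by
  have ht : -1 < x.1 3 + min (x.1 3) 0 := by
    rcases le_total (x.1 3) 0 with h0 | h0
    · rw [min_eq_left h0]; linarith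
    · rw [min_eq_right h0]; linarith
  have h1 := squeezeFactor_sq ht
  have hpos := squeezeFactor_pos ht
  have h4 : x.1 3 + min (x.1 3) 0 - min (x.1 3 + min (x.1 3) 0) 0 / 2 = x.1 3 := by
    rcases le_total (x.1 3) 0 with h0 | h0
    · rw [min_eq_left h0, min_eq_left (by linarith)]; ring
    · rw [min_eq_right h0, min_eq_right (by linarith)]; ring
  rw [h4] at h1
  have h2 := S3_sq_sum x
  have h3 : x.1 0 ^ 2 + x.1 1 ^ 2 + x.1 2 ^ 2 = 1 - x.1 3 ^ 2 := by linarith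
  rw [← h3] at h1
  field_simp
  linarith

theorem continuousOn_squeezeUp : ContinuousOn squeezeUp {x | -1 < x.1 3} := by
  have h : ContinuousOn (fun x : S3 => squeezeFactor (x.1 3)) {x | -1 < x.1 3} :=
    continuousOn_squeezeFactor.comp (by fun_prop) fun x hx => hx
  exact continuousOn_pt (h.mul (by fun_prop)) (h.mul (by fun_prop)) (h.mul (by fun_prop))
    (by fun_prop) fun x hx => squeezeUp_sum hx

theorem continuousOn_stretchDown : ContinuousOn stretchDown {x | -(1 / 2) < x.1 3} := by
  have hm : ∀ x : S3, -(1 / 2) < x.1 3 → -1 < x.1 3 + min (x.1 3) 0 := fun x hx => by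
    rcases le_total (x.1 3) 0 with h0 | h0
    · rw [min_eq_left h0]; linarith
    · rw [min_eq_right h0]; linarith
  have h : ContinuousOn (fun x : S3 => (squeezeFactor (x.1 3 + min (x.1 3) 0))⁻¹)
      {x | -(1 / 2) < x.1 3} :=
    (continuousOn_squeezeFactor.comp (by fun_prop) fun x hx => hm x hx).inv₀
      fun x hx => (squeezeFactor_pos (hm x hx)).ne'
  exact continuousOn_pt (h.mul (by fun_prop)) (h.mul (by fun_prop)) (h.mul (by fun_prop))
    (by fun_prop) fun x hx => stretchDown_sum hx

theorem stretchDown_squeezeUp {x : S3} (h : -1 < x.1 3) : stretchDown (squeezeUp x) = x := by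
  have h3 : (squeezeUp x).1 3 = x.1 3 - min (x.1 3) 0 / 2 := pt_three (squeezeUp_sum h)
  have h4 : (squeezeUp x).1 3 + min ((squeezeUp x).1 3) 0 = x.1 3 := by
    rw [h3]
    rcases le_total (x.1 3) 0 with h0 | h0
    · rw [min_eq_left h0, min_eq_left (by linarith)]; ring
    · rw [min_eq_right h0, min_eq_right (by linarith)]; ring
  have hp := (squeezeFactor_pos h).ne'
  refine pt_eq ?_ ?_ ?_ h4
  · rw [h4, squeezeUp, pt_zero (squeezeUp_sum h), inv_mul_cancel_left₀ hp]
  · rw [h4, squeezeUp, pt_one (squeezeUp_sum h), inv_mul_cancel_left₀ hp]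
  · rw [h4, squeezeUp, pt_two (squeezeUp_sum h), inv_mul_cancel_left₀ hp]

theorem squeezeUp_of_nonneg {x : S3} (h : 0 ≤ x.1 3) : squeezeUp x = x := by
  have : squeezeFactor (x.1 3) = 1 := by simp [squeezeFactor, min_eq_right h]
  refine pt_eq ?_ ?_ ?_ ?_ <;> simp [this, min_eq_right h]

/-- A point of the great circle of height `7/25`. The height lies strictly between `0` and `1/2`,
so that near this point the sum and its upper summand coincide with the great circle, and
`squeezeUp` does not move the points. -/
noncomputable def stdPoint : S3 := pt (24 / 25) 0 0 (7 / 25)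

theorem stdPoint_mem : stdPoint ∈ greatCircle :=
  ⟨pt_one (by norm_num), pt_two (by norm_num)⟩

theorem stdPoint_three : stdPoint.1 3 = 7 / 25 := pt_three (by norm_num)

theorem IsSum.stdPoint_mem_left (h : IsSum J J₁ J₂) : stdPoint ∈ J₁ :=
  (h.mem_left (by rw [stdPoint_three]; norm_num)).2 stdPoint_mem

theorem IsSum.stdPoint_mem_sum (h : IsSum J J₁ J₂) : stdPoint ∈ J :=
  (h.mem_upper (by rw [stdPoint_three]; norm_num)).2 h.stdPoint_mem_left

/-- The south pole is on the upper summand. -/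
theorem IsSum.neg_one_lt (h : IsSum J J₁ J₂) {x : S3} (hx : x ∉ J₁) : -1 < x.1 3 := by
  by_contra hle
  have h1 := S3_sq_sum x
  have h2 : x.1 1 = 0 ∧ x.1 2 = 0 := by
    constructor <;> nlinarith [sq_nonneg (x.1 0), sq_nonneg (x.1 1), sq_nonneg (x.1 2)]
  exact hx ((h.mem_left (by linarith)).2 h2)

/-- If a cover of the complement of a connected sum embeds, so does a cover of the complement of
its upper summand, which is squeezed into the upper part of the sum. -/
theorem IsSum.hasEmbeddedCover_left (h : IsSum J J₁ J₂) {N N₁ : Circle × ℂ → S3} (hN : IsTube N J)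
    (hN₁ : IsTube N₁ J₁) (hJ : HasEmbeddedCover J) : HasEmbeddedCover J₁ := by
  obtain ⟨f, hf, hc, e, he⟩ := hJ
  have hm : ∀ x ∉ J₁, squeezeUp x ∉ J := fun x hx hxJ => by
    rcases le_total 0 (x.1 3) with h0 | h0
    · rw [squeezeUp_of_nonneg h0, h.mem_upper h0] at hxJ
      exact hx hxJ
    · have h1 := h.neg_one_lt hx
      have h3 : (squeezeUp x).1 3 = x.1 3 / 2 := by
        rw [squeezeUp, pt_three (squeezeUp_sum h1), min_eq_left h0]; ring
      rw [h.mem_lower (by linarith), h.mem_right (by linarith)] at hxJ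
      have h4 := hxJ.1
      have h5 := hxJ.2
      rw [squeezeUp, pt_one (squeezeUp_sum h1)] at h4
      rw [squeezeUp, pt_two (squeezeUp_sum h1)] at h5
      have hp := (squeezeFactor_pos h1).ne'
      exact hx ((h.mem_left (by linarith)).2
        ⟨(mul_eq_zero.1 h4).resolve_left hp, (mul_eq_zero.1 h5).resolve_left hp⟩)
  have hφ : ContinuousOn squeezeUp J₁ᶜ := continuousOn_squeezeUp.mono fun x hx => h.neg_one_lt hx
  have hfφ : ContinuousOn (f ∘ squeezeUp) J₁ᶜ := hf.comp hφ hm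
  refine ⟨f ∘ squeezeUp, hfφ, ?_, fun p => e (squeezeUp p.1, p.2 + 0), ?_⟩
  -- near `stdPoint` the two knots and the two circle-valued maps are the same
  · rw [hN₁.isConnected_cov_iff hfφ h.stdPoint_mem_left]
    rw [hN.isConnected_cov_iff hf h.stdPoint_mem_sum] at hc
    intro n hn hr
    refine hc n hn (hr.congr (V := {x | 0 < x.1 3}) ?_ ?_ (fun y hy => ?_) fun y hy _ => ?_)
    · exact isOpen_lt continuous_const (continuous_S3_coord 3)
    · rw [mem_ofPred_eq, stdPoint_three]; norm_num
    · exact (h.mem_upper (le_of_lt hy)).symm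
    · simp only [Function.comp, squeezeUp_of_nonneg (le_of_lt hy)]
  · refine he.comp (g := fun p : S3 × ℝ => (squeezeUp p.1, p.2 + 0))
      (embedsOn_cov (u := fun _ => 0) (l := stretchDown) hφ (by fun_prop) ?_ ?_)
      (mapsTo_cov (u := fun _ => 0) hm fun x _ => by simp)
    · refine continuousOn_stretchDown.mono ?_
      rintro _ ⟨x, hx, rfl⟩
      have h1 := h.neg_one_lt hx
      rw [mem_ofPred_eq, squeezeUp, pt_three (squeezeUp_sum h1)]
      rcases le_total (x.1 3) 0 with h0 | h0
      · rw [min_eq_left h0]; linarith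
      · rw [min_eq_right h0]; linarith
    · exact fun x hx => stretchDown_squeezeUp (h.neg_one_lt hx)

/-- If a cover of the complement of a connected sum embeds, so does a cover of the complement of
its lower summand, by reflection. -/
theorem IsSum.hasEmbeddedCover_right (h : IsSum J J₁ J₂) {N N₂ : Circle × ℂ → S3}
    (hN : IsTube N J) (hN₂ : IsTube N₂ J₂) (hJ : HasEmbeddedCover J) : HasEmbeddedCover J₂ := by
  have := (h.reflect.hasEmbeddedCover_left (hN.image_homeomorph reflection)
    (hN₂.image_homeomorph reflection) (hJ.image_homeomorph reflection)).image_homeomorph reflection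
  rw [← image_comp] at this
  have e : reflection ∘ reflection = id := by ext1 x; simp
  rwa [e, image_id] at this

end Sums

/-! ### Classifying maps of infinite cyclic covers -/

section AbstractCovers

/-- The pullback of a covering map is a covering map. -/
theorem isCoveringMap_pullback {A B C : Type*} [TopologicalSpace A] [TopologicalSpace B]
    [TopologicalSpace C] {p : A → B} (hp : IsCoveringMap p) {g : C → B} (hg : Continuous g) :
    IsCoveringMap (fun y : {q : C × A // g q.1 = p q.2} => y.1.1) := by
  intro x
  obtain ⟨hd, U, hxU, hU, hpU, H, hH⟩ := hp (g x)
  have hcont : Continuous (fun y : {q : C × A // g q.1 = p q.2} => y.1.1) := by fun_prop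
  have hHs : ∀ y, p (H.symm y).1 = y.1.1 := fun y => by rw [← hH, H.apply_symm_apply]
  refine IsEvenlyCovered.to_isEvenlyCovered_preimage
    (show IsEvenlyCovered _ x (p ⁻¹' {g x}) from
      ⟨hd, g ⁻¹' U, hxU, hU.preimage hg, (hU.preimage hg).preimage hcont, ?_, ?_⟩)
  · exact
    { toFun := fun y => (⟨y.1.1.1, y.2⟩, (H ⟨y.1.1.2, by
        have := y.1.2; have h2 : g y.1.1.1 ∈ U := y.2
        rw [this] at h2; exact h2⟩).2)
      invFun := fun z => ⟨⟨(z.1.1, (H.symm (⟨g z.1.1, z.1.2⟩, z.2)).1), by rw [hHs]⟩, z.1.2⟩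
      left_inv := fun y => by
        apply Subtype.ext
        apply Subtype.ext
        refine Prod.ext rfl ?_
        have h2 : p y.1.1.2 ∈ U := by
          have := y.1.2; have h2 : g y.1.1.1 ∈ U := y.2
          rw [this] at h2; exact h2
        have : ((⟨g y.1.1.1, y.2⟩, (H ⟨y.1.1.2, h2⟩).2) : U × (p ⁻¹' {g x}))
            = H ⟨y.1.1.2, h2⟩ := by
          refine Prod.ext (Subtype.ext ?_) rfl
          rw [hH]; exact y.1.2
        simp only [this, H.symm_apply_apply]
      right_inv := fun z => by simp
      continuous_toFun := by fun_prop
      continuous_invFun := by fun_prop }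
  · intro y; rfl

variable {X E : Type} [TopologicalSpace X] [TopologicalSpace E]

/-- An infinite cyclic cover of a compact space carries a real function that grows by `2π` under
the generating deck transformation: local such functions are averaged with a partition of
unity. -/
theorem exists_height [CompactSpace E] [T2Space E] {p : X → E} (hp : IsCoveringMap p)
    (hs : Function.Surjective p) {τ : X ≃ₜ X}
    (hτ : ∀ x y, p x = p y ↔ ∃ n : ℤ, (τ ^ n) x = y) (hfree : ∀ n : ℤ, n ≠ 0 → ∀ x, (τ ^ n) x ≠ x) :
    ∃ h : X → ℝ, Continuous h ∧ ∀ x, h (τ x) = h x + 2 * Real.pi := by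
  classical
  have hinj : ∀ (m n : ℤ) x, (τ ^ m) x = (τ ^ n) x → m = n := by
    intro m n x h
    by_contra hne
    refine hfree (m - n) (sub_ne_zero.2 hne) ((τ ^ n) x) ?_
    rw [← Homeomorph.mul_apply, ← zpow_add, sub_add_cancel, h]
  have hpτ : ∀ (n : ℤ) x, p ((τ ^ n) x) = p x := fun n x => ((hτ _ _).2 ⟨n, rfl⟩).symm
  have hloc : ∀ e : E, ∃ (U : Set E) (sec : E → X), IsOpen U ∧ e ∈ U ∧ ContinuousOn sec U ∧
      ∀ y ∈ U, p (sec y) = y := by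
    intro e
    obtain ⟨x, rfl⟩ := hs e
    obtain ⟨φ, hφ, e⟩ := hp.isLocalHomeomorph x
    refine ⟨φ.target, φ.symm, φ.open_target, ?_, φ.continuousOn_symm, fun y hy => ?_⟩
    · rw [e]; exact φ.map_source hφ
    · have := φ.right_inv hy
      rwa [← e] at this
  choose U sec hU heU hsec hpsec using hloc
  have hex : ∀ e x, p x ∈ U e → ∃ n : ℤ, (τ ^ n) (sec e (p x)) = x := fun e x hx =>
    (hτ _ _).1 (hpsec e _ hx)
  -- `n e x` is the number of deck transformations from the sheet of the local section at `e` to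
  -- `x`
  let n : E → X → ℤ := fun e x => if h : p x ∈ U e then (hex e x h).choose else 0
  have hn : ∀ e x, p x ∈ U e → (τ ^ n e x) (sec e (p x)) = x := fun e x hx => by
    simp only [n, hx, dif_pos]; exact (hex e x hx).choose_spec
  have hnτ : ∀ e x, p x ∈ U e → n e (τ x) = n e x + 1 := fun e x hx => by
    have h1 : p (τ x) = p x := hpτ 1 x
    refine hinj _ _ (sec e (p x)) ?_
    have h2 := hn e (τ x) (by rwa [h1])
    rw [h1] at h2
    rw [h2, add_comm, zpow_add, Homeomorph.mul_apply, hn e x hx, zpow_one]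
  have hnc : ∀ e x, p x ∈ U e → ∀ᶠ y in 𝓝 x, n e y = n e x := by
    intro e x hx
    obtain ⟨φ, hφ, hpφ⟩ := hp.isLocalHomeomorph x
    have hc : ContinuousAt (fun y => (τ ^ n e x) (sec e (p y))) x := by
      refine (τ ^ n e x).continuous.continuousAt.comp ?_
      exact ((hsec e).continuousAt ((hU e).mem_nhds hx)).comp hp.continuous.continuousAt
    have h1 : ∀ᶠ y in 𝓝 x, (τ ^ n e x) (sec e (p y)) ∈ φ.source := by
      refine hc.eventually_mem (φ.open_source.mem_nhds ?_)
      rw [hn e x hx]; exact hφ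
    filter_upwards [h1, φ.open_source.mem_nhds hφ,
      hp.continuous.continuousAt.preimage_mem_nhds ((hU e).mem_nhds hx)] with y hy1 hy2 hy3
    refine hinj _ _ (sec e (p y)) ?_
    rw [hn e y hy3]
    refine (φ.injOn hy1 hy2 ?_).symm
    rw [← hpφ, hpτ, hpsec e _ hy3]
  obtain ⟨t, ht⟩ := isCompact_univ.elim_finite_subcover U hU fun e _ => mem_iUnion.2 ⟨e, heU e⟩
  obtain ⟨ρ, hρ⟩ := PartitionOfUnity.exists_isSubordinate isClosed_univ (fun e : t => U e)
    (fun e => hU e) (by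
      intro y hy
      obtain ⟨e, he, hy⟩ := mem_iUnion₂.1 (ht hy)
      exact mem_iUnion.2 ⟨⟨e, he⟩, hy⟩)
  refine ⟨fun x => ∑ e : t, ρ e (p x) * (2 * Real.pi * n e x), ?_, fun x => ?_⟩
  · refine continuous_finsetSum _ fun e _ => continuous_iff_continuousAt.2 fun x => ?_
    by_cases hx : p x ∈ tsupport (ρ e)
    · refine ContinuousAt.mul ((ρ e).continuous.comp hp.continuous).continuousAt ?_
      refine (continuousAt_const (y := 2 * Real.pi * (n e x : ℝ))).congr ?_
      filter_upwards [hnc e x (hρ e hx)] with y hy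
      rw [hy]
    · refine (continuousAt_const (y := (0 : ℝ))).congr ?_
      have : (tsupport (ρ e))ᶜ ∈ 𝓝 (p x) := (isClosed_tsupport _).isOpen_compl.mem_nhds hx
      filter_upwards [hp.continuous.continuousAt.preimage_mem_nhds this] with y hy
      rw [image_eq_zero_of_notMem_tsupport hy, zero_mul]
  · have h1 : p (τ x) = p x := hpτ 1 x
    have h2 : ∑ e : t, ρ e (p x) = 1 := by
      rw [← finsum_eq_sum_of_fintype]; exact ρ.sum_eq_one (mem_univ _)
    have h3 : ∀ e : t, ρ e (p (τ x)) * (2 * Real.pi * n e (τ x)) =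
        ρ e (p x) * (2 * Real.pi * n e x) + ρ e (p x) * (2 * Real.pi) := fun e => by
      rw [h1]
      by_cases hx : p x ∈ tsupport (ρ e)
      · rw [hnτ e x (hρ e hx)]; push_cast; ring
      · rw [image_eq_zero_of_notMem_tsupport hx]; ring
    change ∑ e : t, ρ e (p (τ x)) * (2 * Real.pi * n e (τ x)) =
      (∑ e : t, ρ e (p x) * (2 * Real.pi * n e x)) + 2 * Real.pi
    rw [Finset.sum_congr rfl fun e _ => h3 e, Finset.sum_add_distrib, ← Finset.sum_mul, h2, one_mul]

/-- Every infinite cyclic cover of a compact space is classified by a circle-valued map. -/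
theorem IsInfiniteCyclicCover.exists_classifying_map [CompactSpace E] [T2Space E] {p : X → E}
    (hp : IsInfiniteCyclicCover p) : ∃ f : E → Circle, Continuous f ∧
      Nonempty (X ≃ₜ {q : E × ℝ // f q.1 = Circle.exp q.2}) := by
  obtain ⟨τ, hτ, hfree⟩ := hp.deck
  have hcov := hp.covering
  obtain ⟨h, hh, hhτ⟩ := exists_height hcov hp.surjective hτ hfree
  have hhn : ∀ (n : ℤ) x, h ((τ ^ n) x) = h x + n * (2 * Real.pi) := by
    intro n
    induction n with
    | zero => intro x; simp
    | succ n ih =>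
      intro x
      rw [add_comm, zpow_add, Homeomorph.mul_apply, zpow_one, hhτ, ih]; push_cast; ring
    | pred n ih =>
      intro x
      have := hhτ ((τ ^ (-(n : ℤ) - 1)) x)
      rw [← zpow_one τ, ← Homeomorph.mul_apply, zpow_one τ, ← zpow_one_add, add_sub_cancel,
        ih] at this
      push_cast at this ⊢; linarith
  let f : E → Circle := fun y => Circle.exp (h (Function.surjInv hp.surjective y))
  have hfp : ∀ x, f (p x) = Circle.exp (h x) := fun x => by
    obtain ⟨n, hn⟩ := (hτ _ _).1 (Function.surjInv_eq hp.surjective (p x))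
    simp only [f]
    nth_rw 2 [← hn]
    rw [hhn, Circle.exp_add, exp_int_mul_two_pi, mul_one]
  have hf : Continuous f := by
    rw [(hcov.isQuotientMap hp.surjective).continuous_iff]
    exact (Circle.exp.continuous.comp hh).congr fun x => (hfp x).symm
  refine ⟨f, hf, ⟨?_⟩⟩
  -- the projection and the height together give the comparison with the pullback
  let j : X → {q : E × ℝ // f q.1 = Circle.exp q.2} := fun x => ⟨(p x, h x), hfp x⟩
  have hj : Continuous j := by have := hcov.continuous; fun_prop
  have hbij : Function.Bijective j := by
    constructor
    · intro x y e
      have e' := congrArg Subtype.val e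
      simp only [j, Prod.mk.injEq] at e'
      obtain ⟨n, hn⟩ := (hτ x y).1 e'.1
      have h1 := hhn n x
      rw [hn, ← e'.2] at h1
      have h2 : (n : ℝ) * (2 * Real.pi) = 0 := by linarith
      have h3 : n = 0 := by
        have := Real.pi_pos
        rcases mul_eq_zero.1 h2 with h | h
        · exact_mod_cast h
        · linarith
      rw [h3] at hn
      simpa using hn
    · rintro ⟨⟨y, t⟩, hy⟩
      obtain ⟨x, rfl⟩ := hp.surjective y
      simp only [hfp] at hy
      obtain ⟨m, hm⟩ := Circle.exp_eq_exp.1 hy.symm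
      refine ⟨(τ ^ m) x, Subtype.ext (Prod.ext ?_ ?_)⟩
      · exact ((hτ _ _).2 ⟨m, rfl⟩).symm
      · simp only [j]; rw [hhn, hm]
  have hloc : IsLocalHomeomorph j := by
    have h1 : IsLocalHomeomorph (fun y : {q : E × ℝ // f q.1 = Circle.exp q.2} => y.1.1) :=
      (isCoveringMap_pullback Circle.isCoveringMap_exp hf).isLocalHomeomorph
    refine IsLocalHomeomorph.of_comp
      (g := fun y : {q : E × ℝ // f q.1 = Circle.exp q.2} => y.1.1) (f := j) ?_ h1 hj
    exact hcov.isLocalHomeomorph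
  exact (Equiv.ofBijective j hbij).toHomeomorphOfContinuousOpen hj hloc.isOpenMap

end AbstractCovers

/-! ### Radial maps of a tube -/

section Radial

open Classical in
/-- The distance to the core in the coordinates of the tube `N`, read as `2` off the tube. -/
noncomputable def tubeNorm (N : Circle × ℂ → S3) (x : S3) : ℝ :=
  if x ∈ range N then ‖(tubeCoord N x).2‖ else 2

open Classical in
/-- The map that moves the points of the tube `N` radially, from distance `s` to distance `a s` of
the core, and fixes the points off the tube. It is used for functions `a` with `a s = s` for `s ≥
2`, which makes it continuous at the end of the tube. -/
noncomputable def radial (N : Circle × ℂ → S3) (a : ℝ → ℝ) (x : S3) : S3 :=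
  if x ∈ range N then
    N ((tubeCoord N x).1, ((a ‖(tubeCoord N x).2‖ / ‖(tubeCoord N x).2‖ : ℝ) : ℂ) *
      (tubeCoord N x).2)
  else x

variable {N : Circle × ℂ → S3} {J : Set S3}

theorem IsTube.tubeNorm_apply (hN : IsTube N J) (p : Circle × ℂ) : tubeNorm N (N p) = ‖p.2‖ := by
  rw [tubeNorm, if_pos ⟨p, rfl⟩, hN.tubeCoord_apply]

theorem IsTube.notMem_iff (hN : IsTube N J) {x : S3} : x ∉ J ↔ 0 < tubeNorm N x := by
  by_cases hx : x ∈ range N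
  · obtain ⟨p, rfl⟩ := hx
    rw [hN.tubeNorm_apply, hN.mem_iff, norm_pos_iff]
  · rw [tubeNorm, if_neg hx]
    exact iff_of_true (fun h => hx (hN.subset_range h)) (by norm_num)

theorem IsTube.mem_exterior_iff (hN : IsTube N J) {x : S3} :
    x ∈ exterior N ↔ 1 ≤ tubeNorm N x := by
  rw [exterior, mem_compl_iff, ← not_lt, not_iff_not]
  by_cases hx : x ∈ range N
  · obtain ⟨p, rfl⟩ := hx
    rw [hN.tubeNorm_apply, hN.isOpenEmbedding.injective.mem_set_image]; rfl
  · rw [tubeNorm, if_neg hx]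
    refine iff_of_false ?_ (by norm_num)
    rintro ⟨p, -, rfl⟩; exact hx ⟨p, rfl⟩

theorem IsTube.isClosed_exterior (hN : IsTube N J) : IsClosed (exterior N) := by
  refine IsOpen.isClosed_compl (hN.isOpenEmbedding.isOpenMap _ ?_)
  exact isOpen_lt (by fun_prop) (by fun_prop)

theorem IsTube.exterior_subset (hN : IsTube N J) : exterior N ⊆ Jᶜ := fun x hx => by
  rw [mem_compl_iff, hN.notMem_iff]
  linarith [hN.mem_exterior_iff.1 hx]

theorem IsTube.isClosed_tubeNorm_le (hN : IsTube N J) {s : ℝ} (hs : s < 2) :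
    IsClosed {x | tubeNorm N x ≤ s} := by
  have : {x | tubeNorm N x ≤ s} = N '' (univ ×ˢ Metric.closedBall 0 s) := by
    ext x
    by_cases hx : x ∈ range N
    · obtain ⟨p, rfl⟩ := hx
      rw [mem_ofPred_eq, hN.tubeNorm_apply, hN.isOpenEmbedding.injective.mem_set_image]
      simp
    · rw [mem_ofPred_eq, tubeNorm, if_neg hx]
      refine iff_of_false (by linarith) ?_
      rintro ⟨p, -, rfl⟩; exact hx ⟨p, rfl⟩
  rw [this]
  exact ((isCompact_univ.prod (isCompact_closedBall _ _)).image hN.continuous).isClosed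

theorem IsTube.isOpen_lt_tubeNorm (hN : IsTube N J) {s : ℝ} (hs : s < 2) :
    IsOpen {x | s < tubeNorm N x} := by
  have : {x | s < tubeNorm N x} = {x | tubeNorm N x ≤ s}ᶜ := by ext x; simp
  rw [this]
  exact (hN.isClosed_tubeNorm_le hs).isOpen_compl

theorem IsTube.tubeNorm_radial (hN : IsTube N J) {a : ℝ → ℝ} {x : S3} (hx : x ∉ J)
    (ha : 0 ≤ a (tubeNorm N x)) (h2 : a 2 = 2) :
    tubeNorm N (radial N a x) = a (tubeNorm N x) := by
  rw [hN.notMem_iff] at hx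
  by_cases hr : x ∈ range N
  · obtain ⟨p, rfl⟩ := hr
    rw [hN.tubeNorm_apply] at *
    rw [radial, if_pos ⟨p, rfl⟩, hN.tubeNorm_apply, hN.tubeCoord_apply, norm_mul,
      Complex.norm_real, Real.norm_eq_abs, abs_of_nonneg (by positivity)]
    field_simp
  · rw [radial, if_neg hr, tubeNorm, if_neg hr, h2]

theorem IsTube.radial_radial (hN : IsTube N J) {a b : ℝ → ℝ} {x : S3} (hx : x ∉ J)
    (ha : 0 < a (tubeNorm N x)) :
    radial N b (radial N a x) = radial N (fun s => b (a s)) x := by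
  rw [hN.notMem_iff] at hx
  by_cases hr : x ∈ range N
  · obtain ⟨p, rfl⟩ := hr
    rw [hN.tubeNorm_apply] at *
    have h1 : radial N a (N p) = N (p.1, ((a ‖p.2‖ / ‖p.2‖ : ℝ) : ℂ) * p.2) := by
      rw [radial, if_pos ⟨p, rfl⟩, hN.tubeCoord_apply]
    have h2 : ‖((a ‖p.2‖ / ‖p.2‖ : ℝ) : ℂ) * p.2‖ = a ‖p.2‖ := by
      rw [norm_mul, Complex.norm_real, Real.norm_eq_abs, abs_of_nonneg (by positivity)]
      field_simp
    rw [h1, radial, if_pos ⟨_, rfl⟩, hN.tubeCoord_apply, radial, if_pos ⟨p, rfl⟩,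
      hN.tubeCoord_apply]
    simp only [h2]
    rw [← mul_assoc, ← Complex.ofReal_mul]
    congr 4
    field_simp
  · rw [radial, radial, radial, if_neg hr, if_neg hr, if_neg hr]

theorem IsTube.radial_eq_self (hN : IsTube N J) {a : ℝ → ℝ} {x : S3} (hx : x ∉ J)
    (ha : a (tubeNorm N x) = tubeNorm N x) : radial N a x = x := by
  rw [hN.notMem_iff] at hx
  by_cases hr : x ∈ range N
  · obtain ⟨p, rfl⟩ := hr
    rw [hN.tubeNorm_apply] at *
    rw [radial, if_pos ⟨p, rfl⟩, hN.tubeCoord_apply, ha, div_self hx.ne', Complex.ofReal_one,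
      one_mul]
  · rw [radial, if_neg hr]

/-- Radial maps depend continuously on the point and on parameters. -/
theorem IsTube.continuousOn_radial_param (hN : IsTube N J) {Y : Type*} [TopologicalSpace Y]
    {a : Y × ℝ → ℝ} {s0 : ℝ} (h0 : 0 ≤ s0)
    (ha : ContinuousOn a (univ ×ˢ Ioi s0)) (h2 : ∀ y s, 2 ≤ s → a (y, s) = s) :
    ContinuousOn (fun p : Y × S3 => radial N (fun s => a (p.1, s)) p.2)
      (univ ×ˢ {x | s0 < tubeNorm N x}) := by
  -- the formula in the tube is used up to distance `2`, the identity from there on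
  let C : Set S3 := N '' (univ ×ˢ Metric.closedBall 0 2)
  let B : Set S3 := N '' (univ ×ˢ Metric.ball 0 2)
  have hC : IsClosed C :=
    ((isCompact_univ.prod (isCompact_closedBall _ _)).image hN.continuous).isClosed
  have hB : IsOpen B := hN.isOpenEmbedding.isOpenMap _ (isOpen_univ.prod Metric.isOpen_ball)
  have hsub : ∀ x, s0 < tubeNorm N x → x ∉ J := fun x hx => by
    rw [hN.notMem_iff]; linarith
  refine continuousOn_of_closed_cover (A := univ ×ˢ C) (B := univ ×ˢ Bᶜ) (isClosed_univ.prod hC)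
    (isClosed_univ.prod hB.isClosed_compl) ?_ ?_ ?_
  · rintro ⟨y, x⟩ -
    by_cases hx : x ∈ B
    · refine Or.inl ⟨mem_univ _, ?_⟩
      exact image_mono (prod_mono_right Metric.ball_subset_closedBall) hx
    · exact Or.inr ⟨mem_univ _, hx⟩
  · let S : Set (Y × S3) := (univ ×ˢ {x | s0 < tubeNorm N x}) ∩ univ ×ˢ C
    have hr : ∀ p ∈ S, p.2 ∈ range N := fun p hp => image_subset_range _ _ hp.2.2
    have hc : ContinuousOn (fun p : Y × S3 => tubeCoord N p.2) S :=
      hN.continuousOn_tubeCoord.comp continuousOn_snd hr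
    have hn : ∀ p ∈ S, s0 < ‖(tubeCoord N p.2).2‖ := fun p hp => by
      have := hp.1.2
      rwa [mem_ofPred_eq, tubeNorm, if_pos (hr p hp)] at this
    have hc2 : ContinuousOn (fun p : Y × S3 => (tubeCoord N p.2).2) S :=
      continuous_snd.comp_continuousOn hc
    have hq : ContinuousOn (fun p : Y × S3 => a (p.1, ‖(tubeCoord N p.2).2‖)) S :=
      ha.comp (continuousOn_fst.prodMk hc2.norm) fun p hp => ⟨mem_univ _, hn p hp⟩
    have : ContinuousOn (fun p : Y × S3 => N ((tubeCoord N p.2).1,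
        ((a (p.1, ‖(tubeCoord N p.2).2‖) / ‖(tubeCoord N p.2).2‖ : ℝ) : ℂ) *
        (tubeCoord N p.2).2)) S := by
      refine hN.continuous.comp_continuousOn
        ((continuous_fst.comp_continuousOn hc).prodMk (ContinuousOn.mul ?_ hc2))
      refine Complex.continuous_ofReal.comp_continuousOn (hq.div hc2.norm fun p hp => ?_)
      have := hn p hp
      linarith
    refine this.congr fun p hp => ?_
    rw [radial, if_pos (hr p hp)]
  · refine continuousOn_snd.congr fun p hp => ?_
    refine hN.radial_eq_self (hsub _ hp.1.2) (h2 _ _ ?_)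
    by_cases hr : p.2 ∈ range N
    · obtain ⟨q, hq⟩ := hr
      rw [← hq, hN.tubeNorm_apply]
      by_contra hlt
      exact hp.2.2 ⟨q, ⟨mem_univ _, by simpa using hlt⟩, hq⟩
    · rw [tubeNorm, if_neg hr]

theorem IsTube.continuousOn_radial (hN : IsTube N J) {a : ℝ → ℝ} {s0 : ℝ} (h0 : 0 ≤ s0)
    (ha : ContinuousOn a (Ioi s0)) (h2 : ∀ s, 2 ≤ s → a s = s) :
    ContinuousOn (radial N a) {x | s0 < tubeNorm N x} := by
  have := hN.continuousOn_radial_param (Y := Unit) (a := fun p => a p.2) h0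
    (ha.comp continuousOn_snd fun p hp => hp.2) (fun _ => h2)
  exact this.comp (f := fun x => ((), x)) (by fun_prop) fun x hx => ⟨mem_univ _, hx⟩

theorem IsTube.compl_eq (hN : IsTube N J) : Jᶜ = {x | 0 < tubeNorm N x} := by
  ext x; exact hN.notMem_iff

/-- A radial map of a knot complement is homotopic to the identity, so that it changes a
circle-valued map by a continuous angle only. -/
theorem IsTube.exists_angle_radial (hN : IsTube N J) {f : S3 → Circle} (hf : ContinuousOn f Jᶜ)
    {a : ℝ → ℝ} (ha : ContinuousOn a (Ioi 0)) (hpos : ∀ s, 0 < s → 0 < a s)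
    (h2 : ∀ s, 2 ≤ s → a s = s) :
    ∃ u : S3 → ℝ, ContinuousOn u Jᶜ ∧ ∀ x ∉ J, f (radial N a x) = f x * Circle.exp (u x) := by
  let b : I × ℝ → ℝ := fun p => (1 - p.1) * p.2 + p.1 * a p.2
  have hb : ContinuousOn b (univ ×ˢ Ioi 0) := by
    have : ContinuousOn (fun p : I × ℝ => a p.2) (univ ×ˢ Ioi 0) :=
      ha.comp continuousOn_snd fun p hp => hp.2
    fun_prop
  have hbpos : ∀ (y : I) s, 0 < s → 0 < b (y, s) := fun y s hs => by
    have h1 := hpos s hs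
    have h3 := y.2.1; have h4 := y.2.2
    simp only [b]
    rcases h3.eq_or_lt with h | h
    · rw [← h]; linarith
    · have : 0 < (y : ℝ) * a s := by positivity
      have : 0 ≤ (1 - (y : ℝ)) * s := mul_nonneg (by linarith) hs.le
      linarith
  have hb2 : ∀ (y : I) s, 2 ≤ s → b (y, s) = s := fun y s hs => by
    simp only [b, h2 s hs]; ring
  have hm : MapsTo (fun p : I × S3 => radial N (fun s => b (p.1, s)) p.2) (univ ×ˢ Jᶜ) Jᶜ := by
    rintro ⟨y, x⟩ ⟨-, hx⟩
    have hx' := hN.notMem_iff.1 hx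
    rw [mem_compl_iff, hN.notMem_iff, hN.tubeNorm_radial hx (hbpos y _ hx').le (hb2 y 2 le_rfl)]
    exact hbpos y _ hx'
  have hc := hN.continuousOn_radial_param le_rfl hb hb2
  rw [← hN.compl_eq] at hc
  obtain ⟨u, hu, h⟩ := exists_angle_of_homotopyOn (S := Jᶜ)
    (fun p : I × S3 => f (radial N (fun s => b (p.1, s)) p.2)) (hf.comp hc hm)
  refine ⟨u, hu, fun x hx => ?_⟩
  have h1 := h x hx
  simp only [b, Icc.coe_one, Icc.coe_zero, sub_self, zero_mul, one_mul, sub_zero, zero_add,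
    add_zero] at h1
  rw [h1, hN.radial_eq_self (a := fun s => s) hx rfl]

end Radial

/-! ### The exterior and the complement of a knot -/

section Exterior

variable {N : Circle × ℂ → S3} {J : Set S3}

/-- The radial retraction of the complement of the core of the tube `N` onto the exterior. -/
noncomputable def retraction (N : Circle × ℂ → S3) : S3 → S3 := radial N fun s => max s 1

theorem IsTube.retraction_mem (hN : IsTube N J) {x : S3} (hx : x ∉ J) :
    retraction N x ∈ exterior N := by
  rw [hN.mem_exterior_iff, retraction, hN.tubeNorm_radial hx (by positivity) (by norm_num)]
  exact le_max_right _ _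

theorem IsTube.retraction_eq_self (hN : IsTube N J) {x : S3} (hx : x ∈ exterior N) :
    retraction N x = x :=
  hN.radial_eq_self (hN.exterior_subset hx) (max_eq_left (hN.mem_exterior_iff.1 hx))

theorem IsTube.continuousOn_retraction (hN : IsTube N J) : ContinuousOn (retraction N) Jᶜ := by
  rw [hN.compl_eq]
  exact hN.continuousOn_radial le_rfl (by fun_prop) fun s hs => max_eq_left (by linarith)

/-- A circle-valued map on the exterior extends to the complement of the core, constantly along the
rays of the tube. -/
theorem IsTube.exists_extension (hN : IsTube N J) {f : exterior N → Circle} (hf : Continuous f) :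
    ∃ f' : S3 → Circle, ContinuousOn f' Jᶜ ∧ (∀ x ∉ J, f' (retraction N x) = f' x) ∧
      ∀ x : exterior N, f' x = f x := by
  classical
  let f' : S3 → Circle := fun x => if h : retraction N x ∈ exterior N then f ⟨_, h⟩ else 1
  have h1 : ∀ x : exterior N, f' x = f x := fun x => by
    have := hN.retraction_eq_self x.2
    simp [f', this]
  refine ⟨f', ?_, fun x hx => ?_, h1⟩
  · rw [continuousOn_iff_continuous_domRestrict]
    have h2 : Continuous fun x : (Jᶜ : Set S3) => retraction N x :=
      continuousOn_iff_continuous_domRestrict.1 hN.continuousOn_retraction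
    have h3 : Continuous fun x : (Jᶜ : Set S3) =>
        f ⟨retraction N x, hN.retraction_mem x.2⟩ := hf.comp (h2.subtype_mk _)
    refine h3.congr fun x => ?_
    simp [f', hN.retraction_mem x.2]
  · have h2 := hN.retraction_mem hx
    rw [h1 ⟨_, h2⟩]
    simp [f', h2]

/-- Sliding along the rays of the tube joins each point of the cover of the complement to the
part over the exterior. -/
theorem IsTube.isConnected_cov_of_exterior (hN : IsTube N J) {f : S3 → Circle}
    (hr : ∀ x ∉ J, f (retraction N x) = f x)
    (hc : IsConnected (cov J f ∩ {p | p.1 ∈ exterior N})) : IsConnected (cov J f) := by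
  obtain ⟨⟨p0, hp0⟩, hc⟩ := hc
  refine ⟨⟨p0, hp0.1⟩, isPreconnected_of_forall p0 ?_⟩
  rintro ⟨x, t⟩ ⟨hx : x ∉ J, hxt : f x = Circle.exp t⟩
  have hx' := hN.notMem_iff.1 hx
  -- `P s` has its distance to the core raised to at least `s`
  let P : I → S3 × ℝ := fun σ' => (radial N (fun s => max s σ') x, t)
  have hpos : ∀ y : I, 0 < max (tubeNorm N x) y := fun y => lt_max_of_lt_left hx'
  have hcont : Continuous P := by
    have := hN.continuousOn_radial_param (Y := I) (a := fun p => max p.2 p.1) le_rfl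
      (by fun_prop) (fun y s hs => max_eq_left (by linarith [y.2.2]))
    have := this.comp_continuous (f := fun y : I => (y, x)) (by fun_prop)
      fun y => ⟨mem_univ _, hx'⟩
    exact this.prodMk continuous_const
  have hPJ : ∀ y, (P y).1 ∉ J := fun y => by
    change radial N (fun s => max s y) x ∉ J
    rw [hN.notMem_iff, hN.tubeNorm_radial (a := fun s => max s y) hx (hpos y).le
      (max_eq_left (by linarith [y.2.2]))]
    exact hpos y
  have hPr : ∀ y, retraction N (P y).1 = retraction N x := fun y => by
    rw [retraction, hN.radial_radial hx (hpos y)]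
    congr 1
    ext s
    rw [max_assoc, max_eq_right y.2.2]
  have h1 : P 1 = (retraction N x, t) := rfl
  have h0 : P 0 = (x, t) := by
    exact Prod.ext (hN.radial_eq_self (a := fun s => max s (0 : I)) hx (max_eq_left hx'.le)) rfl
  refine ⟨range P ∪ cov J f ∩ {p | p.1 ∈ exterior N}, ?_, Or.inr hp0, Or.inl ⟨0, h0⟩, ?_⟩
  · refine union_subset ?_ inter_subset_left
    rintro _ ⟨y, rfl⟩
    refine ⟨hPJ y, ?_⟩
    rw [← hr _ (hPJ y), hPr, hr x hx]; exact hxt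
  · refine IsPreconnected.union (retraction N x, t) ⟨1, h1⟩ ?_ (isPreconnected_range hcont) hc
    refine ⟨⟨hN.exterior_subset (hN.retraction_mem hx), ?_⟩, hN.retraction_mem hx⟩
    exact (hr x hx).trans hxt

/-- The pullback of the universal cover of the circle to the exterior is the part of the cover of
the complement that lies over the exterior. -/
theorem IsTube.isEmbedding_pullback (hN : IsTube N J) (f : S3 → Circle) :
    IsEmbedding (fun q : {q : exterior N × ℝ // f q.1 = Circle.exp q.2} =>
      (⟨(q.1.1, q.1.2), hN.exterior_subset q.1.1.2, q.2⟩ : cov J f)) := by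
  refine IsEmbedding.of_comp (by fun_prop) continuous_subtype_val ?_
  exact (IsEmbedding.subtypeVal.prodMap IsEmbedding.id).comp IsEmbedding.subtypeVal

/-- The part over the exterior of a cover of the complement, as a pullback to the exterior. -/
def toPullback {f : S3 → Circle} {f₀ : exterior N → Circle} (h : ∀ x : exterior N, f x = f₀ x)
    (y : (cov J f ∩ {p | p.1 ∈ exterior N} : Set (S3 × ℝ))) :
    {q : exterior N × ℝ // f₀ q.1 = Circle.exp q.2} :=
  ⟨(⟨y.1.1, y.2.2⟩, y.1.2), by rw [← h]; exact y.2.1.2⟩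

theorem isEmbedding_toPullback {f : S3 → Circle} {f₀ : exterior N → Circle}
    (h : ∀ x : exterior N, f x = f₀ x) : IsEmbedding (toPullback (J := J) h) := by
  refine IsEmbedding.of_comp (g := fun q => ((q.1.1 : S3), q.1.2)) ?_ (by fun_prop) ?_
  · unfold toPullback
    fun_prop
  · exact IsEmbedding.subtypeVal

theorem IsTube.isConnected_over_exterior (hN : IsTube N J) {f : S3 → Circle}
    {f₀ : exterior N → Circle} (h : ∀ x : exterior N, f x = f₀ x)
    [ConnectedSpace {q : exterior N × ℝ // f₀ q.1 = Circle.exp q.2}] :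
    IsConnected (cov J f ∩ {p | p.1 ∈ exterior N}) := by
  have h1 : Continuous fun q : {q : exterior N × ℝ // f₀ q.1 = Circle.exp q.2} =>
    ((q.1.1 : S3), q.1.2) := by fun_prop
  have h2 : range (fun q : {q : exterior N × ℝ // f₀ q.1 = Circle.exp q.2} =>
      ((q.1.1 : S3), q.1.2)) = cov J f ∩ {p | p.1 ∈ exterior N} := by
    ext q
    constructor
    · rintro ⟨y, rfl⟩
      refine ⟨⟨hN.exterior_subset y.1.1.2, ?_⟩, y.1.1.2⟩
      rw [h]; exact y.2
    · intro hq
      exact ⟨toPullback h ⟨q, hq⟩, rfl⟩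
  rw [← h2]
  exact isConnected_range h1

/-- The distances to the core after a push of the complement of the core into the interior of the
exterior. -/
noncomputable def push (s : ℝ) : ℝ := max s (1 + s / 2)

/-- The push of the complement of the core into the interior of the exterior lifts to an embedding
of covers. -/
theorem IsTube.exists_push (hN : IsTube N J) {f : S3 → Circle} (hf : ContinuousOn f Jᶜ) :
    ∃ g : S3 × ℝ → S3 × ℝ, EmbedsOn g (cov J f) ∧
      MapsTo g (cov J f) (cov J f ∩ {p | p.1 ∈ exterior N}) ∧
      ∀ p, (g p).1 = radial N push p.1 := by
  let a : ℝ → ℝ := push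
  have ha : Continuous a := by unfold a push; fun_prop
  have hapos : ∀ s, 0 < s → 1 < a s := fun s hs => lt_max_of_lt_right (by linarith)
  have ha2 : ∀ s, 2 ≤ s → a s = s := fun s hs => max_eq_left (by linarith)
  obtain ⟨u, hu, h⟩ := hN.exists_angle_radial hf ha.continuousOn
    (fun s hs => by linarith [hapos s hs]) ha2
  have hnorm : ∀ x ∉ J, 1 < tubeNorm N (radial N a x) := fun x hx => by
    have := hapos _ (hN.notMem_iff.1 hx)
    rwa [hN.tubeNorm_radial hx (by linarith) (ha2 2 le_rfl)]
  have hψ : ∀ x ∉ J, radial N a x ∉ J := fun x hx => by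
    rw [hN.notMem_iff]; linarith [hnorm x hx]
  let l : ℝ → ℝ := fun s => min s (2 * (s - 1))
  refine ⟨fun p => (radial N a p.1, p.2 + u p.1), embedsOn_cov (l := radial N l) ?_ hu ?_ ?_,
    fun p hp => ⟨mapsTo_cov hψ h hp, ?_⟩, fun p => rfl⟩
  · rw [hN.compl_eq]
    exact hN.continuousOn_radial le_rfl ha.continuousOn ha2
  · refine (hN.continuousOn_radial (s0 := 1) zero_le_one (by fun_prop)
      fun s hs => min_eq_left (by linarith)).mono ?_
    rintro _ ⟨x, hx, rfl⟩
    exact hnorm x hx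
  · intro x hx
    have h0 := hN.notMem_iff.1 hx
    rw [hN.radial_radial hx (by linarith [hapos _ h0])]
    refine hN.radial_eq_self hx ?_
    simp only [l, a, push]
    rcases le_total (tubeNorm N x) 2 with h2 | h2
    · rw [max_eq_right (by linarith), min_eq_right (by linarith)]; ring
    · rw [max_eq_left (by linarith), min_eq_left (by linarith)]
  · exact hN.mem_exterior_iff.2 (hnorm _ hp.1).le

/-- An embedding of an infinite cyclic cover of the exterior gives one of the cover of the
complement, by pushing the complement into the exterior. -/
theorem IsTube.hasEmbeddedCover (hN : IsTube N J) {X : Type} [TopologicalSpace X]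
    {p : X → exterior N} (hp : IsInfiniteCyclicCover p) {e : X → S3} (he : IsEmbedding e) :
    HasEmbeddedCover J := by
  have : CompactSpace (exterior N) := isCompact_iff_compactSpace.1 hN.isClosed_exterior.isCompact
  obtain ⟨f0, hf0, ⟨Φ⟩⟩ := hp.exists_classifying_map
  obtain ⟨f, hf, hr, hff⟩ := hN.exists_extension hf0
  have hX : ConnectedSpace X := hp.connected
  have : ConnectedSpace {q : exterior N × ℝ // f0 q.1 = Circle.exp q.2} :=
    Φ.surjective.connectedSpace Φ.continuous
  obtain ⟨g, hg, hgA, -⟩ := hN.exists_push hf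
  have : Nonempty S3 := ⟨N (1, 0)⟩
  obtain ⟨e', he', -⟩ := (he.comp (Φ.symm.isEmbedding.comp
    (isEmbedding_toPullback (J := J) hff))).exists_embedsOn
  exact ⟨f, hf, hN.isConnected_cov_of_exterior hr (hN.isConnected_over_exterior hff), e' ∘ g,
    he'.comp hg hgA⟩

/-- Restricting a cyclic cover of the complement to the exterior. -/
theorem IsTube.exists_infiniteCyclicCover (hN : IsTube N J) (h : HasEmbeddedCover J) :
    ∃ (X : Type) (_ : TopologicalSpace X) (p : X → exterior N),
      IsInfiniteCyclicCover p ∧ ∃ e : X → S3, IsEmbedding e := by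
  obtain ⟨f, hf, hc, e, he⟩ := h
  let f0 : exterior N → Circle := fun x => f x
  have hf0 : Continuous f0 :=
    continuousOn_iff_continuous_domRestrict.1 (hf.mono hN.exterior_subset)
  let X := {q : exterior N × ℝ // f0 q.1 = Circle.exp q.2}
  refine ⟨X, inferInstance, fun q => q.1.1, ⟨?_, ?_, ?_, ?_⟩, fun q => e (q.1.1, q.1.2), ?_⟩
  · obtain ⟨u, hu, h⟩ := hN.exists_angle_radial hf (a := fun s => max s 1) (by fun_prop)
      (fun s hs => by positivity) fun s hs => max_eq_left (by linarith)
    have hcov : ConnectedSpace (cov J f) := isConnected_iff_connectedSpace.1 hc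
    -- the retraction lifts to a surjection from the cover of the complement
    let g : cov J f → X := fun y => ⟨(⟨retraction N y.1.1, hN.retraction_mem y.2.1⟩,
      y.1.2 + u y.1.1), by
        refine (h _ y.2.1).trans ?_
        rw [Circle.exp_add]
        exact congrArg (· * Circle.exp (u y.1.1)) y.2.2⟩
    have hg : Continuous g := by
      have h1 : Continuous fun y : cov J f => retraction N y.1.1 :=
        hN.continuousOn_retraction.comp_continuous (by fun_prop) fun y => y.2.1
      have h2 : Continuous fun y : cov J f => u y.1.1 :=
        hu.comp_continuous (by fun_prop) fun y => y.2.1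
      exact ((h1.subtype_mk _).prodMk ((continuous_snd.comp continuous_subtype_val).add
        h2)).subtype_mk _
    refine Function.Surjective.connectedSpace (f := g) ?_ hg
    rintro ⟨⟨⟨x, hx⟩, t⟩, hxt⟩
    have hxJ := hN.exterior_subset hx
    have h1 := h x hxJ
    have h2 : radial N (fun s => max s 1) x = x := hN.retraction_eq_self hx
    rw [h2] at h1
    refine ⟨⟨(x, t - u x), hxJ, ?_⟩, ?_⟩
    · rw [Circle.exp_sub, ← hxt, eq_div_iff_mul_eq']; exact h1.symm
    · refine Subtype.ext (Prod.ext (Subtype.ext h2) ?_)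
      simp [g]
  · exact isCoveringMap_pullback Circle.isCoveringMap_exp hf0
  · intro x
    obtain ⟨t, ht⟩ := Circle.exp_surjective (f0 x)
    exact ⟨⟨(x, t), ht.symm⟩, rfl⟩
  · have h2π : ∀ t : ℝ, Circle.exp (t + 2 * Real.pi) = Circle.exp t := fun t => by simp
    have h2π' : ∀ t : ℝ, Circle.exp (t - 2 * Real.pi) = Circle.exp t := fun t => by simp
    let τ : X ≃ₜ X :=
      { toFun := fun q => ⟨(q.1.1, q.1.2 + 2 * Real.pi), by rw [h2π]; exact q.2⟩
        invFun := fun q => ⟨(q.1.1, q.1.2 - 2 * Real.pi), by rw [h2π']; exact q.2⟩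
        left_inv := fun q => by simp
        right_inv := fun q => by simp
        continuous_toFun := by fun_prop
        continuous_invFun := by fun_prop }
    have hτ : ∀ (n : ℤ) (q : X), ((τ ^ n) q).1 = (q.1.1, q.1.2 + n * (2 * Real.pi)) := by
      intro n
      induction n with
      | zero => intro q; simp
      | succ n ih =>
        intro q
        rw [zpow_add_one, Homeomorph.mul_apply, ih]
        have : (τ q).1 = (q.1.1, q.1.2 + 2 * Real.pi) := rfl
        rw [this]
        refine Prod.ext rfl ?_
        push_cast; ring
      | pred n ih =>
        intro q
        rw [zpow_sub_one, Homeomorph.mul_apply, ih]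
        have : ((τ⁻¹ : X ≃ₜ X) q).1 = (q.1.1, q.1.2 - 2 * Real.pi) := rfl
        rw [this]
        refine Prod.ext rfl ?_
        push_cast; ring
    refine ⟨τ, fun x y => ⟨fun hxy => ?_, ?_⟩, fun n hn x hx => ?_⟩
    · have h1 := x.2
      have hxy : x.1.1 = y.1.1 := hxy
      rw [hxy, y.2] at h1
      obtain ⟨m, hm⟩ := Circle.exp_eq_exp.1 h1
      exact ⟨m, Subtype.ext (by rw [hτ, hxy, ← hm])⟩
    · rintro ⟨n, rfl⟩
      exact (congrArg Prod.fst (hτ n x)).symm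
    · have h1 := congrArg Prod.snd (hτ n x)
      rw [hx] at h1
      have h2 : (n : ℝ) * (2 * Real.pi) = 0 := by simpa using h1
      have := Real.pi_pos
      rcases mul_eq_zero.1 h2 with h | h
      · exact hn (by exact_mod_cast h)
      · linarith
  · exact (show IsEmbedding fun y : cov J f => e y from he).comp (hN.isEmbedding_pullback f)

end Exterior

/-- Property IE may be tested on the covers of the complement of the knot, and so does not depend
on the tube. -/
theorem Knot.propertyIE_iff (k : Knot) : k.PropertyIE ↔ HasEmbeddedCover k.carrier := by
  constructor
  · rintro ⟨N, hN, X, _, p, hp, e, he⟩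
    exact hN.hasEmbeddedCover hp he
  · intro h
    obtain ⟨N, hN⟩ := k.tame
    exact ⟨N, hN, hN.exists_infiniteCyclicCover h⟩

/-! ### Infinite cyclic covers of bundles over the circle -/

section BundlesOverTheCircle

theorem dist_circle_exp_le (s t : ℝ) : dist (Circle.exp s) (Circle.exp t) ≤ |s - t| := by
  have h : ((Circle.exp s : ℂ) - Circle.exp t) =
      Circle.exp t * (Complex.exp (Complex.I * ((s - t : ℝ) : ℂ)) - 1) := by
    rw [mul_sub, mul_one, Circle.coe_exp, Circle.coe_exp, ← Complex.exp_add]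
    congr 2
    push_cast; ring
  change dist (Circle.exp s : ℂ) (Circle.exp t) ≤ |s - t|
  rw [dist_eq_norm, h, norm_mul, Circle.norm_coe, one_mul]
  exact Real.norm_exp_I_mul_ofReal_sub_one_le

/-- A two-sided recursion with invertible steps has a solution. -/
theorem exists_int_recursion {G : Type*} [Group G] (c : ℤ → G) :
    ∃ g : ℤ → G, ∀ j, g (j + 1) = c j * g j := by
  let P : ℕ → G := fun n => Nat.rec 1 (fun n a => c n * a) n
  let M : ℕ → G := fun n => Nat.rec (c (-1))⁻¹ (fun n a => (c (Int.negSucc (n + 1)))⁻¹ * a) n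
  refine ⟨fun j => Int.rec P M j, fun j => ?_⟩
  match j with
  | Int.ofNat n => rfl
  | Int.negSucc 0 =>
    change P 0 = c (-1) * (c (-1))⁻¹
    rw [mul_inv_cancel]; rfl
  | Int.negSucc (n + 1) =>
    change M n = c (Int.negSucc (n + 1)) * ((c (Int.negSucc (n + 1)))⁻¹ * M n)
    rw [mul_inv_cancel_left]

theorem locallyFinite_unit_intervals {δ : ℝ} (hδ : 0 < δ) :
    LocallyFinite fun j : ℤ => Icc (j * δ) ((j + 1) * δ) := by
  intro t
  refine ⟨Metric.ball t δ, Metric.ball_mem_nhds _ hδ,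
    (finite_Icc (⌊t / δ⌋ - 3) (⌊t / δ⌋ + 3)).subset ?_⟩
  rintro j ⟨s, ⟨h1, h2⟩, h3⟩
  rw [Metric.mem_ball, Real.dist_eq, abs_lt] at h3
  have h4 : (⌊t / δ⌋ : ℝ) * δ ≤ t := (le_div_iff₀ hδ).1 (Int.floor_le _)
  have h5 : t < (⌊t / δ⌋ + 1 : ℝ) * δ := (div_lt_iff₀ hδ).1 (Int.lt_floor_add_one _)
  have h6 : (⌊t / δ⌋ : ℝ) - 3 < j := by
    by_contra h
    have : (j + 3 : ℝ) * δ ≤ ⌊t / δ⌋ * δ := mul_le_mul_of_nonneg_right (by linarith) hδ.le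
    linarith
  have h7 : (j : ℝ) < ⌊t / δ⌋ + 3 := by
    by_contra h
    have : (⌊t / δ⌋ + 3 : ℝ) * δ ≤ j * δ := mul_le_mul_of_nonneg_right (by linarith) hδ.le
    linarith
  exact ⟨by exact_mod_cast h6.le, by exact_mod_cast h7.le⟩

theorem floor_div_cases {δ t : ℝ} (hδ : 0 < δ) {j : ℤ} (h : t ∈ Icc (j * δ) ((j + 1) * δ)) :
    ⌊t / δ⌋ = j ∨ (⌊t / δ⌋ = j + 1 ∧ t = (j + 1) * δ) := by
  rcases h.2.eq_or_lt with h2 | h2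
  · right
    refine ⟨?_, h2⟩
    rw [h2, mul_div_cancel_right₀ _ hδ.ne']
    exact_mod_cast Int.floor_intCast (j + 1)
  · left
    rw [Int.floor_eq_iff, le_div_iff₀ hδ, div_lt_iff₀ hδ]
    exact ⟨h.1, h2⟩

variable {E F : Type} [TopologicalSpace E] [TopologicalSpace F] {q : E → Circle}

/-- Local trivialisations of a bundle over the circle along consecutive short arcs, adjusted so
that neighbouring ones agree over the common end point. -/
theorem exists_matching_trivializations
    (hq : ∀ b : Circle, ∃ T : Bundle.Trivialization F q, b ∈ T.baseSet) :
    ∃ (δ : ℝ) (_ : 0 < δ) (S : ℤ → Bundle.Trivialization F q),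
      (∀ j : ℤ, ∀ t ∈ Icc (j * δ) ((j + 1) * δ), Circle.exp t ∈ (S j).baseSet) ∧
      ∀ (j : ℤ) (x : E), q x = Circle.exp ((j + 1) * δ) → ((S (j + 1)) x).2 = ((S j) x).2 := by
  choose T hT using hq
  obtain ⟨ε, hε, h⟩ := lebesgue_number_lemma_of_metric (isCompact_univ (X := Circle))
    (fun b => (T b).open_baseSet) fun b _ => mem_iUnion.2 ⟨b, hT b⟩
  have hδ : 0 < ε / 2 := by positivity
  have h1 : ∀ j : ℤ, ∃ S : Bundle.Trivialization F q,
      ∀ t ∈ Icc (j * (ε / 2)) ((j + 1) * (ε / 2)), Circle.exp t ∈ S.baseSet := fun j => by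
    obtain ⟨b, hb⟩ := h (Circle.exp (j * (ε / 2))) (mem_univ _)
    refine ⟨T b, fun t ht => hb ?_⟩
    refine (dist_circle_exp_le _ _).trans_lt ?_
    rw [abs_of_nonneg (by linarith [ht.1])]
    linarith [ht.2]
  choose S hS using h1
  have hl : ∀ j : ℤ, Circle.exp ((j + 1) * (ε / 2)) ∈ (S j).baseSet := fun j =>
    hS j _ ⟨by nlinarith, le_rfl⟩
  have hr : ∀ j : ℤ, Circle.exp ((j + 1) * (ε / 2)) ∈ (S (j + 1)).baseSet := fun j =>
    hS (j + 1) _ ⟨by push_cast; exact le_rfl, by push_cast; nlinarith⟩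
  -- composing the coordinate changes met on the way to the `j`-th arc and undoing the result makes
  -- neighbouring trivialisations agree
  obtain ⟨g, hg⟩ := exists_int_recursion fun j =>
    (S j).coordChangeHomeomorph (S (j + 1)) (hl j) (hr j)
  refine ⟨ε / 2, hδ, fun j => (S j).transFiberHomeomorph (g j).symm, hS, fun j x hx => ?_⟩
  have h2 := (S j).coordChange_apply_snd (S (j + 1)) (p := x) (by rw [hx]; exact hl j)
  simp only [Bundle.Trivialization.transFiberHomeomorph_apply]
  rw [Homeomorph.symm_apply_eq, hg, Homeomorph.mul_apply, Homeomorph.apply_symm_apply,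
    Bundle.Trivialization.coordChangeHomeomorph_coe, ← hx, h2]

/-- The infinite cyclic cover of the total space of a bundle over the circle, obtained by pulling
the bundle back to the line, is a product. -/
theorem exists_product_structure
    (hq : ∀ b : Circle, ∃ T : Bundle.Trivialization F q, b ∈ T.baseSet) :
    ∃ Φ : {p : E × ℝ // q p.1 = Circle.exp p.2} ≃ₜ F × ℝ, ∀ p, (Φ p).2 = p.1.2 := by
  obtain ⟨δ, hδ, S, hS, hm⟩ := exists_matching_trivializations hq
  let P := {p : E × ℝ // q p.1 = Circle.exp p.2}
  let K : ℤ → Set ℝ := fun j => Icc (j * δ) ((j + 1) * δ)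
  have hK : ∀ t, t ∈ K ⌊t / δ⌋ := fun t =>
    ⟨(le_div_iff₀ hδ).1 (Int.floor_le _), ((div_lt_iff₀ hδ).1 (Int.lt_floor_add_one _)).le⟩
  have hKend : ∀ j : ℤ, (j + 1) * δ ∈ K j := fun j => ⟨by nlinarith, le_rfl⟩
  -- the fibre coordinate of the trivialisation in charge, and its inverse `B` below
  let A : P → F × ℝ := fun p => ((S ⌊p.1.2 / δ⌋ p.1.1).2, p.1.2)
  have hA : ∀ (j : ℤ) (p : P), p.1.2 ∈ K j → A p = ((S j p.1.1).2, p.1.2) := fun j p hp => by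
    rcases floor_div_cases hδ hp with h | ⟨h1, h2⟩
    · simp only [A, h]
    · simp only [A, h1]
      rw [hm j p.1.1 (by rw [p.2, h2])]
  have hbase : ∀ (y : F × ℝ) (j : ℤ), y.2 ∈ K j → Circle.exp y.2 ∈ (S j).baseSet := fun y j hy =>
    hS j y.2 hy
  let B0 : ℤ → F × ℝ → E := fun j y => (S j).toOpenPartialHomeomorph.symm (Circle.exp y.2, y.1)
  have hqB : ∀ (y : F × ℝ) (j : ℤ), y.2 ∈ K j → q (B0 j y) = Circle.exp y.2 := fun y j hy =>
    (S j).proj_symm_apply' (hbase y j hy)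
  have hSB : ∀ (y : F × ℝ) (j : ℤ), y.2 ∈ K j → (S j (B0 j y)).2 = y.1 := fun y j hy => by
    simp only [B0]; rw [(S j).apply_symm_apply' (hbase y j hy)]
  have hBS : ∀ (x : E) (t : ℝ) (j : ℤ), t ∈ K j → q x = Circle.exp t →
      B0 j ((S j x).2, t) = x := fun x t j ht hx => by
    simp only [B0]
    rw [← hx]
    exact (S j).symm_apply_mk_proj ((S j).mem_source.2 (by rw [hx]; exact hS j t ht))
  let B : F × ℝ → P := fun y => ⟨(B0 ⌊y.2 / δ⌋ y, y.2), hqB y _ (hK y.2)⟩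
  have hB : ∀ (j : ℤ) (y : F × ℝ), y.2 ∈ K j → (B y).1.1 = B0 j y := fun j y hy => by
    rcases floor_div_cases hδ hy with h | ⟨h1, h2⟩
    · simp only [B, h]
    · simp only [B, h1]
      have h3 : y.2 ∈ K (j + 1) := by rw [← h1]; exact hK _
      have h4 := hSB y (j + 1) h3
      rw [hm j _ (by rw [hqB y _ h3, h2])] at h4
      have h5 := hBS (B0 (j + 1) y) y.2 j hy (hqB y _ h3)
      rw [h4] at h5
      exact h5.symm
  have hlf := locallyFinite_unit_intervals hδ
  have hAc : Continuous A := by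
    refine (hlf.preimage_continuous (g := fun p : P => p.1.2) (by fun_prop)).continuous
      (eq_univ_of_forall fun p => mem_iUnion.2 ⟨_, hK p.1.2⟩)
      (fun j => isClosed_Icc.preimage (by fun_prop)) fun j => ?_
    refine ContinuousOn.congr (f := fun p : P => ((S j p.1.1).2, p.1.2)) ?_ (hA j)
    refine ContinuousOn.prodMk (continuous_snd.comp_continuousOn ?_) (by fun_prop)
    refine (S j).continuousOn_toFun.comp (by fun_prop) fun p hp => ?_
    rw [(S j).mem_source, p.2]
    exact hS j _ hp
  have hBc : Continuous B := by
    refine Continuous.subtype_mk (Continuous.prodMk ?_ continuous_snd) _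
    refine (hlf.preimage_continuous (g := fun p : F × ℝ => p.2) (by fun_prop)).continuous
      (eq_univ_of_forall fun p => mem_iUnion.2 ⟨_, hK p.2⟩)
      (fun j => isClosed_Icc.preimage (by fun_prop)) fun j => ?_
    refine ContinuousOn.congr (f := B0 j) ?_ (fun y hy => hB j y hy)
    refine (S j).toOpenPartialHomeomorph.continuousOn_symm.comp (by fun_prop) fun y hy => ?_
    exact (S j).mem_target.2 (hbase y j hy)
  refine ⟨{ toFun := A, invFun := B, left_inv := fun p => ?_, right_inv := fun y => ?_,
            continuous_toFun := hAc, continuous_invFun := hBc }, fun p => rfl⟩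
  · refine Subtype.ext (Prod.ext ?_ rfl)
    exact hBS _ _ _ (hK p.1.2) p.2
  · refine Prod.ext ?_ rfl
    exact hSB y _ (hK y.2)

/-- The line is embedded into the interval of radius `2` around `t₀`, by a map that is the
identity on the interval of radius `1`. -/
noncomputable def compress (t₀ t : ℝ) : ℝ := t₀ + (t - t₀) / (1 + max 0 (|t - t₀| - 1) / 2)

theorem compress_eq_self {t₀ t : ℝ} (h : |t - t₀| ≤ 1) : compress t₀ t = t := by
  rw [compress, max_eq_left (by linarith)]; simp

theorem abs_compress_sub (t₀ t : ℝ) :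
    |compress t₀ t - t₀| = |t - t₀| / (1 + max 0 (|t - t₀| - 1) / 2) := by
  rw [compress, add_sub_cancel_left, abs_div]
  congr 1
  exact abs_of_pos (by positivity)

theorem abs_compress_lt (t₀ t : ℝ) : |compress t₀ t - t₀| < 2 := by
  rw [abs_compress_sub, div_lt_iff₀ (by positivity)]
  linarith [le_max_right 0 (|t - t₀| - 1)]

theorem isEmbedding_compress (t₀ : ℝ) : IsEmbedding (compress t₀) := by
  have h : EmbedsOn (compress t₀) univ := by
    refine embedsOn_of_leftInvOn (l := fun v => t₀ + (v - t₀) / min 1 (2 - |v - t₀|))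
      (t := {v | |v - t₀| < 2}) ?_ (fun t _ => abs_compress_lt t₀ t) ?_ fun t _ => ?_
    · refine Continuous.continuousOn ?_
      unfold compress
      refine continuous_const.add (Continuous.div (by fun_prop) (by fun_prop) fun t => ?_)
      positivity
    · refine continuousOn_const.add (ContinuousOn.div (by fun_prop) (by fun_prop) fun v hv => ?_)
      have : 0 < min 1 (2 - |v - t₀|) := lt_min one_pos (by linarith [mem_ofPred_eq ▸ hv])
      exact this.ne'
    · have h1 : compress t₀ t - t₀ = (t - t₀) / (1 + max 0 (|t - t₀| - 1) / 2) := by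
        rw [compress, add_sub_cancel_left]
      have h1' := abs_compress_sub t₀ t
      rw [h1] at h1'
      simp only [h1, h1']
      rcases le_total (|t - t₀|) 1 with h2 | h2
      · rw [max_eq_left (by linarith)]
        simp only [zero_div, add_zero, div_one]
        rw [min_eq_left (by linarith)]; ring
      · rw [max_eq_right (by linarith)]
        have h3 : 2 - |t - t₀| / (1 + (|t - t₀| - 1) / 2) = (1 + (|t - t₀| - 1) / 2)⁻¹ := by
          field_simp; ring
        rw [h3, min_eq_right]
        · field_simp; ring
        · exact inv_le_one_of_one_le₀ (by linarith)
  exact (show IsEmbedding (fun x : (univ : Set ℝ) => compress t₀ x) from h).comp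
    (Homeomorph.Set.univ ℝ).symm.isEmbedding

/-- The infinite cyclic cover of a bundle over the circle embeds into the part of it over a short
interval. -/
theorem exists_compression
    (hq : ∀ b : Circle, ∃ T : Bundle.Trivialization F q, b ∈ T.baseSet) (t₀ : ℝ) :
    ∃ κ : {p : E × ℝ // q p.1 = Circle.exp p.2} → {p : E × ℝ // q p.1 = Circle.exp p.2},
      IsEmbedding κ ∧ (∀ y, |(κ y).1.2 - t₀| < 2) ∧ ∀ y, |y.1.2 - t₀| ≤ 1 → κ y = y := by
  obtain ⟨Φ, hΦ⟩ := exists_product_structure hq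
  have hΦ' : ∀ y, (Φ.symm y).1.2 = y.2 := fun y => by rw [← hΦ, Φ.apply_symm_apply]
  refine ⟨fun y => Φ.symm (Prod.map id (compress t₀) (Φ y)), ?_, fun y => ?_, fun y hy => ?_⟩
  · exact Φ.symm.isEmbedding.comp
      ((IsEmbedding.id.prodMap (isEmbedding_compress t₀)).comp Φ.isEmbedding)
  · rw [hΦ']; exact abs_compress_lt _ _
  · rw [Φ.symm_apply_eq]
    refine Prod.ext rfl ?_
    simp only [Prod.map_snd, hΦ]
    exact compress_eq_self hy

end BundlesOverTheCircle

/-! ### Embeddings that agree locally with the projection -/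

section LocalProjections

/-- The cover `cov J f` has embeddings into the 3-sphere that agree with the projection near any
prescribed point. -/
def HasLocalProjections (J : Set S3) (f : S3 → Circle) : Prop :=
  ∀ y₀ ∈ cov J f, ∃ ι : S3 × ℝ → S3, EmbedsOn ι (cov J f) ∧
    ∀ᶠ y in 𝓝[cov J f] y₀, ι y = y.1

theorem HasLocalProjections.of_embedsOn {J J' : Set S3} {f f' : S3 → Circle}
    (h : HasLocalProjections J f) (Φ : S3 ≃ₜ S3) {g : S3 × ℝ → S3 × ℝ}
    (hg : EmbedsOn g (cov J' f')) (hm : MapsTo g (cov J' f') (cov J f))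
    (hΦ : ∀ y, Φ (g y).1 = y.1) : HasLocalProjections J' f' := by
  intro y hy
  obtain ⟨ι, hι, hev⟩ := h _ (hm hy)
  refine ⟨Φ ∘ ι ∘ g, Φ.isEmbedding.comp (hι.comp hg hm), ?_⟩
  have := (hg.continuousOn y hy).tendsto_nhdsWithin hm
  filter_upwards [this.eventually hev] with z hz
  simp only [Function.comp, hz, hΦ]

/-- Over an interval shorter than a full turn, here of length `4 < 2π`, the projection of the cover
is an embedding. -/
theorem embedsOn_fst_of_short {J : Set S3} {f : S3 → Circle} (hf : ContinuousOn f Jᶜ) (t₀ : ℝ) :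
    EmbedsOn Prod.fst (cov J f ∩ {p | |p.2 - t₀| < 2}) := by
  let T : Set S3 := {x | x ∉ J ∧ ((f x * (Circle.exp t₀)⁻¹ : Circle) : ℂ) ∈ Complex.slitPlane}
  have key : ∀ p ∈ cov J f ∩ {p | |p.2 - t₀| < 2},
      ((f p.1 * (Circle.exp t₀)⁻¹ : Circle) : ℂ).arg = p.2 - t₀ := by
    rintro ⟨x, t⟩ ⟨⟨hx, hxt⟩, ht : |t - t₀| < 2⟩
    rw [abs_lt] at ht
    have hπ := Real.pi_gt_three
    have : f x * (Circle.exp t₀)⁻¹ = Circle.exp (t - t₀) := by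
      rw [Circle.exp_sub, div_eq_mul_inv]; exact congrArg (· * _) hxt
    rw [this, Circle.arg_exp (by linarith) (by linarith)]
  refine embedsOn_of_leftInvOn (t := T)
    (l := fun x => (x, t₀ + ((f x * (Circle.exp t₀)⁻¹ : Circle) : ℂ).arg)) (by fun_prop) ?_ ?_ ?_
  · intro p hp
    refine ⟨hp.1.1, ?_⟩
    rw [Complex.mem_slitPlane_iff_arg, key p hp]
    refine ⟨fun h => ?_, Circle.coe_ne_zero _⟩
    have h2 : |p.2 - t₀| < 2 := hp.2
    rw [h, abs_of_pos Real.pi_pos] at h2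
    linarith [Real.pi_gt_three]
  · refine continuousOn_id.prodMk (continuousOn_const.add ?_)
    have h1 : ContinuousOn (fun x => ((f x * (Circle.exp t₀)⁻¹ : Circle) : ℂ)) T :=
      continuous_subtype_val.comp_continuousOn
        ((hf.mono fun x hx => hx.1).mul continuousOn_const)
    exact fun x hx => ContinuousAt.comp_continuousWithinAt (g := Complex.arg)
      (Complex.continuousAt_arg hx.2) (h1 x hx)
  · intro p hp
    refine Prod.ext rfl ?_
    simp only [key p hp]; ring

/-- The distances to the core after a map that undoes `push`. Since `2 * v - 2` vanishes at the
boundary `v = 1` of the exterior, the distance is kept above `ε * v`, so that the whole exterior is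
embedded into the complement of the core. -/
noncomputable def pullBack (ε v : ℝ) : ℝ := max (min v (2 * v - 2)) (ε * v)

variable {N : Circle × ℂ → S3} {J : Set S3}

theorem IsTube.embedsOn_pullBack (hN : IsTube N J) {ε : ℝ} (h0 : 0 < ε) (h1 : ε ≤ 1) :
    EmbedsOn (radial N (pullBack ε)) (exterior N) := by
  have hpos : ∀ s, 0 < s → 0 < pullBack ε s := fun s hs => lt_max_of_lt_right (by positivity)
  have hb2 : ∀ s, 2 ≤ s → pullBack ε s = s := fun s hs => by
    rw [pullBack, min_eq_left (by linarith), max_eq_left (by nlinarith)]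
  refine embedsOn_of_leftInvOn (t := Jᶜ)
    (l := radial N fun v => min (max v (1 + v / 2)) (v / ε)) ?_ ?_ ?_ ?_
  · refine (hN.continuousOn_radial le_rfl ?_ hb2).mono ?_
    · unfold pullBack; fun_prop
    · rw [← hN.compl_eq]; exact hN.exterior_subset
  · intro x hx
    have hx' := hN.exterior_subset hx
    have h2 := hpos _ (hN.notMem_iff.1 hx')
    rw [mem_compl_iff, hN.notMem_iff, hN.tubeNorm_radial hx' h2.le (hb2 2 le_rfl)]
    exact h2
  · rw [hN.compl_eq]
    refine hN.continuousOn_radial le_rfl (by fun_prop) fun s hs => ?_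
    rw [max_eq_left (by linarith), min_eq_left]
    rw [le_div_iff₀ h0]; nlinarith
  · intro x hx
    have hx' := hN.exterior_subset hx
    have h2 := hN.mem_exterior_iff.1 hx
    rw [hN.radial_radial hx' (hpos _ (by linarith))]
    refine hN.radial_eq_self hx' ?_
    generalize tubeNorm N x = s at h2
    simp only [pullBack]
    rcases le_total (min s (2 * s - 2)) (ε * s) with h | h
    · rw [max_eq_right h, mul_div_cancel_left₀ _ h0.ne', min_eq_right]
      rcases le_total s (2 * s - 2) with h3 | h3
      · rw [min_eq_left h3] at h
        exact h.trans (le_max_left _ _)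
      · rw [min_eq_right h3] at h
        refine le_trans ?_ (le_max_right _ _)
        linarith
    · rw [max_eq_left h, min_eq_left]
      · rcases le_total s (2 * s - 2) with h3 | h3
        · rw [min_eq_left h3, max_eq_left (by linarith)]
        · rw [min_eq_right h3, max_eq_right (by linarith)]; ring
      · have h4 : s ≤ min s (2 * s - 2) / ε := by
          rw [le_div_iff₀ h0]; linarith
        rcases le_total s (2 * s - 2) with h3 | h3
        · rw [min_eq_left h3] at h4 ⊢
          rw [max_eq_left (by linarith)]; exact h4
        · rw [min_eq_right h3] at h4 ⊢
          rw [max_eq_right (by linarith)]; linarith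

/-- For a small enough `ε`, `push` is undone at all distances not below a given `s₁ > 0`. -/
theorem pullBack_push {ε s₁ s : ℝ} (h1 : 0 < s₁) (hε : ε = s₁ / (s₁ + 2)) (hs : s₁ ≤ s) :
    pullBack ε (push s) = s := by
  have h2 : ε * push s ≤ s := by
    have h3 : push s ≤ 1 + s := max_le (by linarith) (by linarith)
    have h4 : 0 ≤ ε := by rw [hε]; positivity
    refine (mul_le_mul_of_nonneg_left h3 h4).trans ?_
    rw [hε, div_mul_eq_mul_div, div_le_iff₀ (by linarith)]
    nlinarith
  have h3 : min (push s) (2 * push s - 2) = s := by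
    unfold push
    rcases le_total s 2 with h | h
    · rw [max_eq_right (by linarith), min_eq_right (by linarith)]; ring
    · rw [max_eq_left (by linarith), min_eq_left (by linarith)]
  rw [pullBack, h3, max_eq_left h2]

/-- For a fibred knot the infinite cyclic cover is the product of a fibre with the line.
Compressing the line to a short interval embeds the cover into the complement itself, without
moving the points near a prescribed one. -/
theorem IsTube.exists_hasLocalProjections (hN : IsTube N J) {F : Type} [TopologicalSpace F]
    [ConnectedSpace F] {q : exterior N → Circle}
    (hq : ∀ b : Circle, ∃ T : Bundle.Trivialization F q, b ∈ T.baseSet) :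
    ∃ f : S3 → Circle, ContinuousOn f Jᶜ ∧ IsConnected (cov J f) ∧ HasLocalProjections J f := by
  have hqc : Continuous q := continuous_iff_continuousAt.2 fun x => by
    obtain ⟨T, hT⟩ := hq (q x)
    exact T.continuousAt_proj (T.mem_source.2 hT)
  obtain ⟨f, hf, hr, hfq⟩ := hN.exists_extension hqc
  obtain ⟨Φ, -⟩ := exists_product_structure hq
  have : ConnectedSpace {p : exterior N × ℝ // q p.1 = Circle.exp p.2} :=
    Φ.symm.surjective.connectedSpace Φ.symm.continuous
  refine ⟨f, hf, hN.isConnected_cov_of_exterior hr (hN.isConnected_over_exterior hfq), ?_⟩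
  rintro y₀ hy₀
  obtain ⟨g, hg, hgm, hg1⟩ := hN.exists_push hf
  obtain ⟨κ, hκ, hκ1, hκ2⟩ := exists_compression hq (g y₀).2
  let v : {p : exterior N × ℝ // q p.1 = Circle.exp p.2} → S3 × ℝ := fun p => (p.1.1, p.1.2)
  have hv : IsEmbedding v :=
    (IsEmbedding.subtypeVal.prodMap IsEmbedding.id).comp IsEmbedding.subtypeVal
  have : Nonempty (S3 × ℝ) := ⟨y₀⟩
  obtain ⟨m, hm, hmκ⟩ := (hv.comp (hκ.comp (isEmbedding_toPullback (J := J) hfq))).exists_embedsOn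
  have hmm : MapsTo m (cov J f ∩ {p | p.1 ∈ exterior N})
      ((cov J f ∩ {p | |p.2 - (g y₀).2| < 2}) ∩ {p | p.1 ∈ exterior N}) := fun p hp => by
    have h1 := hmκ ⟨p, hp⟩
    simp only at h1
    rw [h1]
    have h2 := (κ (toPullback hfq ⟨p, hp⟩)).1.1.2
    refine ⟨⟨⟨hN.exterior_subset h2, ?_⟩, hκ1 _⟩, h2⟩
    refine (hfq _).trans ?_
    exact Subtype.prop (κ _)
  -- `s₁` is below the distance of the prescribed point to the core, so that `push` is undone near
  -- that point
  let s₁ := min (tubeNorm N y₀.1) 1 / 2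
  have hs₁ : 0 < s₁ := by
    have := hN.notMem_iff.1 hy₀.1
    positivity
  have hs₁' : s₁ < tubeNorm N y₀.1 := by
    have := min_le_left (tubeNorm N y₀.1) 1
    simp only [s₁] at hs₁ ⊢; linarith
  have hs₁2 : s₁ < 2 := by
    have := min_le_right (tubeNorm N y₀.1) 1
    simp only [s₁]; linarith
  let ε := s₁ / (s₁ + 2)
  have hε : 0 < ε := by positivity
  have hε1 : ε ≤ 1 := (div_le_one (by linarith)).2 (by linarith)
  -- push into the exterior, compress to a short interval, project, and undo the push
  refine ⟨radial N (pullBack ε) ∘ Prod.fst ∘ m ∘ g, ?_, ?_⟩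
  · refine (hN.embedsOn_pullBack hε hε1).comp (EmbedsOn.comp
      (t := (cov J f ∩ {p | |p.2 - (g y₀).2| < 2}) ∩ {p | p.1 ∈ exterior N}) ?_
      (hm.comp hg hgm) (hmm.comp hgm)) fun p hp => (hmm (hgm hp)).2
    exact (embedsOn_fst_of_short hf _).mono inter_subset_left
  · have h1 : ∀ᶠ y in 𝓝[cov J f] y₀, s₁ < tubeNorm N y.1 :=
      mem_nhdsWithin_of_mem_nhds (continuous_fst.continuousAt.preimage_mem_nhds
        ((hN.isOpen_lt_tubeNorm hs₁2).mem_nhds hs₁'))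
    have h2 : ∀ᶠ y in 𝓝[cov J f] y₀, |(g y).2 - (g y₀).2| < 1 := by
      have h3 : ContinuousWithinAt (fun y => |(g y).2 - (g y₀).2|) (cov J f) y₀ :=
        ((hg.continuousOn y₀ hy₀).snd.sub continuousWithinAt_const).abs
      refine h3.eventually (gt_mem_nhds ?_)
      simp
    filter_upwards [h1, h2, self_mem_nhdsWithin] with y hy1 hy2 hy3
    have h4 := hmκ ⟨g y, hgm hy3⟩
    simp only [Function.comp] at h4 ⊢
    rw [h4, hκ2 _ hy2.le]
    change radial N (pullBack ε) (g y).1 = y.1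
    have h5 := hN.notMem_iff.1 hy3.1
    rw [hg1, hN.radial_radial (a := push) hy3.1 (lt_max_of_lt_left h5)]
    exact hN.radial_eq_self hy3.1 (pullBack_push hs₁ rfl hy1.le)

end LocalProjections

/-! ### Cylindrical coordinates around the great circle -/

section Cylindrical

/-- The coordinates `x₁`, `x₂` transverse to the great circle, as a complex number. -/
def transverse (x : S3) : ℂ := ⟨x.1 1, x.1 2⟩

/-- The angle around the great circle, read as `1` on the circle. -/
noncomputable def theta (x : S3) : Circle := dir (transverse x)

theorem continuous_transverse : Continuous transverse := by
  have : transverse = fun x : S3 => ((x.1 1 : ℝ) : ℂ) + ((x.1 2 : ℝ) : ℂ) * Complex.I := by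
    ext x; apply Complex.ext <;> simp [transverse]
  rw [this]; fun_prop

theorem mem_greatCircle_iff {x : S3} : x ∈ greatCircle ↔ transverse x = 0 := by
  rw [Complex.ext_iff]; rfl

theorem continuousOn_theta : ContinuousOn theta greatCircleᶜ :=
  continuousOn_dir.comp continuous_transverse.continuousOn fun _ hx h =>
    hx (mem_greatCircle_iff.2 h)

theorem norm_transverse_sq (x : S3) : ‖transverse x‖ ^ 2 = 1 - x.1 0 ^ 2 - x.1 3 ^ 2 := by
  rw [← Complex.normSq_eq_norm_sq, Complex.normSq_apply]
  have := S3_sq_sum x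
  simp only [transverse]; linarith

theorem sq_add_sq_lt {x : S3} (hx : x ∉ greatCircle) : x.1 0 ^ 2 + x.1 3 ^ 2 < 1 := by
  have h1 : 0 < ‖transverse x‖ := norm_pos_iff.2 fun h => hx (mem_greatCircle_iff.2 h)
  have h2 := norm_transverse_sq x
  have : 0 < ‖transverse x‖ ^ 2 := by positivity
  linarith

/-- The distance from the `(x₀, x₃)`-plane of the points with given `x₀` and `x₃`. -/
noncomputable def radius (a h : ℝ) : ℝ := √(1 - a ^ 2 - h ^ 2)

theorem radius_sq {a h : ℝ} (H : a ^ 2 + h ^ 2 ≤ 1) : radius a h ^ 2 = 1 - a ^ 2 - h ^ 2 :=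
  Real.sq_sqrt (by linarith)

theorem radius_pos {a h : ℝ} (H : a ^ 2 + h ^ 2 < 1) : 0 < radius a h :=
  Real.sqrt_pos.2 (by linarith)

/-- The point with coordinates `x₀ = a`, `x₃ = h` and angle `ζ` around the great circle. -/
noncomputable def cyl (a h : ℝ) (ζ : Circle) : S3 :=
  pt a (radius a h * (ζ : ℂ).re) (radius a h * (ζ : ℂ).im) h

theorem re_sq_add_im_sq (ζ : Circle) : (ζ : ℂ).re ^ 2 + (ζ : ℂ).im ^ 2 = 1 := by
  have := Circle.normSq_coe ζ
  rw [Complex.normSq_apply] at this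
  linarith

theorem cyl_sum {a h : ℝ} (H : a ^ 2 + h ^ 2 ≤ 1) (ζ : Circle) :
    a ^ 2 + (radius a h * (ζ : ℂ).re) ^ 2 + (radius a h * (ζ : ℂ).im) ^ 2 + h ^ 2 = 1 := by
  rw [mul_pow, mul_pow, radius_sq H]
  have := re_sq_add_im_sq ζ
  linear_combination (1 - a ^ 2 - h ^ 2) * this

theorem cyl_zero {a h : ℝ} (H : a ^ 2 + h ^ 2 ≤ 1) (ζ : Circle) : (cyl a h ζ).1 0 = a :=
  pt_zero (cyl_sum H ζ)

theorem cyl_one {a h : ℝ} (H : a ^ 2 + h ^ 2 ≤ 1) (ζ : Circle) :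
    (cyl a h ζ).1 1 = radius a h * (ζ : ℂ).re := pt_one (cyl_sum H ζ)

theorem cyl_two {a h : ℝ} (H : a ^ 2 + h ^ 2 ≤ 1) (ζ : Circle) :
    (cyl a h ζ).1 2 = radius a h * (ζ : ℂ).im := pt_two (cyl_sum H ζ)

theorem cyl_three {a h : ℝ} (H : a ^ 2 + h ^ 2 ≤ 1) (ζ : Circle) : (cyl a h ζ).1 3 = h :=
  pt_three (cyl_sum H ζ)

theorem transverse_cyl {a h : ℝ} (H : a ^ 2 + h ^ 2 ≤ 1) (ζ : Circle) :
    transverse (cyl a h ζ) = (radius a h : ℂ) * ζ := by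
  apply Complex.ext <;> simp [transverse, cyl_one H, cyl_two H]

theorem cyl_notMem {a h : ℝ} (H : a ^ 2 + h ^ 2 < 1) (ζ : Circle) : cyl a h ζ ∉ greatCircle := by
  rw [mem_greatCircle_iff, transverse_cyl H.le, mul_eq_zero, not_or]
  exact ⟨by exact_mod_cast (radius_pos H).ne', Circle.coe_ne_zero ζ⟩

theorem theta_cyl {a h : ℝ} (H : a ^ 2 + h ^ 2 < 1) (ζ : Circle) : theta (cyl a h ζ) = ζ := by
  rw [theta, transverse_cyl H.le, dir_mul (radius_pos H)]

theorem cyl_theta (x : S3) : cyl (x.1 0) (x.1 3) (theta x) = x := by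
  have h1 : radius (x.1 0) (x.1 3) = ‖transverse x‖ := by
    rw [radius, ← norm_transverse_sq, Real.sqrt_sq (norm_nonneg _)]
  have h2 := norm_mul_dir (transverse x)
  refine pt_eq rfl ?_ ?_ rfl
  · rw [h1]; simpa [transverse, theta] using congrArg Complex.re h2
  · rw [h1]; simpa [transverse, theta] using congrArg Complex.im h2

theorem continuousOn_cyl {Y : Type*} [TopologicalSpace Y] {a h : Y → ℝ} {ζ : Y → Circle}
    {s : Set Y} (ha : ContinuousOn a s) (hh : ContinuousOn h s) (hζ : ContinuousOn ζ s)
    (H : ∀ y ∈ s, a y ^ 2 + h y ^ 2 ≤ 1) : ContinuousOn (fun y => cyl (a y) (h y) (ζ y)) s := by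
  have h1 : ContinuousOn (fun y => radius (a y) (h y)) s := by
    unfold radius; fun_prop
  have h2 : ContinuousOn (fun y => ((ζ y : Circle) : ℂ)) s :=
    continuous_subtype_val.comp_continuousOn hζ
  exact continuousOn_pt ha (h1.mul (Complex.continuous_re.comp_continuousOn h2))
    (h1.mul (Complex.continuous_im.comp_continuousOn h2)) hh fun y hy => cyl_sum (H y hy) _

theorem dist_sq_S3 (x y : S3) : dist x y ^ 2 = (x.1 0 - y.1 0) ^ 2 + (x.1 1 - y.1 1) ^ 2 +
    (x.1 2 - y.1 2) ^ 2 + (x.1 3 - y.1 3) ^ 2 := by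
  rw [Subtype.dist_eq, EuclideanSpace.dist_eq, Real.sq_sqrt (by positivity), Fin.sum_univ_four]
  simp only [Real.dist_eq, sq_abs]

end Cylindrical

/-! ### Circle-valued maps near the equatorial 2-sphere -/

section StandardLayer

/-- Near the equatorial 2-sphere the set `J` coincides with the great circle. -/
def IsStdLayer (J : Set S3) : Prop := ∀ x : S3, |x.1 3| < 1 / 2 → (x ∈ J ↔ x ∈ greatCircle)

theorem IsSum.isStdLayer_left {J J₁ J₂ : Set S3} (h : IsSum J J₁ J₂) : IsStdLayer J₁ :=
  fun _ hx => h.mem_left (abs_lt.1 hx).2.le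

theorem IsSum.isStdLayer_right {J J₁ J₂ : Set S3} (h : IsSum J J₁ J₂) : IsStdLayer J₂ :=
  fun _ hx => h.mem_right (abs_lt.1 hx).1.le

theorem IsSum.isStdLayer {J J₁ J₂ : Set S3} (h : IsSum J J₁ J₂) : IsStdLayer J := fun x hx => by
  rcases le_total 0 (x.1 3) with h0 | h0
  · rw [h.mem_upper h0, h.isStdLayer_left x hx]
  · rw [h.mem_lower h0, h.isStdLayer_right x hx]

/-- One of the two points at which the great circle crosses the equatorial 2-sphere. -/
noncomputable def pole : S3 := pt 1 0 0 0

theorem pole_zero : pole.1 0 = 1 := pt_zero (by norm_num)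
theorem pole_one : pole.1 1 = 0 := pt_one (by norm_num)
theorem pole_two : pole.1 2 = 0 := pt_two (by norm_num)
theorem pole_three : pole.1 3 = 0 := pt_three (by norm_num)

theorem pole_mem : pole ∈ greatCircle := ⟨pole_one, pole_two⟩

/-- The angle around the great circle has no root near a point of the circle. -/
theorem not_hasLocalRoot_theta {n : ℕ} (hn : 2 ≤ n) : ¬ HasLocalRoot greatCircle theta pole n := by
  rintro ⟨U, hU, hpU, g, hg, hgn⟩
  obtain ⟨ε, hε, hball⟩ := Metric.isOpen_iff.1 hU _ hpU
  -- a small circle around the pole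
  let a : ℝ := 1 - min (ε ^ 2 / 4) (1 / 2)
  have ha0 : 1 / 2 ≤ a := by simp only [a]; linarith [min_le_right (ε ^ 2 / 4) (1 / 2 : ℝ)]
  have ha1 : a < 1 := by
    have : 0 < min (ε ^ 2 / 4) (1 / 2) := by positivity
    simp only [a]; linarith
  have H : a ^ 2 + 0 ^ 2 < 1 := by nlinarith
  have hUc : ∀ ζ, cyl a 0 ζ ∈ U \ greatCircle := fun ζ => by
    refine ⟨hball ?_, cyl_notMem H ζ⟩
    rw [Metric.mem_ball]
    refine lt_of_pow_lt_pow_left₀ 2 hε.le ?_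
    have h1 := cyl_sum H.le ζ
    rw [dist_sq_S3, pole_zero, pole_one, pole_two, pole_three, cyl_zero H.le, cyl_one H.le,
      cyl_two H.le, cyl_three H.le]
    have h2 : 1 - a ≤ ε ^ 2 / 4 := by simp only [a]; linarith [min_le_left (ε ^ 2 / 4) (1 / 2 : ℝ)]
    nlinarith
  have hc : Continuous fun ζ : Circle => g (cyl a 0 ζ) := by
    refine hg.comp_continuous ?_ hUc
    rw [← continuousOn_univ]
    exact continuousOn_cyl continuousOn_const continuousOn_const continuousOn_id fun _ _ => H.le
  have h1 := dvd_degree_of_root (d := 1) (n := n) (c := 1) (u := fun _ => 0) (by fun_prop) hc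
    fun ζ => by
      rw [hgn _ (hUc ζ), theta_cyl H]; simp
  have h2 := Int.le_of_dvd one_pos h1
  omega

/-- In the standard layer a circle-valued map is a power of the angle, up to a real angle. -/
theorem IsStdLayer.exists_eq_theta_zpow {J : Set S3} (hJ : IsStdLayer J) {f : S3 → Circle}
    (hf : ContinuousOn f Jᶜ) : ∃ (d : ℤ) (u : S3 → ℝ),
      ContinuousOn u ({x | |x.1 3| < 1 / 2} \ greatCircle) ∧
      ∀ x ∈ {x : S3 | |x.1 3| < 1 / 2} \ greatCircle, f x = theta x ^ d * Circle.exp (u x) := by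
  classical
  let D : Set (ℝ × ℝ) := {p | p.1 ^ 2 + p.2 ^ 2 < 1 ∧ |p.2| < 1 / 2}
  -- `D` is the range of the coordinates `(x₀, x₃)` on the layer; it is star-shaped, so that the
  -- only invariant of the map there is its degree in the angle
  have hstar : ∀ p ∈ D, ∀ s : ℝ, 0 ≤ s → s ≤ 1 → (s * p.1, s * p.2) ∈ D := by
    rintro ⟨a, h⟩ ⟨h1 : a ^ 2 + h ^ 2 < 1, h2 : |h| < 1 / 2⟩ s hs0 hs1
    constructor
    · change (s * a) ^ 2 + (s * h) ^ 2 < 1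
      have : s ^ 2 ≤ 1 := by nlinarith
      nlinarith [mul_nonneg (sub_nonneg.2 this) (by positivity : 0 ≤ a ^ 2 + h ^ 2)]
    · change |s * h| < 1 / 2
      rw [abs_mul, abs_of_nonneg hs0]
      nlinarith [abs_nonneg h]
  have hD0 : ((0, 0) : ℝ × ℝ) ∈ D := ⟨by norm_num, by norm_num⟩
  have : ContractibleSpace D := by
    refine StarConvex.contractibleSpace (x := ((0, 0) : ℝ × ℝ)) ?_ ⟨_, hD0⟩
    intro p hp s t hs ht hst
    have h1 : s • ((0, 0) : ℝ × ℝ) + t • p = (t * p.1, t * p.2) := by ext <;> simp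
    rw [h1]
    exact hstar p hp t ht (by linarith)
  have hmem : ∀ p ∈ D, ∀ ζ, cyl p.1 p.2 ζ ∈ Jᶜ := fun p hp ζ => by
    rw [mem_compl_iff, hJ _ (by rw [cyl_three hp.1.le]; exact hp.2)]
    exact cyl_notMem hp.1 ζ
  have hφ : Continuous fun p : D × Circle => f (cyl p.1.1.1 p.1.1.2 p.2) := by
    refine hf.comp_continuous ?_ fun p => hmem _ p.1.2 _
    rw [← continuousOn_univ]
    exact continuousOn_cyl (by fun_prop) (by fun_prop) (by fun_prop) fun p _ => p.1.2.1.le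
  obtain ⟨d, u, hu, hd⟩ := exists_degree _ hφ
  have hH : ContinuousOn (fun p : I × ℝ × ℝ => f (cyl (p.1 * p.2.1) (p.1 * p.2.2) 1))
      (univ ×ˢ D) := by
    refine hf.comp ?_ fun p hp => hmem _ (hstar _ hp.2 _ p.1.2.1 p.1.2.2) _
    exact continuousOn_cyl (by fun_prop) (by fun_prop) (by fun_prop) fun p hp =>
      (hstar _ hp.2 _ p.1.2.1 p.1.2.2).1.le
  obtain ⟨v, hv, hvH⟩ := exists_angle_of_homotopyOn _ hH
  simp only [Icc.coe_one, Icc.coe_zero, one_mul, zero_mul] at hvH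
  obtain ⟨c, hc⟩ := Circle.exp_surjective (f (cyl 0 0 1))
  have hDx : ∀ x ∈ {x : S3 | |x.1 3| < 1 / 2} \ greatCircle, (x.1 0, x.1 3) ∈ D := fun x hx =>
    ⟨sq_add_sq_lt hx.2, hx.1⟩
  refine ⟨d, fun x => c + v (x.1 0, x.1 3) +
    if hx : (x.1 0, x.1 3) ∈ D then u (⟨_, hx⟩, theta x) else 0, ?_, fun x hx => ?_⟩
  · refine (continuousOn_const.add (hv.comp (by fun_prop) hDx)).add ?_
    rw [continuousOn_iff_continuous_domRestrict]
    have h1 : Continuous fun x : ({x : S3 | |x.1 3| < 1 / 2} \ greatCircle : Set S3) =>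
        theta x := continuousOn_iff_continuous_domRestrict.1
      (continuousOn_theta.mono fun x hx => hx.2)
    have h2 : Continuous fun x : ({x : S3 | |x.1 3| < 1 / 2} \ greatCircle : Set S3) =>
        u (⟨(x.1.1 0, x.1.1 3), hDx x.1 x.2⟩, theta x) := by
      refine hu.comp (Continuous.prodMk (Continuous.subtype_mk ?_ _) h1)
      fun_prop
    refine h2.congr fun x => ?_
    have := hDx x.1 x.2
    simp only [domRestrict_apply, this, dif_pos]
  · have h1 := hDx x hx
    simp only [h1, dif_pos]
    have h2 := hd ⟨_, h1⟩ (theta x)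
    have h3 := hvH _ h1
    simp only [cyl_theta] at h2 h3
    rw [h2, h3, ← hc, Circle.exp_add, Circle.exp_add]
    rw [mul_comm (_ * _) (theta x ^ d), mul_assoc]

theorem IsStdLayer.pole_mem {J : Set S3} (hJ : IsStdLayer J) : pole ∈ J :=
  (hJ pole (by rw [pole_three]; norm_num)).2 KnotIE.pole_mem

theorem isOpen_layer (r : ℝ) : IsOpen {x : S3 | |x.1 3| < r} :=
  isOpen_lt (continuous_S3_coord 3).abs continuous_const

/-- Local roots at the pole depend only on the map near the equatorial 2-sphere. -/
theorem IsStdLayer.hasLocalRoot_congr {J J' : Set S3} (hJ : IsStdLayer J) (hJ' : IsStdLayer J')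
    {f f' : S3 → Circle} {r : ℝ} (h0 : 0 < r) (h1 : r ≤ 1 / 2)
    (hf : ∀ x, |x.1 3| < r → x ∉ greatCircle → f x = f' x) {n : ℕ}
    (h : HasLocalRoot J f pole n) : HasLocalRoot J' f' pole n := by
  refine h.congr (isOpen_layer r) (by simpa [pole_three]) (fun y hy => ?_) fun y hy hyJ => ?_
  · rw [hJ y (lt_of_lt_of_le hy h1), hJ' y (lt_of_lt_of_le hy h1)]
  · exact hf y hy fun h => hyJ ((hJ y (lt_of_lt_of_le hy h1)).2 h)

/-- The degree around the great circle of a map that defines a connected cover is `1` or `-1`;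
otherwise the map would have a root near the great circle. -/
theorem IsStdLayer.sq_degree_eq_one {J : Set S3} (hJ : IsStdLayer J) {N : Circle × ℂ → S3}
    (hN : IsTube N J) {f : S3 → Circle} (hf : ContinuousOn f Jᶜ) (hc : IsConnected (cov J f))
    {d : ℤ} {u : S3 → ℝ} (hu : ContinuousOn u ({x | |x.1 3| < 1 / 2} \ greatCircle))
    (h : ∀ x ∈ {x : S3 | |x.1 3| < 1 / 2} \ greatCircle, f x = theta x ^ d * Circle.exp (u x)) :
    d * d = 1 := by
  have key : ∀ n : ℕ, 2 ≤ n → ¬ (n : ℤ) ∣ d := by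
    rintro n hn ⟨e, rfl⟩
    refine (hN.isConnected_cov_iff hf hJ.pole_mem).1 hc n hn ⟨{x | |x.1 3| < 1 / 2},
      isOpen_layer _, by simp [pole_three], fun x => theta x ^ e * Circle.exp (u x / n), ?_,
      fun y hy => ?_⟩
    · have hsub : {x : S3 | |x.1 3| < 1 / 2} \ J ⊆ {x | |x.1 3| < 1 / 2} \ greatCircle :=
        fun x hx => ⟨hx.1, fun h => hx.2 ((hJ x hx.1).2 h)⟩
      have h1 := (continuousOn_theta.mono fun x hx => hx.2 :
        ContinuousOn theta ({x | |x.1 3| < 1 / 2} \ greatCircle)).mono hsub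
      have h2 : ContinuousOn (fun x => Circle.exp (u x / n)) ({x : S3 | |x.1 3| < 1 / 2} \ J) :=
        Circle.exp.continuous.comp_continuousOn ((hu.mono hsub).div_const _)
      exact ((continuous_zpow e).comp_continuousOn h1).mul h2
    · rw [h y ⟨hy.1, fun h => hy.2 ((hJ y hy.1).2 h)⟩, mul_pow, exp_natpow, ← zpow_natCast,
        ← zpow_mul, mul_comm e, mul_div_cancel₀]
      exact_mod_cast (by omega : n ≠ 0)
  rcases Nat.lt_or_ge d.natAbs 2 with h1 | h1
  · have h0 : d ≠ 0 := fun h0 => key 2 le_rfl (h0 ▸ dvd_zero _)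
    have : d.natAbs = 1 := by omega
    rcases Int.natAbs_eq d with h2 | h2 <;> rw [h2, this] <;> norm_num
  · exact absurd (Int.natAbs_dvd.2 dvd_rfl) (key _ h1)

/-- A cut-off function that is `1` on `[-1/4, 1/4]` and `0` outside `[-3/8, 3/8]`. -/
noncomputable def cutoff (h : ℝ) : ℝ := max 0 (min 1 (3 - 8 * |h|))

/-- The map that defines a connected cover can be changed so that it is the angle around the great
circle near the equatorial 2-sphere; the cover stays the same. -/
theorem IsStdLayer.exists_normalization {J : Set S3} (hJ : IsStdLayer J) {N : Circle × ℂ → S3}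
    (hN : IsTube N J) {f : S3 → Circle} (hf : ContinuousOn f Jᶜ) (hc : IsConnected (cov J f)) :
    ∃ f' : S3 → Circle, ContinuousOn f' Jᶜ ∧
      (∀ x, |x.1 3| ≤ 1 / 4 → x ∉ greatCircle → f' x = theta x) ∧
      ∃ g : S3 × ℝ → S3 × ℝ, EmbedsOn g (cov J f') ∧ MapsTo g (cov J f') (cov J f) ∧
        ∀ y, (g y).1 = y.1 := by
  classical
  obtain ⟨d, u, hu, h⟩ := hJ.exists_eq_theta_zpow hf
  have hd := hJ.sq_degree_eq_one hN hf hc hu h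
  have hdR : (d : ℝ) * d = 1 := by exact_mod_cast hd
  let w : S3 → ℝ := fun x => if |x.1 3| < 1 / 2 then cutoff (x.1 3) * u x else 0
  have hcut : Continuous cutoff := by unfold cutoff; fun_prop
  have hw : ContinuousOn w Jᶜ := by
    refine continuousOn_of_closed_cover (A := {x | |x.1 3| ≤ 3 / 8}) (B := {x | 3 / 8 ≤ |x.1 3|})
      (isClosed_le (continuous_S3_coord 3).abs continuous_const)
      (isClosed_le continuous_const (continuous_S3_coord 3).abs)
      (fun x _ => le_total |x.1 3| (3 / 8)) ?_ ?_
    · have h1 : ∀ x ∈ Jᶜ ∩ {x : S3 | |x.1 3| ≤ 3 / 8}, |x.1 3| < 1 / 2 := fun x hx =>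
        lt_of_le_of_lt hx.2 (by norm_num)
      refine ContinuousOn.congr (f := fun x => cutoff (x.1 3) * u x) ?_ fun x hx => if_pos (h1 x hx)
      refine (hcut.comp (continuous_S3_coord 3)).continuousOn.mul (hu.mono fun x hx => ?_)
      exact ⟨h1 x hx, fun h => hx.1 ((hJ x (h1 x hx)).2 h)⟩
    · refine ContinuousOn.congr (f := fun _ => 0) continuousOn_const fun x hx => ?_
      have hx2 : 3 / 8 ≤ |x.1 3| := hx.2
      simp only [w]
      split_ifs
      · rw [cutoff, max_eq_left, zero_mul]
        exact (min_le_right _ _).trans (by linarith)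
      · rfl
  -- the discrepancy `u` is removed near the equatorial 2-sphere, and `d = ± 1` is its own inverse,
  -- so that the `d`-th power turns the degree into `1`
  let f' : S3 → Circle := fun x => (f x * Circle.exp (-w x)) ^ d
  refine ⟨f', ?_, fun x hx hxC => ?_, fun p => (p.1, d * p.2 + w p.1), ?_, ?_, fun _ => rfl⟩
  · exact (continuous_zpow d).comp_continuousOn
      (hf.mul (Circle.exp.continuous.comp_continuousOn hw.neg))
  · have hx' : |x.1 3| < 1 / 2 := by linarith
    have hwx : w x = u x := by
      simp only [w, if_pos hx', cutoff]
      rw [min_eq_left (by linarith), max_eq_right zero_le_one, one_mul]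
    simp only [f', hwx]
    rw [h x ⟨hx', hxC⟩, Circle.exp_neg, mul_inv_cancel_right, ← zpow_mul, hd, zpow_one]
  · have h1 : ContinuousOn (fun p : S3 × ℝ => w p.1) (Jᶜ ×ˢ univ) :=
      hw.comp continuousOn_fst fun p hp => hp.1
    refine embedsOn_of_leftInvOn (l := fun p => (p.1, d * (p.2 - w p.1))) (t := Jᶜ ×ˢ univ) ?_
      (fun p hp => ⟨hp.1, mem_univ _⟩) (continuousOn_fst.prodMk
        (continuousOn_const.mul (continuousOn_snd.sub h1))) fun p hp => ?_
    · have := h1.mono fun p (hp : p ∈ cov J f') => ⟨hp.1, mem_univ _⟩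
      exact continuousOn_fst.prodMk ((continuousOn_const.mul continuousOn_snd).add this)
    · refine Prod.ext rfl ?_
      simp only
      rw [add_sub_cancel_right, ← mul_assoc, hdR, one_mul]
  · rintro p ⟨hp, hp2⟩
    refine ⟨hp, ?_⟩
    simp only [f'] at hp2
    rw [Circle.exp_add, ← exp_zpow, ← hp2, ← zpow_mul, hd, zpow_one, Circle.exp_neg,
      inv_mul_cancel_right]

end StandardLayer

/-! ### Squeezing a layer to the boundary of a cap, in coordinates -/

section Squeeze

/-- For the points of the 3-sphere with coordinate `x₀ = a` and angle `t`, the largest `|x₃|` on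
the cap `x₁ ≥ c`, read as `0` when the cap has no such points. The angle is clamped to `[-π/4,
π/4]`, which contains the angles on the caps in use, to keep the cosine positive and the function
continuous. -/
noncomputable def capHeight (c a t : ℝ) : ℝ :=
  √(max 0 (1 - a ^ 2 - c ^ 2 / Real.cos (max (-(Real.pi / 4)) (min t (Real.pi / 4))) ^ 2))

theorem clamp_eq_self {t : ℝ} (h : |t| ≤ Real.pi / 4) :
    max (-(Real.pi / 4)) (min t (Real.pi / 4)) = t := by
  rw [abs_le] at h
  rw [min_eq_left h.2, max_eq_right h.1]

theorem cos_clamp_pos (t : ℝ) : 0 < Real.cos (max (-(Real.pi / 4)) (min t (Real.pi / 4))) := by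
  have := Real.pi_pos
  refine Real.cos_pos_of_mem_Ioo ⟨?_, ?_⟩
  · linarith [le_max_left (-(Real.pi / 4)) (min t (Real.pi / 4))]
  · exact max_lt (by linarith) (by linarith [min_le_right t (Real.pi / 4)])

theorem continuous_capHeight (c : ℝ) : Continuous fun p : ℝ × ℝ => capHeight c p.1 p.2 := by
  unfold capHeight
  refine Real.continuous_sqrt.comp (continuous_const.max (Continuous.sub (by fun_prop) ?_))
  exact continuous_const.div (by fun_prop) fun p => (pow_pos (cos_clamp_pos p.2) 2).ne'

theorem continuousOn_capHeight {Y : Type*} [TopologicalSpace Y] {c : ℝ} {a t : Y → ℝ} {s : Set Y}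
    (ha : ContinuousOn a s) (ht : ContinuousOn t s) :
    ContinuousOn (fun y => capHeight c (a y) (t y)) s :=
  Continuous.comp_continuousOn' (g := fun p : ℝ × ℝ => capHeight c p.1 p.2)
    (f := fun y => (a y, t y)) (continuous_capHeight c) (ha.prodMk ht)

theorem capHeight_nonneg (c a t : ℝ) : 0 ≤ capHeight c a t := Real.sqrt_nonneg _

/-- The size `c` of the cap `x₁ ≥ c` and the size `r` of a rectangle in the coordinates `x₀` and
angle over which the cap has positive height. The bound on `c ^ 2` keeps the cap within `|x₃| <
1/8`. -/
structure CapSizes (c r : ℝ) : Prop where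
  pos : 0 < c
  lt_one : c < 1
  near_one : 63 / 64 < c ^ 2
  pos_rect : 0 < r
  rect_le : r < 1 / 2
  height : ∀ a t, |a| ≤ r → |t| ≤ r → 0 < 1 - a ^ 2 - c ^ 2 / Real.cos t ^ 2

theorem exists_capSizes {c₀ : ℝ} (h : c₀ < 1) : ∃ c r, c₀ ≤ c ∧ CapSizes c r := by
  let c := max c₀ (255 / 256)
  have hc : 255 / 256 ≤ c := le_max_right _ _
  have hc1 : c < 1 := max_lt h (by norm_num)
  have hcont : ContinuousAt (fun p : ℝ × ℝ => 1 - p.1 ^ 2 - c ^ 2 / Real.cos p.2 ^ 2) (0, 0) := by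
    refine ContinuousAt.sub (by fun_prop) (continuousAt_const.div (by fun_prop) ?_)
    simp
  have hpos : ∀ᶠ p : ℝ × ℝ in 𝓝 (0, 0), 0 < 1 - p.1 ^ 2 - c ^ 2 / Real.cos p.2 ^ 2 := by
    refine hcont.eventually (lt_mem_nhds ?_)
    simp only [Real.cos_zero]
    nlinarith
  obtain ⟨ε, hε, hball⟩ := Metric.eventually_nhds_iff.1 hpos
  refine ⟨c, min (ε / 2) (1 / 4), le_max_left _ _, ⟨by linarith, hc1, by nlinarith, by positivity,
    lt_of_le_of_lt (min_le_right _ _) (by norm_num), fun a t ha ht => ?_⟩⟩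
  refine hball (y := (a, t)) ?_
  have h1 := min_le_left (ε / 2) (1 / 4)
  rw [Prod.dist_eq, max_lt_iff]
  simp only [Real.dist_eq, sub_zero]
  exact ⟨by linarith, by linarith⟩

variable {c r : ℝ}

theorem CapSizes.capHeight_lt (H : CapSizes c r) (a t : ℝ) : capHeight c a t < 1 / 8 := by
  have h1 : c ^ 2 ≤ c ^ 2 / Real.cos (max (-(Real.pi / 4)) (min t (Real.pi / 4))) ^ 2 := by
    rw [le_div_iff₀ (pow_pos (cos_clamp_pos t) 2)]
    exact mul_le_of_le_one_right (sq_nonneg _) (Real.cos_sq_le_one _)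
  have h2 := H.near_one
  rw [capHeight, Real.sqrt_lt' (by norm_num)]
  exact max_lt (by norm_num) (by nlinarith [sq_nonneg a])

theorem CapSizes.sq_lt_of_capHeight (H : CapSizes c r) {a t : ℝ} (h : capHeight c a t ≠ 0) :
    a ^ 2 < 1 / 64 := by
  have h1 : c ^ 2 ≤ c ^ 2 / Real.cos (max (-(Real.pi / 4)) (min t (Real.pi / 4))) ^ 2 := by
    rw [le_div_iff₀ (pow_pos (cos_clamp_pos t) 2)]
    exact mul_le_of_le_one_right (sq_nonneg _) (Real.cos_sq_le_one _)
  have h2 := H.near_one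
  by_contra h3
  exact h (by rw [capHeight, max_eq_left (by linarith), Real.sqrt_zero])

theorem CapSizes.rect_lt_pi (H : CapSizes c r) : r < Real.pi / 4 := by
  linarith [H.rect_le, Real.pi_gt_three]

theorem CapSizes.capHeight_sq (H : CapSizes c r) {a t : ℝ} (ha : |a| ≤ r) (ht : |t| ≤ r) :
    capHeight c a t ^ 2 = 1 - a ^ 2 - c ^ 2 / Real.cos t ^ 2 := by
  have h1 := H.height a t ha ht
  rw [capHeight, clamp_eq_self (ht.trans H.rect_lt_pi.le), max_eq_right h1.le, Real.sq_sqrt h1.le]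

theorem CapSizes.le_capHeight (_H : CapSizes c r) {a t h : ℝ} (hah : a ^ 2 + h ^ 2 ≤ 1)
    (ht : |t| ≤ Real.pi / 4) (hc : 0 < c) (h1 : c ≤ radius a h * Real.cos t) :
    |h| ≤ capHeight c a t := by
  have hcos : 0 < Real.cos t := by
    have := cos_clamp_pos t; rwa [clamp_eq_self ht] at this
  have h2 : c ^ 2 / Real.cos t ^ 2 ≤ 1 - a ^ 2 - h ^ 2 := by
    rw [div_le_iff₀ (by positivity), ← radius_sq hah, ← mul_pow]
    exact pow_le_pow_left₀ hc.le h1 2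
  rw [capHeight, clamp_eq_self ht]
  refine Real.le_sqrt_of_sq_le ?_
  rw [sq_abs]
  exact le_max_of_le_right (by linarith)

/-- In the coordinates `x₀`, angle and `x₃` on the layer `-1/4 ≤ x₃ ≤ 0` of the cover: the upper
face `x₃ = 0` is shrunk to a rectangle and pushed down to the lower half of the boundary of the cap
`x₁ ≥ c`, and this motion fades out towards the lower face. The factor `k` is `1` on the upper face
and `0` on the lower one; `t ↦ t / (1 + |t| / r)` shrinks the line to `(-r, r)`. -/
noncomputable def squeezeCoord (c r : ℝ) (p : ℝ × ℝ × ℝ) : ℝ × ℝ × ℝ :=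
  let k := 1 + 4 * p.2.2
  let a := (1 - k * (1 - r)) * p.1
  let t := p.2.1 / (1 + k * |p.2.1| / r)
  (a, t, p.2.2 - k * capHeight c a t)

/-- The inverse of `squeezeCoord`. -/
noncomputable def unsqueezeCoord (c r : ℝ) (p : ℝ × ℝ × ℝ) : ℝ × ℝ × ℝ :=
  let h := (p.2.2 + capHeight c p.1 p.2.1) / (1 - 4 * capHeight c p.1 p.2.1)
  let k := 1 + 4 * h
  (p.1 / (1 - k * (1 - r)), p.2.1 / (1 - k * |p.2.1| / r), h)

/-- The layer `-1/4 ≤ x₃ ≤ 0` of the cover in coordinates. -/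
def coordLayer : Set (ℝ × ℝ × ℝ) := {p | p.1 ^ 2 + p.2.2 ^ 2 < 1 ∧ -(1 / 4) ≤ p.2.2 ∧ p.2.2 ≤ 0}

theorem continuousOn_squeezeCoord (H : CapSizes c r) :
    ContinuousOn (squeezeCoord c r) coordLayer := by
  have hr := H.pos_rect
  have hk : Continuous fun p : ℝ × ℝ × ℝ => 1 + 4 * p.2.2 := by fun_prop
  have ht : Continuous fun p : ℝ × ℝ × ℝ => |p.2.1| := by fun_prop
  have hD := continuous_const (y := (1 : ℝ)).add ((hk.mul ht).div_const r)
  have h1 : ContinuousOn (fun p : ℝ × ℝ × ℝ =>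
      p.2.1 / (1 + (1 + 4 * p.2.2) * |p.2.1| / r)) coordLayer := by
    refine (continuous_fst.comp continuous_snd).continuousOn.div hD.continuousOn fun p hp => ?_
    have : 0 ≤ 1 + 4 * p.2.2 := by linarith [hp.2.1]
    positivity
  have h2 : ContinuousOn (fun p : ℝ × ℝ × ℝ => (1 - (1 + 4 * p.2.2) * (1 - r)) * p.1)
      coordLayer := by
    refine Continuous.continuousOn ?_
    fun_prop
  have h3 : ContinuousOn (fun p : ℝ × ℝ × ℝ => capHeight c ((1 - (1 + 4 * p.2.2) * (1 - r)) * p.1)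
      (p.2.1 / (1 + (1 + 4 * p.2.2) * |p.2.1| / r))) coordLayer :=
    continuousOn_capHeight h2 h1
  exact h2.prodMk (h1.prodMk
    ((continuous_snd.comp continuous_snd).continuousOn.sub (hk.continuousOn.mul h3)))

theorem CapSizes.factor_pos (H : CapSizes c r) {h : ℝ} (h0 : h ≤ 0) :
    0 < 1 - (1 + 4 * h) * (1 - r) := by
  have := H.pos_rect; have := H.rect_le
  nlinarith

theorem unsqueezeCoord_squeezeCoord (H : CapSizes c r) {p : ℝ × ℝ × ℝ} (hp : p ∈ coordLayer) :
    unsqueezeCoord c r (squeezeCoord c r p) = p := by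
  obtain ⟨a, t, h⟩ := p
  obtain ⟨h1, h2, h3⟩ := hp
  simp only at h1 h2 h3
  have hr := H.pos_rect
  have hk : 0 ≤ 1 + 4 * h := by linarith
  simp only [squeezeCoord, unsqueezeCoord]
  have hA := H.capHeight_lt ((1 - (1 + 4 * h) * (1 - r)) * a) (t / (1 + (1 + 4 * h) * |t| / r))
  set A := capHeight c ((1 - (1 + 4 * h) * (1 - r)) * a) (t / (1 + (1 + 4 * h) * |t| / r))
  have e1 : (h - (1 + 4 * h) * A + A) / (1 - 4 * A) = h := by
    rw [div_eq_iff (by linarith)]; ring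
  have hD : 0 < 1 + (1 + 4 * h) * |t| / r := by positivity
  have e2 : 1 - (1 + 4 * h) * |t / (1 + (1 + 4 * h) * |t| / r)| / r =
      (1 + (1 + 4 * h) * |t| / r)⁻¹ := by
    rw [abs_div, abs_of_pos hD]
    field_simp
    ring
  rw [e1, e2]
  refine Prod.ext ?_ (Prod.ext ?_ rfl)
  · exact mul_div_cancel_left₀ _ (H.factor_pos h3).ne'
  · simp only
    rw [div_inv_eq_mul, div_mul_cancel₀ _ hD.ne']

theorem embedsOn_squeezeCoord (H : CapSizes c r) :
    EmbedsOn (squeezeCoord c r) coordLayer := by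
  have hr := H.pos_rect
  let T : Set (ℝ × ℝ × ℝ) := {p |
    0 < 1 - (1 + 4 * (unsqueezeCoord c r p).2.2) * (1 - r) ∧
    0 < 1 - (1 + 4 * (unsqueezeCoord c r p).2.2) * |p.2.1| / r}
  refine embedsOn_of_leftInvOn (l := unsqueezeCoord c r) (t := T) (continuousOn_squeezeCoord H)
    (fun p hp => ?_) ?_ (fun p hp => unsqueezeCoord_squeezeCoord H hp)
  · change _ ∧ _
    rw [unsqueezeCoord_squeezeCoord H hp]
    refine ⟨H.factor_pos hp.2.2, ?_⟩
    have hk : 0 ≤ 1 + 4 * p.2.2 := by linarith [hp.2.1]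
    have hD : 0 < 1 + (1 + 4 * p.2.2) * |p.2.1| / r := by positivity
    simp only [squeezeCoord]
    rw [abs_div, abs_of_pos hD, sub_pos, div_lt_one hr, mul_div_assoc', div_lt_iff₀ hD]
    have : r * (1 + (1 + 4 * p.2.2) * |p.2.1| / r) = r + (1 + 4 * p.2.2) * |p.2.1| := by
      field_simp
    linarith
  · have hA : Continuous fun p : ℝ × ℝ × ℝ => capHeight c p.1 p.2.1 :=
      (continuous_capHeight c).comp (continuous_fst.prodMk (continuous_fst.comp continuous_snd))
    have hh : Continuous fun p : ℝ × ℝ × ℝ => (unsqueezeCoord c r p).2.2 := by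
      simp only [unsqueezeCoord]
      refine Continuous.div (by fun_prop) (by fun_prop) fun p => ?_
      linarith [H.capHeight_lt p.1 p.2.1]
    have hk := continuous_const (y := (1 : ℝ)).add (continuous_const (y := (4 : ℝ)).mul hh)
    have h1 := continuous_const (y := (1 : ℝ)).sub (hk.mul (continuous_const (y := 1 - r)))
    have ht : Continuous fun p : ℝ × ℝ × ℝ => |p.2.1| := by fun_prop
    have h2 := continuous_const (y := (1 : ℝ)).sub ((hk.mul ht).div_const r)
    exact (continuous_fst.continuousOn.div h1.continuousOn fun p hp => hp.1.ne').prodMk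
      (((continuous_fst.comp continuous_snd).continuousOn.div h2.continuousOn
        fun p hp => hp.2.ne').prodMk hh.continuousOn)

theorem squeezeCoord_height_bounds (H : CapSizes c r) {p : ℝ × ℝ × ℝ} (hp : p ∈ coordLayer) :
    -(1 / 4) ≤ (squeezeCoord c r p).2.2 ∧ (squeezeCoord c r p).2.2 ≤ 0 ∧
      (-(1 / 4) < p.2.2 → -(1 / 4) < (squeezeCoord c r p).2.2) := by
  obtain ⟨h1, h2, h3⟩ := hp
  simp only [squeezeCoord]
  have hA := H.capHeight_lt ((1 - (1 + 4 * p.2.2) * (1 - r)) * p.1)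
    (p.2.1 / (1 + (1 + 4 * p.2.2) * |p.2.1| / r))
  have hA0 := capHeight_nonneg c ((1 - (1 + 4 * p.2.2) * (1 - r)) * p.1)
    (p.2.1 / (1 + (1 + 4 * p.2.2) * |p.2.1| / r))
  generalize capHeight c ((1 - (1 + 4 * p.2.2) * (1 - r)) * p.1)
    (p.2.1 / (1 + (1 + 4 * p.2.2) * |p.2.1| / r)) = A at hA hA0
  refine ⟨by nlinarith, by nlinarith, fun h => by nlinarith⟩

theorem mapsTo_squeezeCoord (H : CapSizes c r) :
    MapsTo (squeezeCoord c r) coordLayer coordLayer := by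
  intro p hp
  obtain ⟨b1, b2, -⟩ := squeezeCoord_height_bounds H hp
  refine ⟨?_, b1, b2⟩
  obtain ⟨h1, h2, h3⟩ := hp
  by_cases hA : capHeight c (squeezeCoord c r p).1 (squeezeCoord c r p).2.1 = 0
  · have e1 : (squeezeCoord c r p).2.2 = p.2.2 := by
      have : (squeezeCoord c r p).2.2 = p.2.2 - (1 + 4 * p.2.2) *
        capHeight c (squeezeCoord c r p).1 (squeezeCoord c r p).2.1 := rfl
      rw [this, hA]; ring
    rw [e1]
    simp only [squeezeCoord]
    have h4 := H.factor_pos h3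
    have h5 : 1 - (1 + 4 * p.2.2) * (1 - r) ≤ 1 := by
      have : 0 ≤ (1 + 4 * p.2.2) * (1 - r) :=
        mul_nonneg (by linarith) (by linarith [H.rect_le])
      linarith
    have h6 : (1 - (1 + 4 * p.2.2) * (1 - r)) ^ 2 ≤ 1 := pow_le_one₀ h4.le h5
    rw [mul_pow]
    nlinarith [mul_nonneg (sub_nonneg.2 h6) (sq_nonneg p.1)]
  · -- over the cap both coordinates are small
    have h4 := H.sq_lt_of_capHeight hA
    nlinarith

/-- Points of the open layer are pushed off the cap. -/
theorem squeezeCoord_notMem_cap (H : CapSizes c r) {p : ℝ × ℝ × ℝ} (hp : p ∈ coordLayer)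
    (h0 : p.2.2 < 0) (ht : |(squeezeCoord c r p).2.1| ≤ Real.pi / 4) :
    radius (squeezeCoord c r p).1 (squeezeCoord c r p).2.2 *
      Real.cos (squeezeCoord c r p).2.1 < c := by
  by_contra h1
  have hm := mapsTo_squeezeCoord H hp
  have h2 := H.le_capHeight hm.1.le ht H.pos (not_lt.1 h1)
  have h3 : (squeezeCoord c r p).2.2 = p.2.2 - (1 + 4 * p.2.2) *
      capHeight c (squeezeCoord c r p).1 (squeezeCoord c r p).2.1 := rfl
  have hA := H.capHeight_lt (squeezeCoord c r p).1 (squeezeCoord c r p).2.1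
  rw [h3] at h2
  generalize capHeight c (squeezeCoord c r p).1 (squeezeCoord c r p).2.1 = A at h2 hA
  have h4 := (abs_le.1 h2).1
  nlinarith

/-- The upper face of the layer lands on the boundary of the cap. -/
theorem squeezeCoord_mem_cap (H : CapSizes c r) {p : ℝ × ℝ × ℝ} (hp : p ∈ coordLayer)
    (h0 : p.2.2 = 0) : |(squeezeCoord c r p).2.1| < Real.pi / 4 ∧
      radius (squeezeCoord c r p).1 (squeezeCoord c r p).2.2 *
        Real.cos (squeezeCoord c r p).2.1 = c := by
  have hm := (mapsTo_squeezeCoord H hp).1.le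
  obtain ⟨a, t, h⟩ := p
  obtain ⟨h1, -, -⟩ := hp
  simp only at h0 h1
  subst h0
  have hr := H.pos_rect
  simp only [squeezeCoord, mul_zero, add_zero, one_mul, sub_sub_cancel, zero_sub] at hm ⊢
  have ha : |r * a| ≤ r := by
    rw [abs_mul, abs_of_pos hr]
    have : |a| ≤ 1 := abs_le_one_iff_mul_self_le_one.2 (by nlinarith)
    nlinarith
  have ht : |t / (1 + |t| / r)| < r := by
    have hD : 0 < 1 + |t| / r := by positivity
    rw [abs_div, abs_of_pos hD, div_lt_iff₀ hD, mul_add, mul_div_cancel₀ _ hr.ne']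
    linarith
  refine ⟨ht.trans H.rect_lt_pi, ?_⟩
  have hcos : 0 < Real.cos (t / (1 + |t| / r)) := by
    have := cos_clamp_pos (t / (1 + |t| / r))
    rwa [clamp_eq_self (ht.le.trans H.rect_lt_pi.le)] at this
  have h2 : radius (r * a) (-capHeight c (r * a) (t / (1 + |t| / r))) ^ 2 =
      c ^ 2 / Real.cos (t / (1 + |t| / r)) ^ 2 := by
    rw [radius_sq hm, neg_sq, H.capHeight_sq ha ht.le]; ring
  rw [← div_pow] at h2
  have h3 := (sq_eq_sq₀ (Real.sqrt_nonneg _) (div_nonneg H.pos.le hcos.le)).1 h2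
  rw [radius] at *
  rw [h3, div_mul_cancel₀ _ hcos.ne']

end Squeeze

/-! ### Squeezing a half of a cover -/

section SqueezeCover

/-- The coordinates `x₀`, angle and `x₃` on the cover. -/
def toCoord (p : S3 × ℝ) : ℝ × ℝ × ℝ := (p.1.1 0, p.2, p.1.1 3)

/-- The point of the cover with given coordinates `x₀`, angle and `x₃`. -/
noncomputable def ofCoord (q : ℝ × ℝ × ℝ) : S3 × ℝ := (cyl q.1 q.2.2 (Circle.exp q.2.1), q.2.1)

theorem continuous_toCoord : Continuous toCoord := by unfold toCoord; fun_prop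

theorem toCoord_ofCoord {q : ℝ × ℝ × ℝ} (h : q.1 ^ 2 + q.2.2 ^ 2 ≤ 1) :
    toCoord (ofCoord q) = q := by
  simp only [toCoord, ofCoord, cyl_zero h, cyl_three h]

theorem continuousOn_ofCoord : ContinuousOn ofCoord {q | q.1 ^ 2 + q.2.2 ^ 2 < 1} :=
  (continuousOn_cyl (by fun_prop) (by fun_prop) (by fun_prop) fun _ hq => le_of_lt hq).prodMk
    (by fun_prop)

/-- `squeezeCoord` on the layer `-1/4 ≤ x₃ ≤ 0` of the cover, the identity below. -/
noncomputable def squeeze (c r : ℝ) (p : S3 × ℝ) : S3 × ℝ :=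
  open Classical in if p.1.1 3 ≤ -(1 / 4) then p else ofCoord (squeezeCoord c r (toCoord p))

/-- A set standard near the equatorial 2-sphere, with a circle-valued map on its complement that
is the angle around the great circle there. -/
structure IsStdPair (J : Set S3) (f : S3 → Circle) : Prop where
  layer : IsStdLayer J
  angle : ∀ x : S3, |x.1 3| ≤ 1 / 4 → x ∉ greatCircle → f x = theta x

variable {J : Set S3} {f : S3 → Circle} {c r : ℝ}

theorem IsStdPair.notMem_iff (hJ : IsStdPair J f) {x : S3} (hx : |x.1 3| ≤ 1 / 4) :
    x ∉ J ↔ x ∉ greatCircle := not_congr (hJ.layer x (by linarith))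

theorem IsStdPair.mem_cov_iff (hJ : IsStdPair J f) {x : S3} (hx : |x.1 3| ≤ 1 / 4) {t : ℝ} :
    (x, t) ∈ cov J f ↔ x ∉ greatCircle ∧ theta x = Circle.exp t := by
  constructor
  · rintro ⟨h1, h2⟩
    have h3 := (hJ.notMem_iff hx).1 h1
    exact ⟨h3, by rw [← hJ.angle x hx h3]; exact h2⟩
  · rintro ⟨h1, h2⟩
    exact ⟨(hJ.notMem_iff hx).2 h1, by rw [← h2]; exact hJ.angle x hx h1⟩

theorem IsStdPair.ofCoord_toCoord (hJ : IsStdPair J f) {p : S3 × ℝ} (hp : p ∈ cov J f)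
    (hx : |p.1.1 3| ≤ 1 / 4) : ofCoord (toCoord p) = p := by
  have := ((hJ.mem_cov_iff hx).1 hp).2
  refine Prod.ext ?_ rfl
  simp only [ofCoord, toCoord]
  rw [← this, cyl_theta]

theorem IsStdPair.ofCoord_mem (hJ : IsStdPair J f) {q : ℝ × ℝ × ℝ} (hq : q ∈ coordLayer) :
    ofCoord q ∈ cov J f := by
  refine (hJ.mem_cov_iff ?_).2 ⟨cyl_notMem hq.1 _, theta_cyl hq.1 _⟩
  rw [cyl_three hq.1.le, abs_le]
  exact ⟨hq.2.1, by linarith [hq.2.2]⟩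

theorem IsStdPair.toCoord_mem (hJ : IsStdPair J f) {p : S3 × ℝ} (hp : p ∈ cov J f)
    (h1 : -(1 / 4) ≤ p.1.1 3) (h2 : p.1.1 3 ≤ 0) : toCoord p ∈ coordLayer := by
  have hx : |p.1.1 3| ≤ 1 / 4 := abs_le.2 ⟨h1, by linarith⟩
  exact ⟨sq_add_sq_lt ((hJ.mem_cov_iff hx).1 hp).1, h1, h2⟩

theorem IsStdPair.squeeze_eq (hJ : IsStdPair J f) {p : S3 × ℝ}
    (hp : p ∈ cov J f) (h1 : -(1 / 4) ≤ p.1.1 3) (h2 : p.1.1 3 ≤ 0) :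
    squeeze c r p = ofCoord (squeezeCoord c r (toCoord p)) := by
  rw [squeeze]
  split_ifs with h
  · have h3 : p.1.1 3 = -(1 / 4) := le_antisymm h h1
    have hx : |p.1.1 3| ≤ 1 / 4 := abs_le.2 ⟨h1, by linarith⟩
    have : squeezeCoord c r (toCoord p) = toCoord p := by
      simp only [squeezeCoord, toCoord, h3]; norm_num
    rw [this, hJ.ofCoord_toCoord hp hx]
  · rfl

theorem IsStdPair.mapsTo_squeeze (H : CapSizes c r) (hJ : IsStdPair J f) :
    MapsTo (squeeze c r) (cov J f ∩ {p | p.1.1 3 ≤ 0}) (cov J f) := by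
  rintro p ⟨hp, h2⟩
  rcases le_total (-(1 / 4)) (p.1.1 3) with h1 | h1
  · rw [hJ.squeeze_eq hp h1 h2]
    exact hJ.ofCoord_mem (mapsTo_squeezeCoord H (hJ.toCoord_mem hp h1 h2))
  · rw [squeeze, if_pos h1]; exact hp

theorem IsStdPair.embedsOn_squeeze (H : CapSizes c r) (hJ : IsStdPair J f) :
    EmbedsOn (squeeze c r) (cov J f ∩ {p | p.1.1 3 ≤ 0}) := by
  have h3 : Continuous fun p : S3 × ℝ => p.1.1 3 := (continuous_S3_coord 3).comp continuous_fst
  have hcoord : ∀ p ∈ cov J f, -(1 / 4) ≤ p.1.1 3 → p.1.1 3 ≤ 0 →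
      (squeeze c r p).1.1 3 = (squeezeCoord c r (toCoord p)).2.2 := fun p hp h1 h2 => by
    rw [hJ.squeeze_eq hp h1 h2]
    exact cyl_three (mapsTo_squeezeCoord H (hJ.toCoord_mem hp h1 h2)).1.le _
  refine embedsOn_of_closed_cover (A := {p | p.1.1 3 ≤ -(1 / 4)}) (B := {p | -(1 / 4) ≤ p.1.1 3})
    (P := {p | p.1.1 3 ≤ -(1 / 4)}) (Q := {p | -(1 / 4) ≤ p.1.1 3})
    (isClosed_le h3 continuous_const) (isClosed_le continuous_const h3)
    (fun p _ => le_total (p.1.1 3) (-(1 / 4))) ?_ ?_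
    (isClosed_le h3 continuous_const) (isClosed_le continuous_const h3) ?_ ?_ ?_ ?_
  · refine EmbedsOn.congr (g := id) IsEmbedding.subtypeVal fun p hp => if_pos hp.2
  · have h4 : EmbedsOn toCoord (cov J f ∩ {p | p.1.1 3 ≤ 0} ∩ {p | -(1 / 4) ≤ p.1.1 3}) :=
      embedsOn_of_leftInvOn (l := ofCoord) (t := {q | q.1 ^ 2 + q.2.2 ^ 2 < 1})
        continuous_toCoord.continuousOn (fun p hp => (hJ.toCoord_mem hp.1.1 hp.2 hp.1.2).1)
        continuousOn_ofCoord fun p hp => hJ.ofCoord_toCoord hp.1.1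
          (abs_le.2 ⟨hp.2, (show p.1.1 3 ≤ 0 from hp.1.2).trans (by norm_num)⟩)
    have h5 : EmbedsOn ofCoord coordLayer :=
      embedsOn_of_leftInvOn (l := toCoord) (t := univ)
        (continuousOn_ofCoord.mono fun q hq => hq.1) (fun _ _ => mem_univ _)
        continuous_toCoord.continuousOn fun q hq => toCoord_ofCoord hq.1.le
    refine EmbedsOn.congr (h5.comp ((embedsOn_squeezeCoord H).comp h4 fun p hp =>
      hJ.toCoord_mem hp.1.1 hp.2 hp.1.2) ((mapsTo_squeezeCoord H).comp fun p hp =>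
      hJ.toCoord_mem hp.1.1 hp.2 hp.1.2)) fun p hp => hJ.squeeze_eq hp.1.1 hp.2 hp.1.2
  · rintro p ⟨-, hp : p.1.1 3 ≤ -(1 / 4)⟩
    rw [squeeze, if_pos hp]; exact hp
  · rintro p ⟨⟨hp, h2⟩, h1⟩
    rw [mem_ofPred_eq, hcoord p hp h1 h2]
    exact (squeezeCoord_height_bounds H (hJ.toCoord_mem hp h1 h2)).1
  · rintro p - h1 h2
    have h1' : p.1.1 3 < -(1 / 4) := not_le.1 h1
    rw [squeeze, if_pos h1'.le] at h2
    exact h1 h2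
  · rintro p ⟨hp, h2⟩ h1
    have h1' : -(1 / 4) < p.1.1 3 := not_le.1 h1
    rw [mem_ofPred_eq, hcoord p hp h1'.le h2, not_le]
    exact (squeezeCoord_height_bounds H (hJ.toCoord_mem hp h1'.le h2)).2.2 h1'

theorem IsStdPair.squeeze_one (H : CapSizes c r) (hJ : IsStdPair J f) {p : S3 × ℝ}
    (hp : p ∈ cov J f) (h1 : -(1 / 4) ≤ p.1.1 3) (h2 : p.1.1 3 ≤ 0) :
    (squeeze c r p).1.1 1 = radius (squeezeCoord c r (toCoord p)).1
      (squeezeCoord c r (toCoord p)).2.2 * Real.cos (squeezeCoord c r (toCoord p)).2.1 := by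
  rw [hJ.squeeze_eq hp h1 h2]
  refine (cyl_one (mapsTo_squeezeCoord H (hJ.toCoord_mem hp h1 h2)).1.le _).trans ?_
  congr 1
  rw [Circle.coe_exp, Complex.exp_ofReal_mul_I_re]

/-- The lift of the cap `x₁ ≥ c` to the cover is avoided by the points below the equator. -/
theorem IsStdPair.squeeze_notMem_cap (H : CapSizes c r) (hJ : IsStdPair J f) {p : S3 × ℝ}
    (hp : p ∈ cov J f) (h2 : p.1.1 3 < 0) (ht : |(squeeze c r p).2| ≤ Real.pi / 4) :
    (squeeze c r p).1.1 1 < c := by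
  rcases le_total (-(1 / 4)) (p.1.1 3) with h1 | h1
  · rw [hJ.squeeze_one H hp h1 h2.le]
    refine squeezeCoord_notMem_cap H (hJ.toCoord_mem hp h1 h2.le) h2 ?_
    rwa [hJ.squeeze_eq hp h1 h2.le] at ht
  · rw [squeeze, if_pos h1]
    have h3 := S3_sq_sum p.1
    have h4 := H.near_one
    have h5 := H.pos
    by_contra h6
    nlinarith [sq_nonneg (p.1.1 0), sq_nonneg (p.1.1 2)]

/-- The equator is carried to the boundary of the lifted cap. -/
theorem IsStdPair.squeeze_mem_cap (H : CapSizes c r) (hJ : IsStdPair J f) {p : S3 × ℝ}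
    (hp : p ∈ cov J f) (h0 : p.1.1 3 = 0) :
    |(squeeze c r p).2| < Real.pi / 4 ∧ (squeeze c r p).1.1 1 = c := by
  have h1 : -(1 / 4) ≤ p.1.1 3 := by rw [h0]; norm_num
  rw [hJ.squeeze_one H hp h1 h0.le]
  have := squeezeCoord_mem_cap H (hJ.toCoord_mem hp h1 h0.le) h0
  refine ⟨?_, this.2⟩
  rw [hJ.squeeze_eq hp h1 h0.le]
  exact this.1

end SqueezeCover

/-! ### Turning the complement of a cap into the cap -/

section Inversion

/-- The conformal involution of the 3-sphere that exchanges the cap `x₁ ≥ c` with its complement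
and acts on the boundary of the cap as the reflection in the equatorial 2-sphere. -/
noncomputable def inversion (c : ℝ) (x : S3) : S3 :=
  pt ((1 - c ^ 2) * x.1 0 / (1 + c ^ 2 - 2 * c * x.1 1))
    ((2 * c - (1 + c ^ 2) * x.1 1) / (1 + c ^ 2 - 2 * c * x.1 1))
    ((1 - c ^ 2) * x.1 2 / (1 + c ^ 2 - 2 * c * x.1 1))
    (-((1 - c ^ 2) * x.1 3) / (1 + c ^ 2 - 2 * c * x.1 1))

variable {c : ℝ}

theorem inversion_denom_pos (h0 : 0 < c) (h1 : c < 1) (x : S3) :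
    0 < 1 + c ^ 2 - 2 * c * x.1 1 := by
  have h2 : x.1 1 ≤ 1 := by
    nlinarith [S3_sq_sum x, sq_nonneg (x.1 0), sq_nonneg (x.1 2), sq_nonneg (x.1 3)]
  nlinarith [mul_le_mul_of_nonneg_left h2 h0.le, pow_pos (sub_pos.2 h1) 2]

theorem inversion_sum (h0 : 0 < c) (h1 : c < 1) (x : S3) :
    ((1 - c ^ 2) * x.1 0 / (1 + c ^ 2 - 2 * c * x.1 1)) ^ 2 +
    ((2 * c - (1 + c ^ 2) * x.1 1) / (1 + c ^ 2 - 2 * c * x.1 1)) ^ 2 +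
    ((1 - c ^ 2) * x.1 2 / (1 + c ^ 2 - 2 * c * x.1 1)) ^ 2 +
    (-((1 - c ^ 2) * x.1 3) / (1 + c ^ 2 - 2 * c * x.1 1)) ^ 2 = 1 := by
  have hD := inversion_denom_pos h0 h1 x
  have hs := S3_sq_sum x
  simp only [div_pow]
  rw [← add_div, ← add_div, ← add_div, div_eq_one_iff_eq (pow_pos hD 2).ne']
  linear_combination (1 - c ^ 2) ^ 2 * hs

theorem continuous_inversion (h0 : 0 < c) (h1 : c < 1) : Continuous (inversion c) := by
  rw [← continuousOn_univ]
  have hD : ∀ x ∈ (univ : Set S3), 1 + c ^ 2 - 2 * c * x.1 1 ≠ 0 :=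
    fun x _ => (inversion_denom_pos h0 h1 x).ne'
  exact continuousOn_pt (ContinuousOn.div (by fun_prop) (by fun_prop) hD)
    (ContinuousOn.div (by fun_prop) (by fun_prop) hD)
    (ContinuousOn.div (by fun_prop) (by fun_prop) hD)
    (ContinuousOn.div (by fun_prop) (by fun_prop) hD) fun x _ => inversion_sum h0 h1 x

theorem inversion_one (h0 : 0 < c) (h1 : c < 1) (x : S3) : (inversion c x).1 1 =
    (2 * c - (1 + c ^ 2) * x.1 1) / (1 + c ^ 2 - 2 * c * x.1 1) := pt_one (inversion_sum h0 h1 x)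

theorem inversion_inversion (h0 : 0 < c) (h1 : c < 1) (x : S3) :
    inversion c (inversion c x) = x := by
  have hD := inversion_denom_pos h0 h1 x
  have hc : 0 < 1 - c ^ 2 := by nlinarith
  have e0 : (inversion c x).1 0 = _ := pt_zero (inversion_sum h0 h1 x)
  have e1 := inversion_one h0 h1 x
  have e2 : (inversion c x).1 2 = _ := pt_two (inversion_sum h0 h1 x)
  have e3 : (inversion c x).1 3 = _ := pt_three (inversion_sum h0 h1 x)
  have eD : 1 + c ^ 2 - 2 * c * (inversion c x).1 1 =
      (1 - c ^ 2) ^ 2 / (1 + c ^ 2 - 2 * c * x.1 1) := by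
    rw [e1, eq_div_iff hD.ne', sub_mul, mul_assoc (2 * c), div_mul_cancel₀ _ hD.ne']
    ring
  have key : ∀ a D : ℝ, 0 < D → (1 - c ^ 2) * ((1 - c ^ 2) * a / D) / ((1 - c ^ 2) ^ 2 / D) = a :=
    fun a D hD => by field_simp
  refine pt_eq ?_ ?_ ?_ ?_
  · rw [eD, e0, key _ _ hD]
  · rw [eD, e1, div_eq_iff (by positivity), sub_eq_iff_eq_add, ← sub_eq_iff_eq_add']
    field_simp; ring
  · rw [eD, e2, key _ _ hD]
  · rw [eD, e3]; refine Eq.trans ?_ (key (x.1 3) _ hD); ring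

theorem isEmbedding_inversion (h0 : 0 < c) (h1 : c < 1) : IsEmbedding (inversion c) :=
  Topology.IsEmbedding.of_leftInverse (f := inversion c) (inversion_inversion h0 h1)
    (continuous_inversion h0 h1) (continuous_inversion h0 h1)

theorem le_inversion_one (h0 : 0 < c) (h1 : c < 1) {x : S3} (hx : x.1 1 ≤ c) :
    c ≤ (inversion c x).1 1 := by
  have hc : 0 < 1 - c ^ 2 := by nlinarith
  rw [inversion_one h0 h1, le_div_iff₀ (inversion_denom_pos h0 h1 x)]
  nlinarith [mul_le_mul_of_nonneg_left hx hc.le]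

theorem lt_inversion_one (h0 : 0 < c) (h1 : c < 1) {x : S3} (hx : x.1 1 < c) :
    c < (inversion c x).1 1 := by
  have hc : 0 < 1 - c ^ 2 := by nlinarith
  rw [inversion_one h0 h1, lt_div_iff₀ (inversion_denom_pos h0 h1 x)]
  nlinarith [mul_lt_mul_of_pos_left hx hc]

theorem inversion_eq_reflection (h0 : 0 < c) (h1 : c < 1) {x : S3} (hx : x.1 1 = c) :
    inversion c x = reflection x := by
  have hc : 0 < 1 - c ^ 2 := by nlinarith
  have hD : 1 + c ^ 2 - 2 * c * x.1 1 = 1 - c ^ 2 := by rw [hx]; ring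
  refine pt_eq ?_ ?_ ?_ ?_
  · rw [hD, reflection_zero]; field_simp
  · rw [hD, reflection_one, hx, div_eq_iff hc.ne']; ring
  · rw [hD, reflection_two]; field_simp
  · rw [hD, reflection_three]; field_simp

end Inversion

/-! ### Lifting a cap to the cover -/

section CapLift

/-- The lift of the points with `x₁ > 0` of the standard layer to the sheet of the cover whose
angles lie in `(-π/2, π/2)`. -/
noncomputable def capLift (x : S3) : S3 × ℝ := (x, (transverse x).arg)

variable {J : Set S3} {f : S3 → Circle} {c r : ℝ}

theorem continuousOn_capLift : ContinuousOn capLift {x | 0 < x.1 1} := by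
  refine continuousOn_id.prodMk fun x hx => ?_
  refine ContinuousAt.comp_continuousWithinAt (g := Complex.arg) ?_
    continuous_transverse.continuousWithinAt
  exact Complex.continuousAt_arg (Or.inl hx)

theorem embedsOn_capLift : EmbedsOn capLift {x | 0 < x.1 1} :=
  embedsOn_of_leftInvOn (l := Prod.fst) (t := univ) continuousOn_capLift (fun _ _ => mem_univ _)
    continuousOn_fst fun _ _ => rfl

theorem CapSizes.abs_three_le (H : CapSizes c r) {x : S3} (hx : c ≤ x.1 1) :
    |x.1 3| ≤ 1 / 4 := by
  refine abs_le_of_sq_le_sq ?_ (by norm_num)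
  have h1 : c ^ 2 ≤ x.1 1 ^ 2 := pow_le_pow_left₀ H.pos.le hx 2
  nlinarith [S3_sq_sum x, H.near_one, sq_nonneg (x.1 0), sq_nonneg (x.1 2)]

theorem CapSizes.abs_arg_lt (H : CapSizes c r) {x : S3} (hx : c ≤ x.1 1) :
    |(transverse x).arg| < Real.pi / 4 := by
  have hx0 : 0 < x.1 1 := H.pos.trans_le hx
  have hw : transverse x ≠ 0 := fun h => hx0.ne' (congrArg Complex.re h)
  have hn : ‖transverse x‖ ≤ 1 := by
    have := norm_transverse_sq x
    exact (sq_le_one_iff₀ (norm_nonneg _)).1 (by nlinarith [sq_nonneg (x.1 0), sq_nonneg (x.1 3)])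
  have hcos : c ≤ Real.cos |(transverse x).arg| := by
    rw [Real.cos_abs, Complex.cos_arg hw]
    refine hx.trans ((le_div_iff₀ (norm_pos_iff.2 hw)).2 ?_)
    exact mul_le_of_le_one_right hx0.le hn
  by_contra h
  have h2 := Real.cos_le_cos_of_nonneg_of_le_pi (by positivity) (Complex.abs_arg_le_pi _)
    (not_lt.1 h)
  rw [Real.cos_pi_div_four] at h2
  have h3 : c ^ 2 ≤ (√2 / 2) ^ 2 := pow_le_pow_left₀ H.pos.le (hcos.trans h2) 2
  rw [div_pow, Real.sq_sqrt (by norm_num)] at h3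
  linarith [H.near_one]

theorem notMem_greatCircle_of_pos {x : S3} (hx : 0 < x.1 1) : x ∉ greatCircle :=
  fun h => hx.ne' h.1

theorem IsStdPair.capLift_mem (hJ : IsStdPair J f) (H : CapSizes c r) {x : S3} (hx : c ≤ x.1 1) :
    capLift x ∈ cov J f :=
  (hJ.mem_cov_iff (H.abs_three_le hx)).2 ⟨notMem_greatCircle_of_pos (H.pos.trans_le hx), rfl⟩

theorem IsStdPair.capLift_eq (hJ : IsStdPair J f) (H : CapSizes c r) {p : S3 × ℝ}
    (hp : p ∈ cov J f) (hx : c ≤ p.1.1 1) (ht : |p.2| ≤ Real.pi / 4) : capLift p.1 = p := by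
  have h1 : theta p.1 = Circle.exp p.2 := ((hJ.mem_cov_iff (H.abs_three_le hx)).1 hp).2
  have h2 := congrArg (fun z : Circle => (z : ℂ).arg) h1
  have hπ := Real.pi_pos
  rw [abs_le] at ht
  simp only [theta, dir] at h2
  rw [Circle.arg_exp (Complex.neg_pi_lt_arg _) (Complex.arg_le_pi _),
    Circle.arg_exp (by linarith) (by linarith)] at h2
  exact Prod.ext rfl h2

/-- Near the middle of the cap an embedding that agrees with the projection near the lift of that
point inverts the lift of a whole cap. -/
theorem IsStdPair.exists_cap (hJ : IsStdPair J f) {ι : S3 × ℝ → S3}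
    (h : ∀ᶠ y in 𝓝[cov J f] (capLift (pt 0 1 0 0)), ι y = y.1) :
    ∃ c r, CapSizes c r ∧ ∀ x : S3, c ≤ x.1 1 → ι (capLift x) = x := by
  have e0 : (pt 0 1 0 0).1 0 = 0 := pt_zero (by norm_num)
  have e1 : (pt 0 1 0 0).1 1 = 1 := pt_one (by norm_num)
  have e2 : (pt 0 1 0 0).1 2 = 0 := pt_two (by norm_num)
  have e3 : (pt 0 1 0 0).1 3 = 0 := pt_three (by norm_num)
  rw [eventually_nhdsWithin_iff] at h
  have hc : ContinuousAt capLift (pt 0 1 0 0) := by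
    refine continuousOn_capLift.continuousAt ((isOpen_lt continuous_const
      (continuous_S3_coord 1)).mem_nhds ?_)
    rw [mem_ofPred_eq, e1]; exact one_pos
  obtain ⟨ε, hε, hball⟩ := Metric.eventually_nhds_iff.1 (hc.eventually h)
  obtain ⟨c, r, hcc, H⟩ := exists_capSizes (c₀ := 1 - ε ^ 2 / 4) (by
    have : 0 < ε ^ 2 := by positivity
    linarith)
  refine ⟨c, r, H, fun x hx => hball ?_ (hJ.capLift_mem H hx)⟩
  refine lt_of_pow_lt_pow_left₀ 2 hε.le ?_
  rw [dist_sq_S3, e0, e1, e2, e3]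
  nlinarith [S3_sq_sum x, pow_pos hε 2]

end CapLift

/-! ### The two halves of the cover of a sum -/

section Gluing

variable {J J₁ J₂ : Set S3} {f f₁ f₂ : S3 → Circle} {c r : ℝ}

theorem IsStdPair.reflect (h : IsStdPair J f) :
    IsStdPair (reflection '' J) (f ∘ reflection) where
  layer x hx := by
    rw [mem_reflection_image, h.layer _ (by simpa using hx)]
    simp [greatCircle]
  angle x hx hxC := by
    have : reflection x ∉ greatCircle := by simpa [greatCircle] using hxC
    rw [Function.comp, h.angle _ (by simpa using hx) this]
    simp [theta, transverse]

/-- The reflection in the equatorial 2-sphere on covers. -/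
noncomputable def reflectCover (p : S3 × ℝ) : S3 × ℝ := (reflection p.1, p.2)

theorem isEmbedding_reflectCover : IsEmbedding reflectCover :=
  reflection.isEmbedding.prodMap IsEmbedding.id

theorem reflectCover_mem {p : S3 × ℝ} :
    reflectCover p ∈ cov (reflection '' J) (f ∘ reflection) ↔ p ∈ cov J f := by
  simp only [reflectCover, cov, mem_ofPred_eq, mem_reflection_image, reflection_reflection,
    Function.comp]

theorem reflectCover_mem' {p : S3 × ℝ} (h : p ∈ cov (reflection '' J) (f ∘ reflection)) :
    reflectCover p ∈ cov J f := by
  simpa only [reflectCover, cov, mem_ofPred_eq, mem_reflection_image, reflection_reflection,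
    Function.comp] using h

theorem isEmbedding_embedsOn {α β : Type*} [TopologicalSpace α] [TopologicalSpace β] {g : α → β}
    (hg : IsEmbedding g) (s : Set α) : EmbedsOn g s := hg.comp IsEmbedding.subtypeVal

/-- The upper part of the cover of the first summand, with its face squeezed to the boundary of the
lifted cap. -/
noncomputable def upperMap (c r : ℝ) (p : S3 × ℝ) : S3 × ℝ :=
  reflectCover (squeeze c r (reflectCover p))

/-- The lower part of the cover of the second summand: its face is squeezed to the boundary of the
lifted cap, it is embedded into the 3-sphere by `ι`, and turned into the cap by the inversion. -/
noncomputable def lowerMap (c r : ℝ) (ι : S3 × ℝ → S3) (p : S3 × ℝ) : S3 × ℝ :=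
  capLift (inversion c (ι (squeeze c r p)))

theorem IsStdPair.embedsOn_upperMap (H : CapSizes c r) (h : IsStdPair J f) :
    EmbedsOn (upperMap c r) (cov J f ∩ {p | 0 ≤ p.1.1 3}) := by
  refine EmbedsOn.comp (t := univ) (isEmbedding_embedsOn isEmbedding_reflectCover _)
    ((h.reflect.embedsOn_squeeze H).comp (isEmbedding_embedsOn isEmbedding_reflectCover _)
    fun p hp => ⟨reflectCover_mem.2 hp.1, ?_⟩) fun _ _ => mem_univ _
  have : 0 ≤ p.1.1 3 := hp.2
  simpa [reflectCover] using this

theorem IsStdPair.upperMap_mem (H : CapSizes c r) (h : IsStdPair J f) {p : S3 × ℝ}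
    (hp : p ∈ cov J f) (h0 : 0 ≤ p.1.1 3) : upperMap c r p ∈ cov J f :=
  reflectCover_mem' (h.reflect.mapsTo_squeeze H
    ⟨reflectCover_mem.2 hp, by simpa [reflectCover] using h0⟩)

theorem IsStdPair.upperMap_notMem_cap (H : CapSizes c r) (h : IsStdPair J f) {p : S3 × ℝ}
    (hp : p ∈ cov J f) (h0 : 0 < p.1.1 3) (ht : |(upperMap c r p).2| ≤ Real.pi / 4) :
    (upperMap c r p).1.1 1 < c := by
  have := h.reflect.squeeze_notMem_cap H (reflectCover_mem.2 hp) (by simpa [reflectCover] using h0)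
    ht
  simpa [upperMap, reflectCover] using this

/-- The image of the lower part of the cover in the 3-sphere stays off the cap. -/
theorem IsStdPair.inclusion_one_lt (H : CapSizes c r) (h : IsStdPair J f) {ι : S3 × ℝ → S3}
    (hι : EmbedsOn ι (cov J f)) (hcap : ∀ x : S3, c ≤ x.1 1 → ι (capLift x) = x) {p : S3 × ℝ}
    (hp : p ∈ cov J f) (h0 : p.1.1 3 < 0) : (ι (squeeze c r p)).1 1 < c := by
  by_contra h1
  have h1 := not_lt.1 h1
  have h2 : capLift (ι (squeeze c r p)) = squeeze c r p :=
    hι.injOn (h.capLift_mem H h1) (h.mapsTo_squeeze H ⟨hp, h0.le⟩) (hcap _ h1)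
  have h3 := h.squeeze_notMem_cap H hp h0
  rw [← h2] at h3
  exact absurd (h3 (H.abs_arg_lt h1).le) (not_lt.2 h1)

/-- On the face the embedding `ι` is the projection, since the face is squeezed to the boundary of
the lifted cap. -/
theorem IsStdPair.inclusion_eq (H : CapSizes c r) (h : IsStdPair J f) {ι : S3 × ℝ → S3}
    (hcap : ∀ x : S3, c ≤ x.1 1 → ι (capLift x) = x) {p : S3 × ℝ}
    (hp : p ∈ cov J f) (h0 : p.1.1 3 = 0) : ι (squeeze c r p) = (squeeze c r p).1 := by
  obtain ⟨h1, h2⟩ := h.squeeze_mem_cap H hp h0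
  have h3 := h.capLift_eq H (h.mapsTo_squeeze H ⟨hp, h0.le⟩) h2.ge h1.le
  conv_lhs => rw [← h3]
  exact hcap _ h2.ge

theorem IsStdPair.le_inversion_inclusion (H : CapSizes c r) (h : IsStdPair J f) {ι : S3 × ℝ → S3}
    (hι : EmbedsOn ι (cov J f)) (hcap : ∀ x : S3, c ≤ x.1 1 → ι (capLift x) = x) {p : S3 × ℝ}
    (hp : p ∈ cov J f) (h0 : p.1.1 3 ≤ 0) : c ≤ (inversion c (ι (squeeze c r p))).1 1 := by
  refine le_inversion_one H.pos H.lt_one ?_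
  rcases h0.eq_or_lt with h1 | h1
  · rw [h.inclusion_eq H hcap hp h1]
    exact (h.squeeze_mem_cap H hp h1).2.le
  · exact (h.inclusion_one_lt H hι hcap hp h1).le

theorem IsStdPair.embedsOn_lowerMap (H : CapSizes c r) (h : IsStdPair J f) {ι : S3 × ℝ → S3}
    (hι : EmbedsOn ι (cov J f)) (hcap : ∀ x : S3, c ≤ x.1 1 → ι (capLift x) = x) :
    EmbedsOn (lowerMap c r ι) (cov J f ∩ {p | p.1.1 3 ≤ 0}) :=
  embedsOn_capLift.comp (g := fun p => inversion c (ι (squeeze c r p)))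
    ((isEmbedding_embedsOn (isEmbedding_inversion H.pos H.lt_one) univ).comp
      (hι.comp (h.embedsOn_squeeze H) (h.mapsTo_squeeze H)) fun _ _ => mem_univ _)
    fun _ hp => H.pos.trans_le (h.le_inversion_inclusion H hι hcap hp.1 hp.2)

/-- The upper and the lower map agree over the equatorial 2-sphere. -/
theorem upperMap_eq_lowerMap (H : CapSizes c r) (h₁ : IsStdPair J₁ f₁) (h₂ : IsStdPair J₂ f₂)
    {ι : S3 × ℝ → S3} (hcap : ∀ x : S3, c ≤ x.1 1 → ι (capLift x) = x) {p : S3 × ℝ}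
    (hp₁ : p ∈ cov J₁ f₁) (hp : p ∈ cov J₂ f₂) (h0 : p.1.1 3 = 0) :
    upperMap c r p = lowerMap c r ι p := by
  have hr : reflectCover p = p := by
    refine Prod.ext (S3_ext ?_ ?_ ?_ ?_) rfl <;> simp [reflectCover, h0]
  obtain ⟨h1, h2⟩ := h₂.squeeze_mem_cap H hp h0
  have h3 := h₁.upperMap_mem H hp₁ h0.ge
  rw [lowerMap, h₂.inclusion_eq H hcap hp h0, inversion_eq_reflection H.pos H.lt_one h2]
  rw [upperMap, hr] at h3 ⊢
  refine (h₁.capLift_eq H h3 ?_ h1.le).symm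
  simpa [reflectCover] using h2.ge

end Gluing

/-! ### The cover of a connected sum -/

section SumCover

variable {J J₁ J₂ : Set S3}

/-- The cover of a sum is the union of the upper part of the cover of the first summand and the
lower part of the cover of the second one. The latter fits into the hole that the squeezing of the
former leaves in the cover of the first summand. -/
theorem IsSum.hasEmbeddedCover (h : IsSum J J₁ J₂) {N N₁ N₂ : Circle × ℂ → S3} (hN : IsTube N J)
    (hN₁ : IsTube N₁ J₁) (hN₂ : IsTube N₂ J₂) (hJ₁ : HasEmbeddedCover J₁)
    (hJ₂ : ∃ f : S3 → Circle, ContinuousOn f J₂ᶜ ∧ IsConnected (cov J₂ f) ∧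
      HasLocalProjections J₂ f) : HasEmbeddedCover J := by
  classical
  obtain ⟨f₁', hf₁', hc₁', e, he⟩ := hJ₁
  obtain ⟨f₁, hf₁, ha₁, g₁, hg₁, hm₁, -⟩ := h.isStdLayer_left.exists_normalization hN₁ hf₁' hc₁'
  obtain ⟨f₂', hf₂', hc₂', hL⟩ := hJ₂
  obtain ⟨f₂, hf₂, ha₂, g₂, hg₂, hm₂, hg₂'⟩ :=
    h.isStdLayer_right.exists_normalization hN₂ hf₂' hc₂'
  have h₁ : IsStdPair J₁ f₁ := ⟨h.isStdLayer_left, ha₁⟩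
  have h₂ : IsStdPair J₂ f₂ := ⟨h.isStdLayer_right, ha₂⟩
  have hL₂ : HasLocalProjections J₂ f₂ :=
    hL.of_embedsOn (Homeomorph.refl S3) hg₂ hm₂ hg₂'
  -- the embedding of the second cover is taken to be the projection near the lift of the middle of
  -- the cap
  have hmid : capLift (pt 0 1 0 0) ∈ cov J₂ f₂ := by
    refine (h₂.mem_cov_iff ?_).2 ⟨notMem_greatCircle_of_pos ?_, rfl⟩
    · rw [pt_three (by norm_num)]; norm_num
    · rw [pt_one (by norm_num)]; exact one_pos
  obtain ⟨ι, hι, hev⟩ := hL₂ _ hmid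
  obtain ⟨c, r, H, hcap⟩ := h₂.exists_cap hev
  let f : S3 → Circle := fun x => if 0 ≤ x.1 3 then f₁ x else f₂ x
  have hup : ∀ x : S3, 0 ≤ x.1 3 → f x = f₁ x := fun x hx => if_pos hx
  have hlow : ∀ x : S3, x.1 3 ≤ 0 → x ∉ J → f x = f₂ x := fun x hx hxJ => by
    rcases hx.eq_or_lt with h0 | h0
    · have h4 : |x.1 3| ≤ 1 / 4 := by rw [h0]; norm_num
      have hC : x ∉ greatCircle := (h₂.notMem_iff h4).1 (fun hh => hxJ ((h.mem_lower hx).2 hh))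
      rw [hup x h0.ge, ha₁ x h4 hC, ha₂ x h4 hC]
    · exact if_neg (not_le.2 h0)
  have hcu : ∀ p : S3 × ℝ, 0 ≤ p.1.1 3 → (p ∈ cov J f ↔ p ∈ cov J₁ f₁) := fun p hp => by
    simp only [cov, mem_ofPred_eq, h.mem_upper hp, hup _ hp]
  have hcl : ∀ p : S3 × ℝ, p.1.1 3 ≤ 0 → (p ∈ cov J f ↔ p ∈ cov J₂ f₂) := fun p hp => by
    simp only [cov, mem_ofPred_eq]
    rw [h.mem_lower hp]
    exact and_congr_right fun hJ => by rw [hlow _ hp fun hh => hJ ((h.mem_lower hp).1 hh)]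
  have hcont : ContinuousOn f Jᶜ := by
    refine continuousOn_of_closed_cover (A := {x | 0 ≤ x.1 3}) (B := {x | x.1 3 ≤ 0})
      (isClosed_le continuous_const (continuous_S3_coord 3))
      (isClosed_le (continuous_S3_coord 3) continuous_const) (fun x _ => le_total 0 (x.1 3)) ?_ ?_
    · refine (hf₁.mono fun x hx => ?_).congr fun x hx => hup x hx.2
      exact fun hh => hx.1 ((h.mem_upper hx.2).2 hh)
    · refine (hf₂.mono fun x hx => ?_).congr fun x hx => hlow x hx.2 hx.1
      exact fun hh => hx.1 ((h.mem_lower hx.2).2 hh)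
  -- near the pole the glued map is the angle around the great circle, which has no roots
  have hconn : IsConnected (cov J f) := by
    refine (hN.isConnected_cov_iff hcont h.isStdLayer.pole_mem).2 fun n hn hroot => ?_
    refine not_hasLocalRoot_theta hn (h.isStdLayer.hasLocalRoot_congr (J' := greatCircle)
      (fun _ _ => Iff.rfl) (r := 1 / 4) (by norm_num) (by norm_num) (fun x hx hxC => ?_) hroot)
    rcases le_total 0 (x.1 3) with h0 | h0
    · rw [hup x h0, ha₁ x hx.le hxC]
    · rw [hlow x h0 (fun hh => hxC ((h.isStdLayer x (by linarith)).1 hh)), ha₂ x hx.le hxC]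
  -- `Ω` embeds the cover of the sum into the cover of the first summand; the upper part goes
  -- outside the open lifted cap (`P` below), the lower part inside the closed one (`Q`)
  let Ω : S3 × ℝ → S3 × ℝ := fun p => if 0 ≤ p.1.1 3 then upperMap c r p else lowerMap c r ι p
  have hΩu : ∀ p : S3 × ℝ, 0 ≤ p.1.1 3 → Ω p = upperMap c r p := fun p hp => if_pos hp
  have hΩl : ∀ p ∈ cov J f, p.1.1 3 ≤ 0 → Ω p = lowerMap c r ι p := fun p hp hx => by
    rcases hx.eq_or_lt with h0 | h0
    · rw [hΩu p h0.ge]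
      exact upperMap_eq_lowerMap H h₁ h₂ hcap ((hcu p h0.ge).1 hp) ((hcl p hx).1 hp) h0
    · exact if_neg (not_le.2 h0)
  have hcapl : ∀ p ∈ cov J f, p.1.1 3 ≤ 0 → c ≤ (Ω p).1.1 1 ∧ |(Ω p).2| < Real.pi / 4 :=
    fun p hp hx => by
      have h5 := h₂.le_inversion_inclusion H hι hcap ((hcl p hx).1 hp) hx
      rw [hΩl p hp hx]
      exact ⟨h5, H.abs_arg_lt h5⟩
  have hΩm : MapsTo Ω (cov J f) (cov J₁ f₁) := fun p hp => by
    rcases le_total 0 (p.1.1 3) with h0 | h0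
    · rw [hΩu p h0]
      exact h₁.upperMap_mem H ((hcu p h0).1 hp) h0
    · rw [hΩl p hp h0]
      exact h₁.capLift_mem H (h₂.le_inversion_inclusion H hι hcap ((hcl p h0).1 hp) h0)
  have c3 : Continuous fun p : S3 × ℝ => p.1.1 3 := (continuous_S3_coord 3).comp continuous_fst
  have c1 : Continuous fun p : S3 × ℝ => p.1.1 1 := (continuous_S3_coord 1).comp continuous_fst
  have c2 : Continuous fun p : S3 × ℝ => |p.2| := by fun_prop
  have hΩ : EmbedsOn Ω (cov J f) := by
    refine embedsOn_of_closed_cover (A := {p | 0 ≤ p.1.1 3}) (B := {p | p.1.1 3 ≤ 0})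
      (P := {p | c < p.1.1 1 ∧ |p.2| < Real.pi / 4}ᶜ) (Q := {p | c ≤ p.1.1 1 ∧ |p.2| ≤ Real.pi / 4})
      (isClosed_le continuous_const c3) (isClosed_le c3 continuous_const)
      (fun p _ => le_total 0 (p.1.1 3)) ?_ ?_
      ((isOpen_lt continuous_const c1).inter (isOpen_lt c2 continuous_const)).isClosed_compl
      ((isClosed_le continuous_const c1).inter (isClosed_le c2 continuous_const)) ?_ ?_ ?_ ?_
    · refine ((h₁.embedsOn_upperMap H).mono ?_).congr fun p hp => hΩu p hp.2
      exact fun p hp => ⟨(hcu p hp.2).1 hp.1, hp.2⟩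
    · refine ((h₂.embedsOn_lowerMap H hι hcap).mono ?_).congr fun p hp => hΩl p hp.1 hp.2
      exact fun p hp => ⟨(hcl p hp.2).1 hp.1, hp.2⟩
    · rintro p ⟨hp, h0 : 0 ≤ p.1.1 3⟩ ⟨h5, h6⟩
      rw [hΩu p h0] at h5 h6
      rcases h0.eq_or_lt with h7 | h7
      · have h8 := (h₂.squeeze_mem_cap H ((hcl p h7.ge).1 hp) h7.symm).2
        have hr : reflectCover p = p := by
          refine Prod.ext (S3_ext ?_ ?_ ?_ ?_) rfl <;> simp [reflectCover, ← h7]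
        rw [upperMap, hr] at h5
        simp only [reflectCover, reflection_one] at h5
        exact absurd h8 h5.ne'
      · exact absurd h5 (not_lt.2 (h₁.upperMap_notMem_cap H ((hcu p h0).1 hp) h7 h6.le).le)
    · rintro p ⟨hp, h0⟩
      exact ⟨(hcapl p hp h0).1, (hcapl p hp h0).2.le⟩
    · rintro p hp hx ⟨h5, h6⟩
      have h0 : 0 < p.1.1 3 := not_le.1 hx
      rw [hΩu p h0.le] at h5 h6
      exact absurd h5 (not_le.2 (h₁.upperMap_notMem_cap H ((hcu p h0.le).1 hp) h0 h6))
    · rintro p hp hx h5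
      have h0 : p.1.1 3 < 0 := not_le.1 hx
      refine h5 ⟨?_, (hcapl p hp h0.le).2⟩
      rw [hΩl p hp h0.le]
      exact lt_inversion_one H.pos H.lt_one
        (h₂.inclusion_one_lt H hι hcap ((hcl p h0.le).1 hp) h0)
  exact ⟨f, hcont, hconn, (e ∘ g₁) ∘ Ω, (he.comp hg₁ hm₁).comp hΩ hΩm⟩

end SumCover

/-! ### Fibred knots and ambient isotopies -/

section FibredSummands

/-- Connectedness of a cover and local projections are preserved by homeomorphisms of the
3-sphere. -/
theorem exists_hasLocalProjections_image {J : Set S3} (Φ : S3 ≃ₜ S3)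
    (h : ∃ f : S3 → Circle, ContinuousOn f Jᶜ ∧ IsConnected (cov J f) ∧
      HasLocalProjections J f) :
    ∃ f : S3 → Circle, ContinuousOn f (Φ '' J)ᶜ ∧ IsConnected (cov (Φ '' J) f) ∧
      HasLocalProjections (Φ '' J) f := by
  obtain ⟨f, hf, hc, hL⟩ := h
  have hm : ∀ x, x ∈ Φ '' J ↔ Φ.symm x ∈ J := fun x => by
    rw [Φ.image_eq_preimage_symm]; rfl
  have hcov : cov (Φ '' J) (f ∘ Φ.symm) = (fun p : S3 × ℝ => (Φ.symm p.1, p.2)) ⁻¹' cov J f := by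
    ext p
    simp only [cov, mem_preimage, mem_ofPred_eq, hm, Function.comp]
  refine ⟨f ∘ Φ.symm, hf.comp Φ.symm.continuous.continuousOn fun x hx => ?_, ?_, ?_⟩
  · exact fun h => hx ((hm x).2 h)
  · rw [hcov]
    exact (Φ.symm.prodCongr (Homeomorph.refl ℝ)).isConnected_preimage.2 hc
  · refine hL.of_embedsOn Φ (g := fun p => (Φ.symm p.1, p.2)) ?_ (fun p hp => ?_)
      fun y => Φ.apply_symm_apply y.1
    · exact isEmbedding_embedsOn (Φ.symm.isEmbedding.prodMap IsEmbedding.id) _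
    · rw [hcov] at hp; exact hp

theorem Knot.IsFibred.exists_hasLocalProjections {k : Knot} (h : k.IsFibred) :
    ∃ f : S3 → Circle, ContinuousOn f k.carrierᶜ ∧ IsConnected (cov k.carrier f) ∧
      HasLocalProjections k.carrier f := by
  obtain ⟨N, hN, F, _, _, _, _, _, q, hq⟩ := h
  exact hN.exists_hasLocalProjections hq

theorem AmbientIsotopic.exists_homeomorph {A B : Set S3} (h : AmbientIsotopic A B) :
    ∃ Φ : S3 ≃ₜ S3, Φ '' A = B := by
  obtain ⟨H, -, -, h1⟩ := h
  exact ⟨H 1, h1⟩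

theorem hasEmbeddedCover_image_iff {J : Set S3} (Φ : S3 ≃ₜ S3) :
    HasEmbeddedCover (Φ '' J) ↔ HasEmbeddedCover J := by
  refine ⟨fun h => ?_, fun h => h.image_homeomorph Φ⟩
  have := h.image_homeomorph Φ.symm
  rwa [Φ.symm.image_eq_preimage_symm, Homeomorph.symm_symm,
    Φ.injective.preimage_image] at this

end FibredSummands

end KnotIE

theorem lemma4p1 (k k₁ k₂ : KnotIE.Knot) (hk : KnotIE.IsConnectedSum k k₁ k₂) :
    (k.PropertyIE → k₁.PropertyIE ∧ k₂.PropertyIE) ∧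
      (k₁.PropertyIE → k₂.IsFibred → k.PropertyIE) := by
  obtain ⟨_, _, _, h, h₁, h₂, h3, h4, h5, h6⟩ := hk
  obtain ⟨Φ, rfl⟩ := h.exists_homeomorph
  obtain ⟨Φ₁, rfl⟩ := h₁.exists_homeomorph
  obtain ⟨Φ₂, rfl⟩ := h₂.exists_homeomorph
  have hs : KnotIE.IsSum (Φ '' k.carrier) (Φ₁ '' k₁.carrier) (Φ₂ '' k₂.carrier) :=
    ⟨h3, h4, h5, h6⟩
  obtain ⟨N, hN⟩ := k.tame
  obtain ⟨N₁, hN₁⟩ := k₁.tame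
  obtain ⟨N₂, hN₂⟩ := k₂.tame
  have hN := hN.image_homeomorph Φ
  have hN₁ := hN₁.image_homeomorph Φ₁
  have hN₂ := hN₂.image_homeomorph Φ₂
  simp only [KnotIE.Knot.propertyIE_iff]
  refine ⟨fun hk => ?_, fun hk₁ hk₂ => ?_⟩
  · rw [← KnotIE.hasEmbeddedCover_image_iff Φ] at hk
    exact ⟨(KnotIE.hasEmbeddedCover_image_iff Φ₁).1 (hs.hasEmbeddedCover_left hN hN₁ hk),
      (KnotIE.hasEmbeddedCover_image_iff Φ₂).1 (hs.hasEmbeddedCover_right hN hN₂ hk)⟩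
  · rw [← KnotIE.hasEmbeddedCover_image_iff Φ₁] at hk₁
    exact (KnotIE.hasEmbeddedCover_image_iff Φ).1 (hs.hasEmbeddedCover hN hN₁ hN₂ hk₁
      (KnotIE.exists_hasLocalProjections_image Φ₂ hk₂.exists_hasLocalProjections))
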